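/- All manifolds and maps are smooth; manifolds are finite-dimensional, Hausdorff and second countable. **Setting.** Let $\mathcal Q$ be a manifold and $(\mathcal V,\partial^+,\partial^-)$ a discrete tangent bundle of $\mathcal Q$: $\mathcal V$ is a manifold with $\dim\mathcal V=2\dim\mathcal Q$, the maps $\partial^\pm\colon\mathcal V\to\mathcal Q$ are submersions with $\ker T\partial^+\cap\ker T\partial^-=0$, and for each $m\in\mathcal Q$ there is exactly one $v\in\mathcal V$ with $\partial^+(v)=\partial^-(v)=m$. A discrete constrained Lagrangian system (DCLS) $(\mathcal V,\sigma_d,\mathcal D_d,\mathcal E_d)$ consists of such a $\mathcal V$, a one-form $\sigma_d$ on $\mathcal V$, an (embedded) submanifold $\mathcal D_d\subseteq\mathcal V$ such that $\partial^\pm|\mathcal D_d$ are submersions, and a subbundle $\mathcal E_d$ of $(\partial^+|\mathcal D_d)^*T\mathcal Q$. It has linear constraints, with constraint distribution $\mathcal D_d^{\mathcal Q}$ (a distribution on $\mathcal Q$ of constant fiber dimension $r$), if for all $v\in\mathcal D_d$ one has $(\mathcal E_d)_v=(\mathcal D_d^{\mathcal Q})_{\partial^+(v)}$, the points $\partial^-(v)$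 and $\partial^+(v)$ can be joined by a piecewise smooth curve with velocities in $\mathcal D_d^{\mathcal Q}$, and $\dim\mathcal D_d=\dim\mathcal Q+r$. For $N\ge 1$, put $$\mathcal C_{d,N}=\{w\in\mathcal V^N:\partial^+(w(k))=\partial^-(w(k+1)),\ 1\le k<N\},\qquad \mathcal N_{d,N}=\{w\in\mathcal C_{d,N}: w(k)\in\mathcal D_d\text{ for all }k\},$$ and, for $w\in\mathcal N_{d,N}$, $$(\mathcal W_{d,N})_w=\{\delta w\in T_w\mathcal C_{d,N}: T\partial^-(\delta w(1))=0,\ T\partial^+(\delta w(N))=0,\ T\partial^+(\delta w(k))\in(\mathcal E_d)_{w(k)}\text{ for all }k\}.$$ A distribution is involutive if the Lie bracket of any two local vector fields with values in it again has values in it; for $\mathcal W_{d,N}$, which is given only at the points of $\mathcal N_{d,N}$, this means: if $X,Y$ are local vector fields on $\mathcal C_{d,N}$ with $X(w),Y(w)\in(\mathcal W_{d,N})_w$ at all points $w\in\mathcal N_{d,N}$ of their domain, then $[X,Y](w)\in(\mathcal W_{d,N})_w$ at these points. **Theorem.** Consider a DCLS with linear constraint distribution $\mathcal D_d^{\mathcal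 Q}$, such that for every $q\in\mathcal Q$ there are $v,\tilde v\in\mathcal D_d$ with $\partial^+(v)=q=\partial^-(\tilde v)$, and let $N\ge2$. The following are equivalent: 1. $\mathcal D_d^{\mathcal Q}$ is involutive; 2. $\mathcal W_{d,N}$ is involutive; 3. $\mathcal W_{d,N}=\{\delta w\in T\mathcal N_{d,N}: T\partial^-(\delta w(1))=0,\ T\partial^+(\delta w(N))=0\}$; 4. $\mathcal W_{d,N}\subseteq T\mathcal N_{d,N}$, i.e. the discrete problem (find points of $\mathcal N_{d,N}$ where $\Sigma_{d,N}(w)\,\delta w=\sum_{k=1}^N\sigma_d(w(k))\,\delta w(k)$ annihilates $\mathcal W_{d,N}$) is variational, in the sense that the tangent bundle of the constraint contains the distribution of variations. -/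

import Mathlib

open scoped Manifold ContDiff Topology

noncomputable section

namespace DiscreteMechanics

section Power

variable {E : Type*} [NormedAddCommGroup E] [NormedSpace ℝ E]
  {V : Type*} [TopologicalSpace V] [ChartedSpace E V]

/-- The model with corners of the finite power `V[1,N] = V × ⋯ × V` (`N` factors). -/
abbrev powModel (E : Type*) [NormedAddCommGroup E] [NormedSpace ℝ E] (N : ℕ) :
    ModelWithCorners ℝ (Fin N → E) (ModelPi fun _ : Fin N => E) :=
  ModelWithCorners.pi fun _ : Fin N => 𝓘(ℝ, E)

/-- A finite power of a smooth manifold is a smooth manifold. -/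
instance instIsManifoldPow (N : ℕ) (n : WithTop ℕ∞) [IsManifold 𝓘(ℝ, E) n V] :
    IsManifold (powModel E N) n (Fin N → V) := by
  apply isManifold_of_contDiffOn
  rintro e e' ⟨f, hf, rfl⟩ ⟨f', hf', rfl⟩
  refine contDiffOn_pi.2 fun i => ?_
  have h := (contDiffGroupoid n 𝓘(ℝ, E)).compatible (hf i trivial) (hf' i trivial)
  rw [contDiffGroupoid, mem_groupoid_of_pregroupoid] at h
  have h1 : ContDiffOn ℝ n ((f i).symm ≫ₕ f' i) ((f i).symm ≫ₕ f' i).source := by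
    simpa [contDiffPregroupoid] using h.1
  have h2 : ContDiff ℝ n (fun x : Fin N → E => x i) := contDiff_apply ℝ E i
  refine h1.comp h2.contDiffOn ?_
  rintro x ⟨⟨hx1, hx2⟩, -⟩
  exact ⟨hx1 i trivial, hx2 i trivial⟩

end Power

section Tangent

variable {E : Type*} [NormedAddCommGroup E] [NormedSpace ℝ E]
  {H : Type*} [TopologicalSpace H] (I : ModelWithCorners ℝ E H)
  {M : Type*} [TopologicalSpace M] [ChartedSpace H M]

/-- The velocity at time `0` of a curve `c` in `M`, as a point of the tangent bundle. -/
def velocity (c : ℝ → M) : TangentBundle I M :=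
  ⟨c 0, mfderiv 𝓘(ℝ, ℝ) I c 0 (1 : ℝ)⟩

/-- The tangent vectors to a subset `S` of `M`: velocities of curves in `S`. For an embedded
submanifold `S` this is the tangent bundle `TS`, as a subset of `TM`. -/
def tangentTo (S : Set M) : Set (TangentBundle I M) :=
  {δ | ∃ c : ℝ → M, MDifferentiableAt 𝓘(ℝ, ℝ) I c 0 ∧ (∀ᶠ t in 𝓝 (0 : ℝ), c t ∈ S) ∧
    velocity I c = δ}

/-- The vector field `X` is smooth on the set `U`. -/
def SmoothFieldOn [IsManifold I 1 M] (X : ∀ x : M, TangentSpace I x) (U : Set M) : Prop :=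
  ContMDiffOn I I.tangent ∞ (fun x => (⟨x, X x⟩ : TangentBundle I M)) U

/-- `F` is a smooth distribution (subbundle of `TM`) of fiber dimension `r`. -/
def IsSmoothDistribution [IsManifold I 1 M] (F : ∀ x : M, Submodule ℝ (TangentSpace I x))
    (r : ℕ) : Prop :=
  ∀ x₀ : M, ∃ U : Set M, IsOpen U ∧ x₀ ∈ U ∧ ∃ X : Fin r → ∀ x : M, TangentSpace I x,
    (∀ i, SmoothFieldOn I (X i) U) ∧
    ∀ x ∈ U, LinearIndependent ℝ (fun i => X i x) ∧
      Submodule.span ℝ (Set.range fun i => X i x) = F x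

/-- The distribution `F` on `M` is involutive: the Lie bracket of (local) smooth vector fields
with values in `F` has values in `F`. -/
def IsInvolutive [IsManifold I 1 M] (F : ∀ x : M, Submodule ℝ (TangentSpace I x)) : Prop :=
  ∀ U : Set M, IsOpen U → ∀ X Y : ∀ x : M, TangentSpace I x,
    SmoothFieldOn I X U → SmoothFieldOn I Y U →
    (∀ x ∈ U, X x ∈ F x) → (∀ x ∈ U, Y x ∈ F x) →
    ∀ x ∈ U, VectorField.mlieBracket I X Y x ∈ F x

/-- Involutivity of a family `W` of tangent vectors to a submanifold `C` of `M` which is given only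
at the points of a subset `S` of `C`: the Lie bracket of (local) smooth vector fields on `C` with
values in `W` (at the points of `S`, where `W` is given) has values in `W`. A vector field on `C`
is written as the restriction of a vector field on `M` that is tangent to `C`. -/
def IsInvolutiveAlong [IsManifold I 1 M] (C S : Set M) (W : Set (TangentBundle I M)) : Prop :=
  ∀ U : Set M, IsOpen U → ∀ X Y : ∀ x : M, TangentSpace I x,
    SmoothFieldOn I X U → SmoothFieldOn I Y U →
    (∀ x ∈ U ∩ C, (⟨x, X x⟩ : TangentBundle I M) ∈ tangentTo I C) →
    (∀ x ∈ U ∩ C, (⟨x, Y x⟩ : TangentBundle I M) ∈ tangentTo I C) →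
    (∀ x ∈ U ∩ S, (⟨x, X x⟩ : TangentBundle I M) ∈ W) →
    (∀ x ∈ U ∩ S, (⟨x, Y x⟩ : TangentBundle I M) ∈ W) →
    ∀ x ∈ U ∩ S, (⟨x, VectorField.mlieBracket I X Y x⟩ : TangentBundle I M) ∈ W

/-- There is a smooth curve segment from `x` to `y` whose velocities lie in `F`. -/
def SmoothArc (F : ∀ x : M, Submodule ℝ (TangentSpace I x)) (x y : M) : Prop :=
  ∃ (a b : ℝ) (c : ℝ → M), a < b ∧ ContMDiffOn 𝓘(ℝ, ℝ) I ∞ c (Set.Icc a b) ∧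
    (∀ t ∈ Set.Icc a b, mfderivWithin 𝓘(ℝ, ℝ) I c (Set.Icc a b) t (1 : ℝ) ∈ F (c t)) ∧
    c a = x ∧ c b = y

/-- `y` is `F`-reachable from `x`: there is a piecewise smooth curve from `x` to `y` (a finite
concatenation of smooth curve segments) whose velocities lie in `F`. -/
def Reachable (F : ∀ x : M, Submodule ℝ (TangentSpace I x)) : M → M → Prop :=
  Relation.ReflTransGen (SmoothArc I F)

end Tangent

/-- `S` is an embedded smooth submanifold of `M` of dimension `d`: near each of its points there
is a chart of `M` that straightens `S` to a `d`-dimensional linear subspace. -/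
def IsEmbeddedSubmanifold {E : Type*} [NormedAddCommGroup E] [NormedSpace ℝ E]
    {M : Type*} [TopologicalSpace M] [ChartedSpace E M] (S : Set M) (d : ℕ) : Prop :=
  ∀ x ∈ S, ∃ φ ∈ IsManifold.maximalAtlas 𝓘(ℝ, E) ∞ M, x ∈ φ.source ∧
    ∃ L : Submodule ℝ E, Module.finrank ℝ L = d ∧ ∀ y ∈ φ.source, y ∈ S ↔ φ y ∈ L

section Discrete

variable (A : Type*) [NormedAddCommGroup A] [NormedSpace ℝ A]
  (Q : Type*) [TopologicalSpace Q] [ChartedSpace A Q] [IsManifold 𝓘(ℝ, A) ∞ Q]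
  (B : Type*) [NormedAddCommGroup B] [NormedSpace ℝ B]
  (V : Type*) [TopologicalSpace V] [ChartedSpace B V] [IsManifold 𝓘(ℝ, B) ∞ V]

/-- A discrete tangent bundle `(V, ∂⁺, ∂⁻)` of the manifold `Q`. The manifolds `Q` and `V` are
modelled on the (finite-dimensional) spaces `A` and `B`. -/
structure DiscreteTangentBundle where
  /-- the map `∂⁺` -/
  dPlus : V → Q
  /-- the map `∂⁻` -/
  dMinus : V → Q
  dim_eq : Module.finrank ℝ B = 2 * Module.finrank ℝ A
  smooth_dPlus : ContMDiff 𝓘(ℝ, B) 𝓘(ℝ, A) ∞ dPlus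
  smooth_dMinus : ContMDiff 𝓘(ℝ, B) 𝓘(ℝ, A) ∞ dMinus
  submersion_dPlus : ∀ v, Function.Surjective (mfderiv 𝓘(ℝ, B) 𝓘(ℝ, A) dPlus v)
  submersion_dMinus : ∀ v, Function.Surjective (mfderiv 𝓘(ℝ, B) 𝓘(ℝ, A) dMinus v)
  ker_inf_ker : ∀ (v : V) (δ : TangentSpace 𝓘(ℝ, B) v),
    mfderiv 𝓘(ℝ, B) 𝓘(ℝ, A) dPlus v δ = 0 → mfderiv 𝓘(ℝ, B) 𝓘(ℝ, A) dMinus v δ = 0 → δ = 0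
  existsUnique_zero : ∀ m : Q, ∃! v : V, dPlus v = m ∧ dMinus v = m

/-- A discrete constrained Lagrangian system `(V, σ_d, D_d, E_d)`. -/
structure DCLS extends DiscreteTangentBundle A Q B V where
  /-- the one-form `σ_d` on `V` -/
  σ : ∀ v : V, TangentSpace 𝓘(ℝ, B) v →L[ℝ] ℝ
  smooth_σ : ContMDiff 𝓘(ℝ, B).tangent 𝓘(ℝ, ℝ) ∞
    (fun δ : TangentBundle 𝓘(ℝ, B) V => σ δ.1 δ.2)
  /-- the discrete velocity constraint `D_d` -/
  D : Set V
  /-- the dimension of `D_d` -/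
  dimD : ℕ
  submanifold_D : IsEmbeddedSubmanifold (E := B) D dimD
  /-- the restriction of `∂⁺` to `D_d` is a submersion -/
  submersion_dPlus_D : ∀ v ∈ D, ∀ u : TangentSpace 𝓘(ℝ, A) (dPlus v),
    ∃ δ : TangentSpace 𝓘(ℝ, B) v,
      (⟨v, δ⟩ : TangentBundle 𝓘(ℝ, B) V) ∈ tangentTo 𝓘(ℝ, B) D ∧
      mfderiv 𝓘(ℝ, B) 𝓘(ℝ, A) dPlus v δ = u
  /-- the restriction of `∂⁻` to `D_d` is a submersion -/
  submersion_dMinus_D : ∀ v ∈ D, ∀ u : TangentSpace 𝓘(ℝ, A) (dMinus v),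
    ∃ δ : TangentSpace 𝓘(ℝ, B) v,
      (⟨v, δ⟩ : TangentBundle 𝓘(ℝ, B) V) ∈ tangentTo 𝓘(ℝ, B) D ∧
      mfderiv 𝓘(ℝ, B) 𝓘(ℝ, A) dMinus v δ = u
  /-- the variation constraint `E_d`, a subspace of the tangent space at `∂⁺(v)` for `v ∈ D_d` -/
  E : ∀ v : D, Submodule ℝ (TangentSpace 𝓘(ℝ, A) (dPlus v))
  /-- the fiber dimension of `E_d` -/
  rankE : ℕ
  /-- `E_d` is a smooth subbundle of the pullback of `TQ` by the restriction of `∂⁺` to `D_d` -/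
  subbundle_E : ∀ v₀ ∈ D, ∃ U : Set V, IsOpen U ∧ v₀ ∈ U ∧
    ∃ X : Fin rankE → ∀ v : V, TangentSpace 𝓘(ℝ, A) (dPlus v),
      (∀ i, ContMDiffOn 𝓘(ℝ, B) 𝓘(ℝ, A).tangent ∞
        (fun v => (⟨dPlus v, X i v⟩ : TangentBundle 𝓘(ℝ, A) Q)) (U ∩ D)) ∧
      ∀ v : D, (v : V) ∈ U → LinearIndependent ℝ (fun i => X i v) ∧
        Submodule.span ℝ (Set.range fun i => X i v) = E v

variable {A Q B V}

namespace DCLS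

variable (S : DCLS A Q B V) (N : ℕ)

/-- The system has linear constraints, with constraint distribution `F` of fiber dimension `r`
(as a manifold, `F` has dimension `dim Q + r`). -/
structure HasLinearConstraints (F : ∀ q : Q, Submodule ℝ (TangentSpace 𝓘(ℝ, A) q)) (r : ℕ) :
    Prop where
  smooth : IsSmoothDistribution 𝓘(ℝ, A) F r
  E_eq : ∀ v : S.D, S.E v = F (S.dPlus v)
  reachable : ∀ v ∈ S.D, Reachable 𝓘(ℝ, A) F (S.dMinus v) (S.dPlus v)
  dim_eq : S.dimD = Module.finrank ℝ A + r

/-- The first order sequences `C_{d,N}` in `V[1,N]`. Sequences are indexed by `Fin N`, so that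
the index `k` stands for the position `k + 1`. -/
def firstOrder : Set (Fin N → V) :=
  {w | ∀ k l : Fin N, (l : ℕ) = k + 1 → S.dPlus (w k) = S.dMinus (w l)}

/-- The constrained first order sequences `N_{d,N}`. -/
def constrained : Set (Fin N → V) :=
  {w | w ∈ S.firstOrder N ∧ ∀ k, w k ∈ S.D}

variable {N}

/-- The entry `δv(k)`, tangent to `V` at `v(k)`, of a tangent vector `δv` to `V[1,N]` at `v`. -/
def entry (δ : TangentBundle (powModel B N) (Fin N → V)) (k : Fin N) :
    TangentSpace 𝓘(ℝ, B) (δ.1 k) :=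
  mfderiv (powModel B N) 𝓘(ℝ, B) (fun w : Fin N → V => w k) δ.1 δ.2

/-- `T∂⁺(δv(k))` -/
def tPlus (δ : TangentBundle (powModel B N) (Fin N → V)) (k : Fin N) :
    TangentSpace 𝓘(ℝ, A) (S.dPlus (δ.1 k)) :=
  mfderiv 𝓘(ℝ, B) 𝓘(ℝ, A) S.dPlus (δ.1 k) (entry δ k)

/-- `T∂⁻(δv(k))` -/
def tMinus (δ : TangentBundle (powModel B N) (Fin N → V)) (k : Fin N) :
    TangentSpace 𝓘(ℝ, A) (S.dMinus (δ.1 k)) :=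
  mfderiv 𝓘(ℝ, B) 𝓘(ℝ, A) S.dMinus (δ.1 k) (entry δ k)

variable (N)

/-- The tangent vectors to `V[1,N]` with fixed endpoint projections: `T∂⁻(δv(1)) = 0` and
`T∂⁺(δv(N)) = 0`. -/
def fixedEndpoints : Set (TangentBundle (powModel B N) (Fin N → V)) :=
  {δ | (∀ k : Fin N, (k : ℕ) = 0 → S.tMinus δ k = 0) ∧
    ∀ k : Fin N, (k : ℕ) + 1 = N → S.tPlus δ k = 0}

/-- The variation distribution `W_{d,N}`: at the points of `N_{d,N}` (where all entries lie in
`D_d`, the base of `E_d`), the tangent vectors to `C_{d,N}` with fixed endpoint projections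
and with `T∂⁺(δv(k)) ∈ (E_d)_{v(k)}` for all `k`. -/
def variations : Set (TangentBundle (powModel B N) (Fin N → V)) :=
  {δ | δ ∈ tangentTo (powModel B N) (S.firstOrder N) ∧ δ ∈ S.fixedEndpoints N ∧
    ∃ h : δ.1 ∈ S.constrained N, ∀ k, S.tPlus δ k ∈ S.E ⟨δ.1 k, h.2 k⟩}

end DCLS

end Discrete

end DiscreteMechanics

end

/-! Write F for the constraint distribution. Everything turns on the property
`TransportsConstraint`: a tangent vector of D_d whose image under T∂⁻ lies in F has its image under
T∂⁺ in F. For v in D_d the pair (T∂⁻, T∂⁺) is an isomorphism of T_vV onto a product of two tangent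
spaces of Q. The vectors with both projections in F thus form a space of dimension 2r. The vectors
of T_vD_d with T∂⁻ in F also form one, since T_vD_d has dimension dim Q + r and T∂⁻ maps it onto. An
inclusion between these two spaces is an equality, so transport means equally that every vector with
both projections in F is tangent to D_d (`transportsConstraint_iff`).

Transport gives 3: T∂⁻ of an entry of a variation is T∂⁺ of the preceding entry, or zero, so every
entry has both projections in F; conversely, transport carries membership in F along a tangent
sequence that starts with zero. Statement 4 gives transport back: variations with only two
consecutive nonzero entries produce vectors of T_vD_d that span those with both projections in F.

That involutivity implies transport is the analytic core. Given u tangent to D_d with T∂⁻u in F, a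
curve y tangent to F with velocity T∂⁻u lifts along ∂⁻ to a curve c in D_d with velocity u. As ∂⁺(c
t) is reachable from y t, the curve ∂⁺ ∘ c stays in one orbit of F. An orbit meets the domain of a
first integral in countably many level sets, so by connectedness ∂⁺ ∘ c stays in a single one and is
tangent to F (`mem_of_orbit`). The local first integrals come from Frobenius' theorem. In a chart, F
has a frame G with p ∘ G = id, whose coefficient fields commute by involutivity; sliding z for unit
time along the field with coefficient −p (z − z₀) defines π. Grönwall estimates take the place of
differentiability of flows in the initial point (`norm_variation_le`).

For the brackets, transport makes fields with values in W tangent to N_{d,N}. The identity [X,Y]g =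
X(Yg) − Y(Xg) then preserves every condition given by a function whose derivatives along X and Y
vanish on N_{d,N}. Conversely, sections of F lift to variations supported at the junction of the
first two entries, and brackets of related fields are related. -/

namespace DiscreteMechanics

noncomputable section

open Set Metric

/-! ### Commuting frames in a vector space and their first integrals -/

section FlatFrame

variable {E : Type*} [NormedAddCommGroup E] [NormedSpace ℝ E]
  {H : Type*} [NormedAddCommGroup H] [NormedSpace ℝ H]

/-- Grönwall's inequality on the unit interval. -/
lemma norm_le_exp_mul_of_norm_deriv_le {f f' : ℝ → E} {K ε : ℝ} (hK : 1 ≤ K) (hε : 0 ≤ ε)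
    (hf : ∀ s ∈ Icc (0 : ℝ) 1, HasDerivWithinAt f (f' s) (Icc 0 1) s)
    (hb : ∀ s ∈ Icc (0 : ℝ) 1, ‖f' s‖ ≤ K * ‖f s‖ + ε) {s : ℝ} (hs : s ∈ Icc (0 : ℝ) 1) :
    ‖f s‖ ≤ Real.exp K * (‖f 0‖ + ε) := by
  have h1 : ‖f s‖ ≤ gronwallBound ‖f 0‖ K ε (s - 0) := by
    refine norm_le_gronwallBound_of_norm_deriv_right_le (f' := f') (b := 1)
      (fun x hx => (hf x hx).continuousWithinAt) (fun x hx => ?_) le_rfl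
      (fun x hx => hb x ⟨hx.1, hx.2.le⟩) s hs
    exact (hf x ⟨hx.1, hx.2.le⟩).mono_of_mem_nhdsWithin (Icc_mem_nhdsGE_of_mem hx)
  refine h1.trans ?_
  have hK0 : K ≠ 0 := by positivity
  rw [gronwallBound_of_K_ne_0 hK0, sub_zero]
  have h2 : Real.exp (K * s) ≤ Real.exp K := by
    apply Real.exp_le_exp.2
    nlinarith [hs.2]
  have h3 : 1 ≤ Real.exp (K * s) := Real.one_le_exp (by have := hs.1; positivity)
  have h4 : ε / K ≤ ε := div_le_self hε hK
  have h5 : 0 ≤ ε / K := by positivity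
  have h6 : ε / K * (Real.exp (K * s) - 1) ≤ ε * Real.exp K :=
    mul_le_mul h4 (by linarith) (by linarith) hε
  nlinarith [mul_le_mul_of_nonneg_left h2 (norm_nonneg (f 0))]

/-- A frame `z ↦ G z` of a distribution on a vector space `E`, on the set `B`, which is normalized
by `p ∘ G z = id` and whose coefficient fields `z ↦ G z h` commute, with uniform bounds. -/
structure IsFlatFrame (p : E →L[ℝ] H) (G : E → H →L[ℝ] E) (G' : E → E →L[ℝ] H →L[ℝ] E)
    (B : Set E) (M : ℝ) : Prop where
  norm_le : ∀ z ∈ B, ‖G z‖ ≤ M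
  norm_deriv_le : ∀ z ∈ B, ‖G' z‖ ≤ M
  norm_sub_le : ∀ z₁ ∈ B, ∀ z₂ ∈ B, ‖G z₂ - G z₁‖ ≤ M * ‖z₂ - z₁‖
  taylor : ∀ z₁ ∈ B, ∀ z₂ ∈ B, ‖G z₂ - G z₁ - G' z₁ (z₂ - z₁)‖ ≤ M * ‖z₂ - z₁‖ ^ 2
  hasFDerivAt : ∀ z ∈ B, HasFDerivAt G (G' z) z
  right_inv : ∀ z ∈ B, ∀ h, p (G z h) = h
  symm : ∀ z ∈ B, ∀ h k, G' z (G z h) k = G' z (G z k) h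

/-- `c` is, on the unit interval, an integral curve in `B` of the coefficient field of `h`. -/
structure IsFlowArc (G : E → H →L[ℝ] E) (B : Set E) (h : H) (c : ℝ → E) : Prop where
  mem : ∀ s ∈ Icc (0 : ℝ) 1, c s ∈ B
  deriv : ∀ s ∈ Icc (0 : ℝ) 1, HasDerivWithinAt c (G (c s) h) (Icc 0 1) s

lemma IsFlowArc.reverse {G : E → H →L[ℝ] E} {B : Set E} {h : H} {c : ℝ → E}
    (hc : IsFlowArc G B h c) : IsFlowArc G B (-h) (fun s => c (1 - s)) := by
  have hmap : ∀ s ∈ Icc (0 : ℝ) 1, 1 - s ∈ Icc (0 : ℝ) 1 := fun s hs =>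
    ⟨by linarith [hs.2], by linarith [hs.1]⟩
  refine ⟨fun s hs => hc.mem _ (hmap s hs), fun s hs => ?_⟩
  have h1 : HasDerivWithinAt (fun s : ℝ => 1 - s) (-1) (Icc 0 1) s := by
    simpa using (hasDerivWithinAt_id s (Icc (0 : ℝ) 1)).const_sub 1
  have := (hc.deriv _ (hmap s hs)).scomp s h1 hmap
  have e : c ∘ (fun s : ℝ => 1 - s) = fun s => c (1 - s) := rfl
  rw [e] at this
  simpa only [map_neg, neg_smul, one_smul] using this

variable {p : E →L[ℝ] H} {G : E → H →L[ℝ] E} {G' : E → E →L[ℝ] H →L[ℝ] E} {B : Set E} {M : ℝ}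

/-- Two flow arcs stay close. -/
lemma IsFlatFrame.norm_sub_arc_le (hG : IsFlatFrame p G G' B M) (hM : 1 ≤ M) {h₁ h₂ : H}
    {c₁ c₂ : ℝ → E} (hc₁ : IsFlowArc G B h₁ c₁) (hc₂ : IsFlowArc G B h₂ c₂) (hh : ‖h₂‖ ≤ 1)
    {s : ℝ} (hs : s ∈ Icc (0 : ℝ) 1) :
    ‖c₂ s - c₁ s‖ ≤ Real.exp M * (‖c₂ 0 - c₁ 0‖ + M * ‖h₂ - h₁‖) := by
  refine norm_le_exp_mul_of_norm_deriv_le (f := fun s => c₂ s - c₁ s) hM (by positivity)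
    (fun s hs => (hc₂.deriv s hs).sub (hc₁.deriv s hs)) (fun s hs => ?_) hs
  have e : G (c₂ s) h₂ - G (c₁ s) h₁ = (G (c₂ s) - G (c₁ s)) h₂ + G (c₁ s) (h₂ - h₁) := by
    simp
  rw [e]
  refine (norm_add_le _ _).trans (add_le_add ?_ ?_)
  · refine ((G (c₂ s) - G (c₁ s)).le_opNorm h₂).trans ?_
    have := hG.norm_sub_le _ (hc₁.mem s hs) _ (hc₂.mem s hs)
    calc _ ≤ ‖G (c₂ s) - G (c₁ s)‖ * 1 := by gcongr
      _ ≤ _ := by simpa using this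
  · exact ((G (c₁ s)).le_opNorm _).trans (by gcongr; exact hG.norm_le _ (hc₁.mem s hs))

/-- The first variation of a flow arc with respect to its initial point and its parameter. -/
lemma IsFlatFrame.norm_variation_le (hG : IsFlatFrame p G G' B M) (hM : 1 ≤ M) {h₁ h₂ : H}
    {c₁ c₂ : ℝ → E} (hc₁ : IsFlowArc G B h₁ c₁) (hc₂ : IsFlowArc G B h₂ c₂) (hh₁ : ‖h₁‖ ≤ 1)
    (hh : ‖h₂‖ ≤ 1) (u : H) :
    ‖c₂ 1 - c₁ 1 - G (c₁ 1) (u + (h₂ - h₁))‖ ≤ Real.exp M * (‖c₂ 0 - c₁ 0 - G (c₁ 0) u‖ +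
      M * (‖h₂ - h₁‖ ^ 2 + 2 * (Real.exp M * (‖c₂ 0 - c₁ 0‖ + M * ‖h₂ - h₁‖)) ^ 2)) := by
  set D : ℝ := Real.exp M * (‖c₂ 0 - c₁ 0‖ + M * ‖h₂ - h₁‖) with hD
  set κ := h₂ - h₁ with hκ
  have hD0 : 0 ≤ D := by positivity
  -- The curve s ↦ G (c₁ s) (u + s • κ) solves the linearized flow equation along `c₁`; what remains
  -- of `c₂ - c₁` grows from its initial value with quadratic errors only.
  have key := norm_le_exp_mul_of_norm_deriv_le (s := 1)
    (f := fun s => c₂ s - c₁ s - G (c₁ s) (u + s • κ))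
    (f' := fun s => G (c₂ s) h₂ - G (c₁ s) h₁
      - (G' (c₁ s) (G (c₁ s) h₁) (u + s • κ) + G (c₁ s) κ))
    (K := M) (ε := M * (‖κ‖ ^ 2 + 2 * D ^ 2)) hM (by positivity) ?_ ?_ ⟨zero_le_one, le_rfl⟩
  · simpa using key
  · intro s hs
    have h1 : HasDerivWithinAt (fun s => G (c₁ s)) (G' (c₁ s) (G (c₁ s) h₁)) (Icc 0 1) s :=
      (hG.hasFDerivAt _ (hc₁.mem s hs)).comp_hasDerivWithinAt s (hc₁.deriv s hs)
    have h2 : HasDerivWithinAt (fun s : ℝ => u + s • κ) κ (Icc 0 1) s := by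
      simpa using ((hasDerivWithinAt_id s (Icc (0 : ℝ) 1)).smul_const κ).const_add u
    exact ((hc₂.deriv s hs).sub (hc₁.deriv s hs)).sub (h1.clm_apply h2)
  · intro s hs
    have hm₁ := hc₁.mem s hs
    have hm₂ := hc₂.mem s hs
    set d := c₂ s - c₁ s with hd
    have hdD : ‖d‖ ≤ D := hG.norm_sub_arc_le hM hc₁ hc₂ hh hs
    have e : G (c₂ s) h₂ - G (c₁ s) h₁
        - (G' (c₁ s) (G (c₁ s) h₁) (u + s • κ) + G (c₁ s) κ) =
        G' (c₁ s) (d - G (c₁ s) (u + s • κ)) h₁ +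
        ((G (c₂ s) - G (c₁ s)) κ + (G (c₂ s) - G (c₁ s) - G' (c₁ s) d) h₁) := by
      -- Commutation enters here: it moves u + s • κ into the direction slot of `G'`, where it
      -- combines with `d`.
      rw [hG.symm _ hm₁ h₁ (u + s • κ), hκ]
      simp only [map_sub, sub_apply]
      abel
    rw [e]
    refine (norm_add_le _ _).trans (add_le_add ?_ ((norm_add_le _ _).trans ?_))
    · calc _ ≤ ‖G' (c₁ s)‖ * ‖d - G (c₁ s) (u + s • κ)‖ * ‖h₁‖ :=
            (G' (c₁ s)).le_opNorm₂ _ _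
        _ ≤ M * ‖d - G (c₁ s) (u + s • κ)‖ * 1 := by
            gcongr; exact hG.norm_deriv_le _ hm₁
        _ = _ := mul_one _
    · have b1 : ‖(G (c₂ s) - G (c₁ s)) κ‖ ≤ M * D * ‖κ‖ :=
        (ContinuousLinearMap.le_opNorm _ _).trans
          (by gcongr; exact (hG.norm_sub_le _ hm₁ _ hm₂).trans (by gcongr))
      have b2 : ‖(G (c₂ s) - G (c₁ s) - G' (c₁ s) d) h₁‖ ≤ M * D ^ 2 * 1 :=
        (ContinuousLinearMap.le_opNorm _ _).trans
          (by gcongr; exact (hG.taylor _ hm₁ _ hm₂).trans (by gcongr))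
      nlinarith [sq_nonneg (D - ‖κ‖), norm_nonneg κ]

/-- Picard–Lindelöf on the whole unit interval: the smallness of `h` keeps solutions from the half
ball within the ball where the bounds hold. The fixed point itself is used because its function
space supplies the confinement to the ball of radius M‖h‖ about `z`. -/
lemma IsFlatFrame.exists_flowArc [CompleteSpace E] {z₀ : E} {ρ : ℝ}
    (hG : IsFlatFrame p G G' (closedBall z₀ ρ) M) (hM : 1 ≤ M) {z : E}
    (hz : z ∈ closedBall z₀ (ρ / 2)) {h : H} (hh : ‖h‖ ≤ 1) (hh' : M * ‖h‖ ≤ ρ / 2) :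
    ∃ c, IsFlowArc G (closedBall z₀ ρ) h c ∧ c 0 = z ∧
      ∀ s ∈ Icc (0 : ℝ) 1, ‖c s - z‖ ≤ M * ‖h‖ := by
  have hM0 : 0 ≤ M := by linarith
  obtain ⟨L, hL⟩ : ∃ L : NNReal, (L : ℝ) = M * ‖h‖ := ⟨.mk _ (by positivity), rfl⟩
  obtain ⟨K, hK⟩ : ∃ K : NNReal, (K : ℝ) = M := ⟨.mk M hM0, rfl⟩
  have hPL : IsPicardLindelof (fun _ x => G x h) (tmin := 0) (tmax := 1)
      ⟨0, by simp⟩ z L 0 L K := by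
    have hsub : closedBall z L ⊆ closedBall z₀ ρ := by
      intro x hx
      rw [mem_closedBall] at hx hz ⊢
      linarith [dist_triangle x z z₀]
    refine IsPicardLindelof.of_time_independent (fun x hx => ?_) ?_ ?_
    · exact ((G x).le_opNorm h).trans (by
        have := hG.norm_le x (hsub hx)
        rw [hL]
        gcongr)
    · refine LipschitzOnWith.of_dist_le_mul fun x hx y hy => ?_
      rw [dist_eq_norm, dist_eq_norm, ← sub_apply]
      refine (ContinuousLinearMap.le_opNorm _ _).trans ?_
      have := hG.norm_sub_le y (hsub hy) x (hsub hx)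
      calc _ ≤ ‖G x - G y‖ * 1 := by gcongr
        _ ≤ _ := by rw [hK]; simpa using this
    · simp
  obtain ⟨α, hα⟩ := ODE.FunSpace.exists_isFixedPt_next hPL (mem_closedBall_self le_rfl)
  have hmem : ∀ s, α.compProj s ∈ closedBall z L :=
    fun s => α.compProj_mem_closedBall hPL.mul_max_le
  refine ⟨α.compProj, ⟨fun s _ => ?_, fun s hs => ?_⟩, ?_, fun s _ => ?_⟩
  · have := hmem s
    rw [mem_closedBall] at this hz ⊢
    linarith [dist_triangle (α.compProj s) z z₀]
  · apply ODE.hasDerivWithinAt_picard_Icc (t₀ := 0) ⟨le_rfl, zero_le_one⟩ hPL.continuousOn_uncurry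
      α.continuous_compProj.continuousOn (fun _ ht' ↦ hmem _)
      z hs |>.congr_of_mem _ hs
    intro t' ht'
    nth_rw 1 [← hα]
    rw [ODE.FunSpace.compProj_of_mem ht', ODE.FunSpace.next_apply]
  · have : α.compProj ((⟨0, by simp⟩ : Icc (0 : ℝ) 1) : ℝ) = z := by
      rw [ODE.FunSpace.compProj_val, ← hα, ODE.FunSpace.next_apply₀]
    exact this
  · have := hmem s
    rwa [mem_closedBall, dist_eq_norm, hL] at this

/-- A flat frame has local first integrals: a map `π` which is constant to second order along the
distribution, and whose level sets are tangent to the distribution. -/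
theorem IsFlatFrame.exists_firstIntegral [CompleteSpace E] {z₀ : E} {ρ : ℝ} (hρ : 0 < ρ)
    (hG : IsFlatFrame p G G' (closedBall z₀ ρ) M) (hM : 1 ≤ M) :
    ∃ (π : E → E) (U : Set E) (C : ℝ), IsOpen U ∧ z₀ ∈ U ∧ U ⊆ closedBall z₀ (ρ / 2) ∧ 0 < C ∧
      (∀ z₁ ∈ U, ∀ z₂ ∈ U, ‖π z₂ - π z₁‖ ≤
        C * (‖z₂ - z₁ - G z₁ (p (z₂ - z₁))‖ + ‖z₂ - z₁‖ ^ 2)) ∧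
      ∀ z₁ ∈ U, ∀ z₂ ∈ U, π z₁ = π z₂ →
        ‖z₂ - z₁ - G z₁ (p (z₂ - z₁))‖ ≤ C * ‖z₂ - z₁‖ ^ 2 := by
  have hM0 : 0 < M := by linarith
  set P : ℝ := ‖p‖ + 1 with hP
  have hP0 : 0 < P := by positivity
  have hpP : ∀ z, ‖p z‖ ≤ P * ‖z‖ := fun z => (p.le_opNorm z).trans (by gcongr; linarith)
  -- The three bounds place the ball in the half ball, give the flow parameter norm at most 1, and
  -- limit the displacement along arcs to ρ / 2.
  set ρ' : ℝ := min (ρ / 2) (min (1 / P) (ρ / (2 * M * P))) with hρ'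
  have hρ'0 : 0 < ρ' := by positivity
  have hUsub : ball z₀ ρ' ⊆ closedBall z₀ (ρ / 2) :=
    ball_subset_closedBall.trans (closedBall_subset_closedBall (min_le_left _ _))
  have hp1 : ∀ z ∈ ball z₀ ρ', ‖p (z - z₀)‖ ≤ 1 := fun z hz => by
    rw [mem_ball, dist_eq_norm] at hz
    calc _ ≤ P * ‖z - z₀‖ := hpP _
      _ ≤ P * (1 / P) := by
        gcongr
        exact hz.le.trans ((min_le_right _ _).trans (min_le_left _ _))
      _ = 1 := by field_simp
  have hp2 : ∀ z ∈ ball z₀ ρ', M * ‖p (z - z₀)‖ ≤ ρ / 2 := fun z hz => by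
    rw [mem_ball, dist_eq_norm] at hz
    calc _ ≤ M * (P * ‖z - z₀‖) := by gcongr; exact hpP _
      _ ≤ M * (P * (ρ / (2 * M * P))) := by
        gcongr
        exact hz.le.trans ((min_le_right _ _).trans (min_le_right _ _))
      _ = ρ / 2 := by field_simp
  -- Along an arc, `p` moves with velocity equal to the parameter, so this arc slides `z` into the
  -- slice p = p z₀; its endpoint will be π z.
  have hflow : ∀ z : E, ∃ c : ℝ → E, z ∈ ball z₀ ρ' →
      IsFlowArc G (closedBall z₀ ρ) (-(p (z - z₀))) c ∧ c 0 = z := fun z => by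
    by_cases hz : z ∈ ball z₀ ρ'
    · obtain ⟨c, h1, h2, -⟩ := hG.exists_flowArc hM (hUsub hz) (h := -(p (z - z₀)))
        (by rw [norm_neg]; exact hp1 z hz) (by rw [norm_neg]; exact hp2 z hz)
      exact ⟨c, fun _ => ⟨h1, h2⟩⟩
    · exact ⟨0, fun h => absurd h hz⟩
  choose c hc using hflow
  set X := Real.exp M with hX
  have hX0 : 0 < X := Real.exp_pos _
  -- The bound of `norm_variation_le` with ‖z₂ − z₁‖ = d and a parameter change of norm at most P d.
  set C : ℝ := X * (1 + M * (P ^ 2 + 2 * (X * (1 + M * P)) ^ 2)) with hC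
  have hC0 : 0 < C := by positivity
  have hXC : X ≤ C := by
    rw [hC]
    exact le_mul_of_one_le_right hX0.le (le_add_of_nonneg_right (by positivity))
  have hXC' : X * (M * (P ^ 2 + 2 * (X * (1 + M * P)) ^ 2)) ≤ C := by
    rw [hC]; gcongr; linarith
  refine ⟨fun z => c z 1, ball z₀ ρ', C, isOpen_ball, mem_ball_self hρ'0, hUsub, hC0, ?_, ?_⟩
  · intro z₁ hz₁ z₂ hz₂
    -- For u = p (z₂ − z₁) the parameter changes by −u, so the predicted displacement of the
    -- endpoints is zero.
    have key := hG.norm_variation_le hM (hc z₁ hz₁).1 (hc z₂ hz₂).1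
      (by rw [norm_neg]; exact hp1 z₁ hz₁) (by rw [norm_neg]; exact hp1 z₂ hz₂) (p (z₂ - z₁))
    have e1 : -(p (z₂ - z₀)) - -(p (z₁ - z₀)) = -(p (z₂ - z₁)) := by
      simp only [map_sub]; abel
    rw [e1, (hc z₁ hz₁).2, (hc z₂ hz₂).2, add_neg_cancel, map_zero, sub_zero, norm_neg] at key
    refine key.trans ?_
    have hd := hpP (z₂ - z₁)
    set d := ‖z₂ - z₁‖
    have hd0 : 0 ≤ d := norm_nonneg _
    calc _ ≤ X * (‖z₂ - z₁ - G z₁ (p (z₂ - z₁))‖ +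
          M * ((P * d) ^ 2 + 2 * (X * (d + M * (P * d))) ^ 2)) := by gcongr
      _ = X * ‖z₂ - z₁ - G z₁ (p (z₂ - z₁))‖ +
          X * (M * (P ^ 2 + 2 * (X * (1 + M * P)) ^ 2)) * d ^ 2 := by ring
      _ ≤ C * ‖z₂ - z₁ - G z₁ (p (z₂ - z₁))‖ + C * d ^ 2 := by gcongr
      _ = _ := by ring
  · intro z₁ hz₁ z₂ hz₂ hπ
    -- Run backwards, both arcs leave the common point π z₁ = π z₂. The initial displacement is
    -- zero, and the parameter change p (z₂ − z₁) predicts z₂ − z₁.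
    have key := hG.norm_variation_le hM (hc z₁ hz₁).1.reverse (hc z₂ hz₂).1.reverse
      (by rw [neg_neg]; exact hp1 z₁ hz₁) (by rw [neg_neg]; exact hp1 z₂ hz₂) 0
    have e1 : - -(p (z₂ - z₀)) - - -(p (z₁ - z₀)) = p (z₂ - z₁) := by
      simp only [map_sub]; abel
    simp only [sub_self, sub_zero, (hc z₁ hz₁).2, (hc z₂ hz₂).2, e1, hπ, map_zero, zero_add,
      norm_zero] at key
    refine key.trans ?_
    have hd := hpP (z₂ - z₁)
    set d := ‖z₂ - z₁‖
    have hd0 : 0 ≤ d := norm_nonneg _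
    calc _ ≤ X * (M * ((P * d) ^ 2 + 2 * (X * (d + M * (P * d))) ^ 2)) := by
          gcongr
          exact (mul_le_mul_of_nonneg_left hd hM0.le).trans (by linarith)
      _ = X * (M * (P ^ 2 + 2 * (X * (1 + M * P)) ^ 2)) * d ^ 2 := by ring
      _ ≤ C * d ^ 2 := by gcongr

/-- A smooth normalized frame with commuting coefficient fields is flat on a small ball. -/
theorem exists_isFlatFrame {z₀ : E} (hG : ContDiffAt ℝ 2 G z₀)
    (hp : ∀ᶠ z in 𝓝 z₀, ∀ h, p (G z h) = h)
    (hs : ∀ᶠ z in 𝓝 z₀, ∀ h k, fderiv ℝ G z (G z h) k = fderiv ℝ G z (G z k) h)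
    {O : Set E} (hO : O ∈ 𝓝 z₀) :
    ∃ ρ > 0, ∃ M : ℝ, 1 ≤ M ∧ closedBall z₀ ρ ⊆ O ∧
      IsFlatFrame p G (fderiv ℝ G) (closedBall z₀ ρ) M := by
  have h1 : ContDiffAt ℝ 1 (fderiv ℝ G) z₀ := hG.fderiv_right (by norm_num)
  obtain ⟨K, s, hs0, hK⟩ := h1.exists_lipschitzOnWith
  obtain ⟨K', s', hs0', hK'⟩ := (hG.of_le (by norm_num : (1 : WithTop ℕ∞) ≤ 2)).exists_lipschitzOnWith
  have hd : ∀ᶠ z in 𝓝 z₀, DifferentiableAt ℝ G z :=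
    (hG.eventually (by simp)).mono fun z hz => hz.differentiableAt (by norm_num)
  have hb1 : ∀ᶠ z in 𝓝 z₀, ‖G z‖ < ‖G z₀‖ + 1 :=
    hG.continuousAt.norm.eventually_lt_const (by linarith)
  have hb2 : ∀ᶠ z in 𝓝 z₀, ‖fderiv ℝ G z‖ < ‖fderiv ℝ G z₀‖ + 1 :=
    ((continuous_norm (E := E →L[ℝ] H →L[ℝ] E)).continuousAt.tendsto.comp
      h1.continuousAt).eventually_lt_const (lt_add_one _)
  obtain ⟨ρ, hρ, hball⟩ := nhds_basis_closedBall.mem_iff.1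
    (Filter.inter_mem (Filter.inter_mem (Filter.inter_mem hs0 hs0')
      (Filter.inter_mem (Filter.inter_mem hd hO) (Filter.inter_mem hb1 hb2)))
      (Filter.inter_mem hp hs))
  set M : ℝ := 1 + K + K' + (‖G z₀‖ + 1) + (‖fderiv ℝ G z₀‖ + 1) with hM
  have n1 := norm_nonneg (G z₀)
  have n2 := norm_nonneg (fderiv ℝ G z₀)
  have n3 : (0 : ℝ) ≤ K := K.2
  have n4 : (0 : ℝ) ≤ K' := K'.2
  refine ⟨ρ, hρ, M, by linarith, fun z hz => (hball hz).1.2.1.2, ?_⟩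
  constructor
  · intro z hz
    have : ‖G z‖ < _ := (hball hz).1.2.2.1
    linarith
  · intro z hz
    have : ‖fderiv ℝ G z‖ < _ := (hball hz).1.2.2.2
    linarith
  · intro z₁ hz₁ z₂ hz₂
    rw [← dist_eq_norm, ← dist_eq_norm]
    refine (hK'.dist_le_mul _ (hball hz₂).1.1.2 _ (hball hz₁).1.1.2).trans ?_
    gcongr
    linarith
  · intro z₁ hz₁ z₂ hz₂
    have hseg : segment ℝ z₁ z₂ ⊆ closedBall z₀ ρ :=
      (convex_closedBall z₀ ρ).segment_subset hz₁ hz₂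
    have := (convex_segment z₁ z₂).norm_image_sub_le_of_norm_hasFDerivWithin_le'
      (f := G) (f' := fderiv ℝ G) (φ := fderiv ℝ G z₁) (C := M * ‖z₂ - z₁‖) (x := z₁) (y := z₂)
      (fun x hx => ((hball (hseg hx)).1.2.1.1.hasFDerivAt).hasFDerivWithinAt)
      (fun x hx => ?_) (left_mem_segment _ _ _) (right_mem_segment _ _ _)
    · refine this.trans (le_of_eq (by ring))
    · rw [← dist_eq_norm]
      refine (hK.dist_le_mul _ (hball (hseg hx)).1.1.1 _ (hball hz₁).1.1.1).trans ?_
      have hx2 : dist x z₁ ≤ ‖z₂ - z₁‖ := by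
        rw [dist_comm, ← dist_eq_norm, dist_comm z₂]
        have := dist_add_dist_of_mem_segment hx
        linarith [dist_nonneg (x := x) (y := z₂)]
      gcongr
      linarith
  · exact fun z hz => (hball hz).1.2.1.1.hasFDerivAt
  · exact fun z hz => (hball hz).2.1
  · exact fun z hz => (hball hz).2.2

end FlatFrame

/-! ### Derivatives along vector fields and along Lie brackets -/

section FieldDeriv

variable {E : Type*} [NormedAddCommGroup E] [NormedSpace ℝ E]
  {G : Type*} [NormedAddCommGroup G] [NormedSpace ℝ G]

/-- The two second derivatives of `g` cancel by symmetry; the derivatives of the fields that remain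
make up the bracket. -/
lemma fderiv_lieBracket {X Y : E → E} {g : E → G} {x : E} (hX : DifferentiableAt ℝ X x)
    (hY : DifferentiableAt ℝ Y x) (hg : ContDiffAt ℝ 2 g x) :
    fderiv ℝ g x (VectorField.lieBracket ℝ X Y x) =
      fderiv ℝ (fun y => fderiv ℝ g y (Y y)) x (X x) -
        fderiv ℝ (fun y => fderiv ℝ g y (X y)) x (Y x) := by
  have hd : DifferentiableAt ℝ (fderiv ℝ g) x :=
    (hg.fderiv_right (m := 1) (by norm_num)).differentiableAt (by norm_num)
  have hsymm : IsSymmSndFDerivAt ℝ g x := hg.isSymmSndFDerivAt (by simp)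
  rw [fderiv_clm_apply hd hY, fderiv_clm_apply hd hX, VectorField.lieBracket]
  simp only [add_apply, ContinuousLinearMap.comp_apply, ContinuousLinearMap.flip_apply, map_sub]
  rw [hsymm.eq (X x) (Y x)]
  abel

variable {H : Type*} [TopologicalSpace H] (I : ModelWithCorners ℝ E H)
  {M : Type*} [TopologicalSpace M] [ChartedSpace H M]

/-- The derivative of the vector valued function `g` along the vector field `X`. -/
def fieldDeriv (g : M → G) (X : ∀ x : M, TangentSpace I x) (x : M) : G :=
  mfderiv I 𝓘(ℝ, G) g x (X x)

/-- The coordinates of the vector field `X` in the preferred chart at `x`. -/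
def chartField (x : M) (X : ∀ x : M, TangentSpace I x) : E → E :=
  VectorField.mpullbackWithin 𝓘(ℝ, E) I (extChartAt I x).symm X (range I)

variable {I}

lemma fieldDeriv_congr {g g' : M → G} {x : M} (h : g =ᶠ[𝓝 x] g')
    (X : ∀ x : M, TangentSpace I x) : fieldDeriv I g X x = fieldDeriv I g' X x := by
  unfold fieldDeriv
  exact congrArg (fun f : E →L[ℝ] G => f (X x)) h.mfderiv_eq

lemma fieldDeriv_comp {E' : Type*} [NormedAddCommGroup E'] [NormedSpace ℝ E'] {f : M → E'}
    {g : E' → G} {x : M} (hg : DifferentiableAt ℝ g (f x)) (hf : MDifferentiableAt I 𝓘(ℝ, E') f x)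
    (X : ∀ x : M, TangentSpace I x) :
    fieldDeriv I (g ∘ f) X x = fderiv ℝ g (f x) (fieldDeriv I f X x) := by
  have h := mfderiv_comp (I := I) (I' := 𝓘(ℝ, E')) (I'' := 𝓘(ℝ, G)) x hg.mdifferentiableAt hf
  rw [mfderiv_eq_fderiv] at h
  exact congrArg (fun T : E →L[ℝ] G => T (X x)) h

variable [IsManifold I ∞ M]

lemma contMDiffOn_fieldDeriv {g : M → G} {X : ∀ x : M, TangentSpace I x} {U : Set M}
    (hU : IsOpen U) (hg : ContMDiffOn I 𝓘(ℝ, G) ∞ g U) (hX : SmoothFieldOn I X U) :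
    ContMDiffOn I 𝓘(ℝ, G) ∞ (fieldDeriv I g X) U := by
  have h1 := hg.contMDiffOn_tangentMapWithin (m := ∞) (by simp) hU.uniqueMDiffOn
  have h2 := h1.comp hX (fun x hx => hx)
  have h3 := (contMDiff_snd_tangentBundle_modelSpace G 𝓘(ℝ, G) (n := ∞)).comp_contMDiffOn h2
  refine h3.congr fun x hx => ?_
  exact congrArg (fun f : E →L[ℝ] G => f (X x)) (mfderivWithin_of_isOpen hU hx).symm

variable [I.Boundaryless]

lemma fderiv_comp_extChartAt_symm {g : M → G} {x : M} {z : E} (hz : z ∈ (extChartAt I x).target)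
    (hg : MDifferentiableAt I 𝓘(ℝ, G) g ((extChartAt I x).symm z))
    (X : ∀ x : M, TangentSpace I x) :
    fderiv ℝ (g ∘ (extChartAt I x).symm) z
      (chartField I x X z) =
      fieldDeriv I g X ((extChartAt I x).symm z) := by
  have h1 := isInvertible_mfderivWithin_extChartAt_symm (I := I) hz
  have h2 : MDifferentiableAt 𝓘(ℝ, E) I (extChartAt I x).symm z := by
    have := mdifferentiableWithinAt_extChartAt_symm hz (I := I)
    rwa [I.range_eq_univ, mdifferentiableWithinAt_univ] at this
  unfold chartField
  rw [VectorField.mpullbackWithin_apply]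
  rw [I.range_eq_univ, mfderivWithin_univ] at h1 ⊢
  have h3 := mfderiv_comp (I := 𝓘(ℝ, E)) (I' := I) (I'' := 𝓘(ℝ, G)) z hg h2
  rw [mfderiv_eq_fderiv] at h3
  unfold fieldDeriv
  have h4 : ∀ u : E, fderiv ℝ (g ∘ (extChartAt I x).symm) z u =
     (mfderiv I 𝓘(ℝ, G) g ((extChartAt I x).symm z))
      (mfderiv 𝓘(ℝ, E) I (extChartAt I x).symm z u) := fun u => by
    exact congrArg (fun f : E →L[ℝ] G => f u) h3
  refine (h4 _).trans ?_
  exact congrArg _ (h1.self_apply_inverse _)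

/-- The chart at `x` reduces this to `fderiv_lieBracket`. All later bracket computations apply it to
coordinate functions, and so never differentiate the components of the fields themselves. -/
lemma fieldDeriv_mlieBracket [CompleteSpace E] {g : M → G} {X Y : ∀ x : M, TangentSpace I x}
    {U : Set M} (hU : IsOpen U) (hg : ContMDiffOn I 𝓘(ℝ, G) ∞ g U) (hX : SmoothFieldOn I X U)
    (hY : SmoothFieldOn I Y U) {x : M} (hx : x ∈ U) :
    fieldDeriv I g (VectorField.mlieBracket I X Y) x =
      fieldDeriv I (fieldDeriv I g Y) X x - fieldDeriv I (fieldDeriv I g X) Y x := by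
  set φ := extChartAt I x with hφ
  have hx0 : φ.symm (φ x) = x := extChartAt_to_inv x
  have hz0 : φ x ∈ φ.target := mem_extChartAt_target x
  have hW : ∀ᶠ z in 𝓝 (φ x), z ∈ φ.target ∧ φ.symm z ∈ U := by
    refine Filter.Eventually.and ?_ ?_
    · exact extChartAt_target_mem_nhds x
    · exact (continuousAt_extChartAt_symm x).eventually_mem (by rw [hx0]; exact hU.mem_nhds hx)
  have hgU : ∀ y ∈ U, ContMDiffAt I 𝓘(ℝ, G) ∞ g y := fun y hy =>
    (hg y hy).contMDiffAt (hU.mem_nhds hy)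
  have hpull : ∀ Z : ∀ x : M, TangentSpace I x, SmoothFieldOn I Z U →
      DifferentiableAt ℝ (chartField I x Z) (φ x) ∧
      (fun z => fderiv ℝ (g ∘ φ.symm) z
        (chartField I x Z z)) =ᶠ[𝓝 (φ x)]
          (fieldDeriv I g Z ∘ φ.symm) := fun Z hZ => by
    constructor
    · have h1 := ((hZ x hx).contMDiffAt (hU.mem_nhds hx)).mdifferentiableAt (by simp)
      rw [← mdifferentiableWithinAt_univ] at h1
      have h2 : DifferentiableWithinAt ℝ (chartField I x Z) (φ.symm ⁻¹' univ ∩ range I) (φ x) :=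
        h1.differentiableWithinAt_mpullbackWithin_vectorField
      rwa [preimage_univ, I.range_eq_univ, univ_inter, differentiableWithinAt_univ] at h2
    · filter_upwards [hW] with z hz
      exact fderiv_comp_extChartAt_symm hz.1 ((hgU _ hz.2).mdifferentiableAt (by simp)) Z
  have hgφ : ContDiffAt ℝ 2 (g ∘ φ.symm) (φ x) := by
    rw [← contMDiffAt_iff_contDiffAt]
    have h1 : ContMDiffAt 𝓘(ℝ, E) I ∞ φ.symm (φ x) := by
      have := contMDiffWithinAt_extChartAt_symm_range (n := ∞) (I := I) x hz0
      rwa [I.range_eq_univ, contMDiffWithinAt_univ] at this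
    exact ((hgU _ (by rwa [hx0])).comp (φ x) h1).of_le (by norm_cast)
  have key := fderiv_lieBracket (hpull X hX).1 (hpull Y hY).1 hgφ
  rw [(hpull X hX).2.fderiv_eq, (hpull Y hY).2.fderiv_eq] at key
  have hsm : ∀ Z : ∀ x : M, TangentSpace I x, SmoothFieldOn I Z U →
      MDifferentiableAt I 𝓘(ℝ, G) (fieldDeriv I g Z) (φ.symm (φ x)) := fun Z hZ => by
    rw [hx0]
    exact ((contMDiffOn_fieldDeriv hU hg hZ x hx).contMDiffAt (hU.mem_nhds hx)).mdifferentiableAt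
      (by simp)
  rw [fderiv_comp_extChartAt_symm hz0 (hsm Y hY) X, fderiv_comp_extChartAt_symm hz0 (hsm X hX) Y,
    hx0] at key
  rw [← key]
  have hgg : g =ᶠ[𝓝 x] (g ∘ φ.symm) ∘ φ := by
    filter_upwards [extChartAt_source_mem_nhds (I := I) x] with y hy
    simp [Function.comp_apply, φ.left_inv hy]
  rw [fieldDeriv_congr hgg]
  have hφd : MDifferentiableAt I 𝓘(ℝ, E) φ x := mdifferentiableAt_extChartAt (mem_chart_source H x)
  have h3 := mfderiv_comp (I := I) (I' := 𝓘(ℝ, E)) (I'' := 𝓘(ℝ, G)) x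
    (hgφ.differentiableAt (by norm_num)).mdifferentiableAt hφd
  rw [mfderiv_eq_fderiv] at h3
  refine (congrArg (fun f : E →L[ℝ] G => f (VectorField.mlieBracket I X Y x)) h3).trans ?_
  refine congrArg (fderiv ℝ (g ∘ φ.symm) (φ x)) ?_
  set L : E := VectorField.lieBracket ℝ (chartField I x X) (chartField I x Y) (φ x) with hL
  have h4 : VectorField.mlieBracket I X Y x = (mfderiv I 𝓘(ℝ, E) φ x).inverse L := by
    rw [← VectorField.mlieBracketWithin_univ, VectorField.mlieBracketWithin_apply]
    have h5 : VectorField.lieBracketWithin ℝ (chartField I x X) (chartField I x Y)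
        (φ.symm ⁻¹' univ ∩ range I) (φ x) = L := by
      rw [preimage_univ, I.range_eq_univ, univ_inter, VectorField.lieBracketWithin_univ]
    exact congrArg _ h5
  rw [h4]
  exact (isInvertible_mfderiv_extChartAt (mem_extChartAt_source x)).self_apply_inverse _

end FieldDeriv

/-! ### Velocities of curves and vectors tangent to a set -/

section Velocity

variable {E : Type*} [NormedAddCommGroup E] [NormedSpace ℝ E]
  {H : Type*} [TopologicalSpace H] (I : ModelWithCorners ℝ E H)
  {M : Type*} [TopologicalSpace M] [ChartedSpace H M]
  {E' : Type*} [NormedAddCommGroup E'] [NormedSpace ℝ E']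
  {H' : Type*} [TopologicalSpace H'] {I' : ModelWithCorners ℝ E' H'}
  {M' : Type*} [TopologicalSpace M'] [ChartedSpace H' M']

/-- The curve `c` has the velocity `u` at time `t`, within the set `s` of times. -/
def HasVelocity (c : ℝ → M) (s : Set ℝ) (t : ℝ) (u : E) : Prop :=
  ContinuousWithinAt c s t ∧ HasDerivWithinAt (extChartAt I (c t) ∘ c) u s t

variable {I} {c : ℝ → M} {s : Set ℝ} {t : ℝ} {u : E}

lemma HasVelocity.mono {s' : Set ℝ} (h : HasVelocity I c s t u) (hs : s' ⊆ s) :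
    HasVelocity I c s' t u :=
  ⟨h.1.mono hs, h.2.mono hs⟩

lemma HasVelocity.unique {u' : E} (h : HasVelocity I c univ t u) (h' : HasVelocity I c univ t u') :
    u = u' :=
  (hasDerivWithinAt_univ.1 h.2).unique (hasDerivWithinAt_univ.1 h'.2)

lemma HasVelocity.congr {c' : ℝ → M} (h : HasVelocity I c univ t u) (hc : c' =ᶠ[𝓝 t] c) :
    HasVelocity I c' univ t u := by
  have h0 : c' t = c t := hc.eq_of_nhds
  refine ⟨(continuousWithinAt_univ _ _).2 (((continuousWithinAt_univ _ _).1 h.1).congr hc.symm), ?_⟩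
  rw [h0]
  have h2 := hasDerivWithinAt_univ.1 h.2
  exact (h2.congr_of_eventuallyEq (hc.fun_comp _)).hasDerivWithinAt

lemma hasVelocity_vector {c : ℝ → E} :
    HasVelocity 𝓘(ℝ, E) c s t u ↔ HasDerivWithinAt c u s t := by
  unfold HasVelocity
  rw [extChartAt_model_space_eq_id]
  exact ⟨fun h => h.2, fun h => ⟨h.continuousWithinAt, h⟩⟩

lemma hasMFDerivWithinAt_real_iff {f' : ℝ →L[ℝ] E} :
    HasMFDerivWithinAt 𝓘(ℝ, ℝ) I c s t f' ↔
      ContinuousWithinAt c s t ∧ HasFDerivWithinAt (extChartAt I (c t) ∘ c) f' s t := by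
  unfold HasMFDerivWithinAt writtenInExtChartAt
  have e : (extChartAt 𝓘(ℝ, ℝ) t).symm ⁻¹' s ∩ range 𝓘(ℝ, ℝ) = s := by
    rw [extChartAt_model_space_eq_id, ModelWithCorners.range_eq_univ, inter_univ]
    rfl
  rw [e, extChartAt_model_space_eq_id]
  rfl

lemma HasVelocity.hasMFDerivWithinAt (h : HasVelocity I c s t u) :
    HasMFDerivWithinAt 𝓘(ℝ, ℝ) I c s t (ContinuousLinearMap.toSpanSingleton ℝ u : ℝ →L[ℝ] E) :=
  hasMFDerivWithinAt_real_iff.2 ⟨h.1, h.2.hasFDerivWithinAt⟩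

lemma hasVelocity_of_hasMFDerivWithinAt {f' : ℝ →L[ℝ] E}
    (h : HasMFDerivWithinAt 𝓘(ℝ, ℝ) I c s t f') : HasVelocity I c s t (f' 1) := by
  have h2 := hasMFDerivWithinAt_real_iff.1 h
  exact ⟨h2.1, h2.2.hasDerivWithinAt⟩

lemma MDifferentiableWithinAt.hasVelocity (h : MDifferentiableWithinAt 𝓘(ℝ, ℝ) I c s t) :
    HasVelocity I c s t (mfderivWithin 𝓘(ℝ, ℝ) I c s t (1 : ℝ)) :=
  hasVelocity_of_hasMFDerivWithinAt h.hasMFDerivWithinAt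

lemma HasVelocity.comp {f : M → M'} (h : HasVelocity I c s t u)
    (hf : MDifferentiableAt I I' f (c t)) :
    HasVelocity I' (f ∘ c) s t (mfderiv I I' f (c t) u) := by
  have h1 := hasVelocity_of_hasMFDerivWithinAt
    (hf.hasMFDerivAt.comp_hasMFDerivWithinAt t h.hasMFDerivWithinAt)
  have e : (mfderiv I I' f (c t) ((1 : ℝ) • u) : E') = mfderiv I I' f (c t) u :=
    congrArg (mfderiv I I' f (c t)) (one_smul ℝ u)
  rw [← e]
  exact h1

lemma HasVelocity.comp_of_eq {f : M → M'} {x : M} (h : HasVelocity I c s t u) (hx : c t = x)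
    (hf : MDifferentiableAt I I' f x) : HasVelocity I' (f ∘ c) s t (mfderiv I I' f x u) := by
  subst hx
  exact h.comp hf

/-- The fiber at `x` is identified with the model space by the preferred chart at `x`, the chart
used in `HasVelocity`. This replaces an equality in the tangent bundle by one of vectors. -/
lemma mem_tangentTo_iff {S : Set M} {x : M} {u : E} :
    (⟨x, u⟩ : TangentBundle I M) ∈ tangentTo I S ↔
      ∃ c : ℝ → M, c 0 = x ∧ HasVelocity I c univ 0 u ∧ ∀ᶠ t in 𝓝 (0 : ℝ), c t ∈ S := by
  constructor
  · rintro ⟨c, hc, hS, hv⟩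
    have h0 : c 0 = x := congrArg Bundle.TotalSpace.proj hv
    subst h0
    refine ⟨c, rfl, ?_, hS⟩
    have h1 := MDifferentiableWithinAt.hasVelocity (mdifferentiableWithinAt_univ.2 hc)
    rw [mfderivWithin_univ] at h1
    have h2 : (mfderiv 𝓘(ℝ, ℝ) I c 0 (1 : ℝ) : E) = u := by
      have := (Bundle.TotalSpace.mk.injEq _ _ _ _).mp hv
      exact eq_of_heq this.2
    rwa [h2] at h1
  · rintro ⟨c, rfl, hv, hS⟩
    have h1 := hasMFDerivWithinAt_univ.1 hv.hasMFDerivWithinAt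
    refine ⟨c, h1.mdifferentiableAt, hS, ?_⟩
    unfold velocity
    congr 1
    rw [h1.mfderiv]
    exact one_smul ℝ u

lemma base_mem_of_mem_tangentTo {S : Set M} {δ : TangentBundle I M} (h : δ ∈ tangentTo I S) :
    δ.1 ∈ S := by
  obtain ⟨c, -, hS, rfl⟩ := h
  exact hS.self_of_nhds

end Velocity

/-! ### Finite powers of a manifold, entry by entry -/

section Power

variable {B : Type*} [NormedAddCommGroup B] [NormedSpace ℝ B]
  {V : Type*} [TopologicalSpace V] [ChartedSpace B V] {N : ℕ}

instance instBoundarylessPow : (powModel B N).Boundaryless := by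
  refine ⟨?_⟩
  simp [powModel, ModelWithCorners.pi]

/-- The preferred chart of the power is the product of the preferred charts of the factors. -/
lemma hasVelocity_pow {c : ℝ → Fin N → V} {s : Set ℝ} {t : ℝ} {δ : Fin N → B} :
    HasVelocity (powModel B N) c s t δ ↔
      ∀ k, HasVelocity 𝓘(ℝ, B) (fun t => c t k) s t (δ k) := by
  unfold HasVelocity
  rw [continuousWithinAt_pi, hasDerivWithinAt_pi]
  exact ⟨fun h k => ⟨h.1 k, h.2 k⟩, fun h => ⟨fun k => (h k).1, fun k => (h k).2⟩⟩

lemma eval_comp_extChartAt_symm (k : Fin N) (w : Fin N → V) :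
    extChartAt 𝓘(ℝ, B) (w k) ∘ (fun w : Fin N → V => w k) ∘ (extChartAt (powModel B N) w).symm
      =ᶠ[𝓝 (extChartAt (powModel B N) w w)] (ContinuousLinearMap.proj k : (Fin N → B) →L[ℝ] B) := by
  filter_upwards [extChartAt_target_mem_nhds (I := powModel B N) w] with z hz
  have h2 : z k ∈ (extChartAt 𝓘(ℝ, B) (w k)).target := by
    rw [extChartAt_target] at hz ⊢
    exact ⟨hz.1 k trivial, by simp⟩
  exact (extChartAt 𝓘(ℝ, B) (w k)).right_inv h2

lemma contMDiff_eval (k : Fin N) :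
    ContMDiff (powModel B N) 𝓘(ℝ, B) ∞ (fun w : Fin N → V => w k) := by
  intro w
  rw [contMDiffAt_iff]
  refine ⟨continuousAt_apply k w, ?_⟩
  rw [(powModel B N).range_eq_univ, contDiffWithinAt_univ]
  exact (ContinuousLinearMap.contDiff _).contDiffAt.congr_of_eventuallyEq
    (eval_comp_extChartAt_symm k w)

lemma mfderiv_eval (k : Fin N) (w : Fin N → V) :
    mfderiv (powModel B N) 𝓘(ℝ, B) (fun w : Fin N → V => w k) w =
      (ContinuousLinearMap.proj k : (Fin N → B) →L[ℝ] B) := by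
  refine HasMFDerivAt.mfderiv ⟨continuousAt_apply k w, ?_⟩
  have h : HasFDerivAt (extChartAt 𝓘(ℝ, B) (w k) ∘ (fun w : Fin N → V => w k) ∘
      (extChartAt (powModel B N) w).symm) (ContinuousLinearMap.proj k : (Fin N → B) →L[ℝ] B)
      (extChartAt (powModel B N) w w) :=
    (ContinuousLinearMap.hasFDerivAt (ContinuousLinearMap.proj k : (Fin N → B) →L[ℝ] B)
      ).congr_of_eventuallyEq (eval_comp_extChartAt_symm k w)
  exact h.hasFDerivWithinAt

lemma entry_mk (w : Fin N → V) (δ : Fin N → B) (k : Fin N) :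
    (DCLS.entry (⟨w, δ⟩ : TangentBundle (powModel B N) (Fin N → V)) k : B) = δ k :=
  congrArg (fun f : (Fin N → B) →L[ℝ] B => f δ) (mfderiv_eval k w)

end Power

/-! ### Lifting curves along submersions of vector spaces -/

section Lift

variable {E : Type*} [NormedAddCommGroup E] [NormedSpace ℝ E]
  {F : Type*} [NormedAddCommGroup F] [NormedSpace ℝ F] [FiniteDimensional ℝ F]

/-- Curves lift along maps with surjective strict derivative, with a prescribed velocity. -/
lemma exists_lift_curve {f : E → F} {f' : E →L[ℝ] F} {x ξ : E} (hf : HasStrictFDerivAt f f' x)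
    (hs : Function.Surjective f') {y : ℝ → F} (hy : HasDerivAt y (f' ξ) 0) (hy0 : y 0 = f x) :
    ∃ c : ℝ → E, c 0 = x ∧ HasDerivAt c ξ 0 ∧ (∀ᶠ t in 𝓝 0, f (c t) = y t) ∧
      ((∀ᶠ t in 𝓝 0, ContinuousAt y t) → ∀ᶠ t in 𝓝 0, ContinuousAt c t) := by
  obtain ⟨R, hR⟩ := f'.exists_rightInverse_of_surjective (LinearMap.range_eq_top.2 hs)
  have hR' : ∀ a, f' (R a) = a := fun a => congrArg (fun g : F →L[ℝ] F => g a) hR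
  -- the map `(t, a) ↦ (t, f (x + t ξ + R a))` is a local diffeomorphism
  let g : ℝ × F →L[ℝ] E := (ContinuousLinearMap.fst ℝ ℝ F).smulRight ξ +
    R.comp (ContinuousLinearMap.snd ℝ ℝ F)
  have hgx : HasStrictFDerivAt (fun q : ℝ × F => x + g q) g 0 :=
    g.hasStrictFDerivAt.const_add x
  have hfg : HasStrictFDerivAt (fun q : ℝ × F => f (x + g q)) (f'.comp g) 0 := by
    refine HasStrictFDerivAt.comp (x := (0 : ℝ × F)) (f := fun q : ℝ × F => x + g q) (g := f) ?_ hgx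
    simpa using hf
  let Θ : ℝ × F → ℝ × F := fun q => (q.1, f (x + g q))
  let Θ' : (ℝ × F) ≃L[ℝ] (ℝ × F) := ContinuousLinearEquiv.equivOfInverse
    ((ContinuousLinearMap.fst ℝ ℝ F).prod (f'.comp g))
    ((ContinuousLinearMap.fst ℝ ℝ F).prod (ContinuousLinearMap.snd ℝ ℝ F -
      (ContinuousLinearMap.fst ℝ ℝ F).smulRight (f' ξ)))
    (fun q => by ext <;> simp [g, hR']) (fun q => by ext <;> simp [g, hR'])
  have hΘ : HasStrictFDerivAt Θ (Θ' : ℝ × F →L[ℝ] ℝ × F) 0 :=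
    (ContinuousLinearMap.fst ℝ ℝ F).hasStrictFDerivAt.prodMk hfg
  have hΘ0 : Θ 0 = (0, f x) := by simp [Θ]
  let e := hΘ.toOpenPartialHomeomorph Θ
  have he0 : (0 : ℝ × F) ∈ e.source := hΘ.mem_toOpenPartialHomeomorph_source
  have het : ((0 : ℝ), f x) ∈ e.target := by
    rw [← hΘ0]; exact hΘ.image_mem_toOpenPartialHomeomorph_target
  have hinv : HasStrictFDerivAt e.symm (Θ'.symm : ℝ × F →L[ℝ] ℝ × F) (Θ 0) := hΘ.to_localInverse
  have hsymm0 : e.symm (0, f x) = 0 := by rw [← hΘ0]; exact e.left_inv he0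
  let Y : ℝ → ℝ × F := fun t => (t, y t)
  have hY0 : Y 0 = Θ 0 := by rw [hΘ0]; simp [Y, hy0]
  have hY : HasDerivAt Y (1, f' ξ) 0 := (hasDerivAt_id 0).prodMk hy
  have hYt : ∀ᶠ t in 𝓝 (0 : ℝ), Y t ∈ e.target :=
    hY.continuousAt.eventually_mem (e.open_target.mem_nhds (by rw [hY0, hΘ0]; exact het))
  refine ⟨fun t => x + g (e.symm (Y t)), ?_, ?_, ?_, ?_⟩
  · simp only [hY0, hΘ0, hsymm0, map_zero, add_zero]
  · rw [← hY0] at hinv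
    have h1 := hinv.hasFDerivAt.comp_hasDerivAt (0 : ℝ) hY
    have h2 := (g.hasFDerivAt.comp_hasDerivAt (0 : ℝ) h1).const_add x
    -- The line x + t ξ already has the right image to first order, so the correction `R a` has zero
    -- velocity and the lift has velocity ξ.
    have h3 : (Θ'.symm : ℝ × F →L[ℝ] ℝ × F) (1, f' ξ) = (1, 0) := by
      change ((1 : ℝ), f' ξ - (1 : ℝ) • f' ξ) = _
      simp
    have h4 : g (1, 0) = ξ := by simp [g]
    rw [h3, h4] at h2
    exact h2
  · filter_upwards [hYt] with t ht
    have h1 : Θ (e.symm (Y t)) = Y t := e.right_inv ht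
    have h2 : (e.symm (Y t)).1 = t := congrArg Prod.fst h1
    exact congrArg Prod.snd h1
  -- Differentiability at 0 gives no continuity at nearby times, which the connectedness argument in
  -- `mem_of_orbit` requires.
  · intro hc
    filter_upwards [hYt, hc] with t ht hct
    have h1 : ContinuousAt Y t := continuousAt_id.prodMk hct
    have h2 : ContinuousAt e.symm (Y t) := e.continuousAt_symm ht
    exact continuousAt_const.add (g.continuous.continuousAt.comp
      (ContinuousAt.comp (f := Y) (g := e.symm) h2 h1))

end Lift

/-! ### Tangent spaces of submanifolds and lifting of curves into them -/

section Submanifold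

variable {B : Type*} [NormedAddCommGroup B] [NormedSpace ℝ B]
  {V : Type*} [TopologicalSpace V] [ChartedSpace B V]

lemma mdifferentiable_of_mem_maximalAtlas {φ : OpenPartialHomeomorph V B}
    (hφ : φ ∈ IsManifold.maximalAtlas 𝓘(ℝ, B) ∞ V) : φ.MDifferentiable 𝓘(ℝ, B) 𝓘(ℝ, B) :=
  ⟨(contMDiffOn_of_mem_maximalAtlas hφ).mdifferentiableOn (by simp),
    (contMDiffOn_symm_of_mem_maximalAtlas hφ).mdifferentiableOn (by simp)⟩

/-- A chart of the maximal atlas has invertible derivatives. -/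
lemma exists_equiv_mfderiv_of_mem_maximalAtlas {φ : OpenPartialHomeomorph V B}
    (hφ : φ ∈ IsManifold.maximalAtlas 𝓘(ℝ, B) ∞ V) {v : V} (hv : v ∈ φ.source) :
    ∃ e : B ≃L[ℝ] B, (∀ u : B, (mfderiv 𝓘(ℝ, B) 𝓘(ℝ, B) φ v u : B) = e u) ∧
      ∀ u : B, (mfderiv 𝓘(ℝ, B) 𝓘(ℝ, B) φ.symm (φ v) u : B) = e.symm u :=
  ⟨(mdifferentiable_of_mem_maximalAtlas hφ).mfderiv hv, fun _ => rfl, fun _ => rfl⟩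

variable [FiniteDimensional ℝ B]

lemma _root_.HasDerivAt.mem_submodule {L : Submodule ℝ B} {c : ℝ → B} {u : B}
    (hc : HasDerivAt c u 0) (hL : ∀ᶠ t in 𝓝 (0 : ℝ), c t ∈ L) : u ∈ L := by
  have h1 := hasDerivAt_iff_tendsto_slope.1 hc
  refine L.closed_of_finiteDimensional.mem_of_tendsto h1 ?_
  filter_upwards [hL.filter_mono nhdsWithin_le_nhds] with t ht
  rw [slope_def_module]
  exact L.smul_mem _ (L.sub_mem ht hL.self_of_nhds)

/-- In the straightening chart a curve in `S` runs in `L`, which is closed and so contains the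
velocity; conversely, a straight line in `L` through φ v pulls back to a curve in `S`. -/
lemma mem_tangentTo_submanifold_iff {S : Set V} {φ : OpenPartialHomeomorph V B}
    (hφ : φ ∈ IsManifold.maximalAtlas 𝓘(ℝ, B) ∞ V) {L : Submodule ℝ B}
    (hL : ∀ y ∈ φ.source, y ∈ S ↔ φ y ∈ L) {v : V} (hv : v ∈ φ.source) (hvS : v ∈ S) (u : B) :
    (⟨v, u⟩ : TangentBundle 𝓘(ℝ, B) V) ∈ tangentTo 𝓘(ℝ, B) S ↔
      (mfderiv 𝓘(ℝ, B) 𝓘(ℝ, B) φ v u : B) ∈ L := by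
  have hmd := mdifferentiable_of_mem_maximalAtlas hφ
  rw [mem_tangentTo_iff]
  constructor
  · rintro ⟨c, rfl, hc, hcS⟩
    have h1 := hasVelocity_vector.1 (hc.comp (hmd.mdifferentiableAt hv))
    refine (hasDerivWithinAt_univ.1 h1).mem_submodule ?_
    have hcont : ContinuousAt c 0 := (continuousWithinAt_univ _ _).1 hc.1
    filter_upwards [hcS, hcont.eventually_mem (φ.open_source.mem_nhds hv)] with t ht1 ht2
    exact (hL _ ht2).1 ht1
  · intro hu
    obtain ⟨e, he, he'⟩ := exists_equiv_mfderiv_of_mem_maximalAtlas hφ hv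
    rw [he] at hu
    have h0 : φ v ∈ φ.target := φ.map_source hv
    let l : ℝ → B := fun t => φ v + t • e u
    have hl0 : l 0 = φ v := by simp [l]
    have hl : HasDerivAt l (e u) 0 := by
      have := ((hasDerivAt_id (0 : ℝ)).smul_const (e u)).const_add (φ v)
      rwa [one_smul] at this
    refine ⟨φ.symm ∘ l, by simp [hl0, φ.left_inv hv], ?_, ?_⟩
    · have h1 := (hasVelocity_vector.2 hl.hasDerivWithinAt).comp (s := univ) (f := φ.symm)
        (I' := 𝓘(ℝ, B)) (hmd.mdifferentiableAt_symm (by rw [hl0]; exact h0))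
      rw [hl0, he', e.symm_apply_apply] at h1
      exact h1
    · filter_upwards [hl.continuousAt.eventually_mem (φ.open_target.mem_nhds (by rwa [hl0]))]
        with t ht
      rw [Function.comp_apply, hL _ (φ.map_target ht), φ.right_inv ht]
      exact L.add_mem ((hL v hv).1 hvS) (L.smul_mem _ hu)

lemma IsEmbeddedSubmanifold.exists_tangent {S : Set V} {d : ℕ}
    (hS : IsEmbeddedSubmanifold (E := B) S d) {v : V} (hv : v ∈ S) :
    ∃ T : Submodule ℝ B, Module.finrank ℝ T = d ∧
      ∀ u : B, (⟨v, u⟩ : TangentBundle 𝓘(ℝ, B) V) ∈ tangentTo 𝓘(ℝ, B) S ↔ u ∈ T := by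
  obtain ⟨φ, hφ, hvφ, L, hLd, hL⟩ := hS v hv
  obtain ⟨e, he, -⟩ := exists_equiv_mfderiv_of_mem_maximalAtlas hφ hvφ
  refine ⟨L.map (e.symm.toLinearEquiv : B →ₗ[ℝ] B), ?_, fun u => ?_⟩
  · rw [LinearEquiv.finrank_map_eq, hLd]
  · rw [mem_tangentTo_submanifold_iff hφ hL hvφ hv, he]
    exact (Submodule.mem_map_equiv (e := e.symm.toLinearEquiv) L).symm

variable {A : Type*} [NormedAddCommGroup A] [NormedSpace ℝ A] [FiniteDimensional ℝ A]
  {Q : Type*} [TopologicalSpace Q] [ChartedSpace A Q]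

/-- Curves lift along the restriction of `f` to a submanifold `S`, if this is a submersion. -/
lemma IsEmbeddedSubmanifold.exists_lift_curve {S : Set V} {d : ℕ}
    (hS : IsEmbeddedSubmanifold (E := B) S d) {f : V → Q} (hf : ContMDiff 𝓘(ℝ, B) 𝓘(ℝ, A) ∞ f)
    {v : V} (hv : v ∈ S)
    (hsurj : ∀ a : A, ∃ u : B, (⟨v, u⟩ : TangentBundle 𝓘(ℝ, B) V) ∈ tangentTo 𝓘(ℝ, B) S ∧
      (mfderiv 𝓘(ℝ, B) 𝓘(ℝ, A) f v u : A) = a)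
    {u : B} (hu : (⟨v, u⟩ : TangentBundle 𝓘(ℝ, B) V) ∈ tangentTo 𝓘(ℝ, B) S)
    {y : ℝ → Q} (hy0 : y 0 = f v)
    (hy : HasVelocity 𝓘(ℝ, A) y univ 0 (mfderiv 𝓘(ℝ, B) 𝓘(ℝ, A) f v u : A)) :
    ∃ c : ℝ → V, c 0 = v ∧ HasVelocity 𝓘(ℝ, B) c univ 0 u ∧
      (∀ᶠ t in 𝓝 0, c t ∈ S ∧ f (c t) = y t) ∧
      ((∀ᶠ t in 𝓝 0, ContinuousAt y t) → ∀ᶠ t in 𝓝 0, ContinuousAt c t) := by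
  obtain ⟨φ, hφ, hvφ, L, -, hL⟩ := hS v hv
  have hmd := mdifferentiable_of_mem_maximalAtlas hφ
  obtain ⟨e, he, he'⟩ := exists_equiv_mfderiv_of_mem_maximalAtlas hφ hvφ
  have hT := mem_tangentTo_submanifold_iff hφ hL hvφ hv
  simp only [he] at hT
  set ψ := extChartAt 𝓘(ℝ, A) (f v) with hψ
  have h0 : φ v ∈ φ.target := φ.map_source hvφ
  have hsm : ContDiffAt ℝ ∞ (ψ ∘ f ∘ φ.symm) (φ v) := by
    rw [← contMDiffAt_iff_contDiffAt]
    refine ContMDiffAt.comp (I' := 𝓘(ℝ, A)) (φ v) ?_ ((hf _).comp (φ v)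
      (contMDiffAt_symm_of_mem_maximalAtlas hφ h0))
    simp only [Function.comp_apply, φ.left_inv hvφ]
    exact contMDiffAt_extChartAt
  -- The straightening chart need not be the preferred one at `v`, so the two derivatives of `f` are
  -- compared along straight lines.
  have hder : ∀ u : B, fderiv ℝ (ψ ∘ f ∘ φ.symm) (φ v) (e u) =
      (mfderiv 𝓘(ℝ, B) 𝓘(ℝ, A) f v u : A) := by
    intro u
    let l : ℝ → B := fun t => φ v + t • e u
    have hl0 : l 0 = φ v := by simp [l]
    have hl : HasDerivAt l (e u) 0 := by
      have := ((hasDerivAt_id (0 : ℝ)).smul_const (e u)).const_add (φ v)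
      rwa [one_smul] at this
    have h1 := (hasVelocity_vector.2 hl.hasDerivWithinAt).comp (s := univ) (f := φ.symm)
      (I' := 𝓘(ℝ, B)) (hmd.mdifferentiableAt_symm (by rw [hl0]; exact h0))
    rw [hl0, he', e.symm_apply_apply] at h1
    have h2 := hasDerivWithinAt_univ.1
      (h1.comp_of_eq (I' := 𝓘(ℝ, A)) (x := v) (by simp [hl0, φ.left_inv hvφ])
        ((hf _).mdifferentiableAt (by simp))).2
    simp only [Function.comp_apply, hl0, φ.left_inv hvφ] at h2
    have h3 := (hsm.differentiableAt (by simp)).hasFDerivAt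
    rw [← hl0] at h3
    have h4 := h3.comp_hasDerivAt (0 : ℝ) hl
    rw [hl0] at h4
    exact h4.unique h2
  let l0 : L := ⟨φ v, (hL v hvφ).1 hv⟩
  -- Restriction to `L` leaves a lifting problem between vector spaces, with surjective derivative
  -- because `f` restricted to `S` is a submersion at `v`.
  have hst : HasStrictFDerivAt (fun l : L => ψ (f (φ.symm l)))
      ((fderiv ℝ (ψ ∘ f ∘ φ.symm) (φ v)).comp L.subtypeL) l0 :=
    (hsm.hasStrictFDerivAt (by simp)).comp l0 L.subtypeL.hasStrictFDerivAt
  have hss : Function.Surjective ((fderiv ℝ (ψ ∘ f ∘ φ.symm) (φ v)).comp L.subtypeL) := by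
    intro a
    obtain ⟨u, hu, hua⟩ := hsurj a
    exact ⟨⟨e u, (hT u).1 hu⟩, (hder u).trans hua⟩
  have hyd : HasDerivAt (ψ ∘ y) ((fderiv ℝ (ψ ∘ f ∘ φ.symm) (φ v)).comp L.subtypeL
      ⟨e u, (hT u).1 hu⟩) 0 := by
    have := hasDerivWithinAt_univ.1 hy.2
    rw [hy0] at this
    rw [ContinuousLinearMap.comp_apply, Submodule.subtypeL_apply, hder]
    exact this
  obtain ⟨c, hc0, hc, hcy, hcc⟩ := DiscreteMechanics.exists_lift_curve hst hss hyd
    (by simp [l0, hy0, φ.left_inv hvφ])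
  have hcL : HasDerivAt (fun t => (c t : B)) (e u) 0 :=
    L.subtypeL.hasFDerivAt.comp_hasDerivAt (0 : ℝ) hc
  have hcL0 : (c 0 : B) = φ v := by rw [hc0]
  have hct : ∀ᶠ t in 𝓝 0, (c t : B) ∈ φ.target :=
    hcL.continuousAt.eventually_mem (φ.open_target.mem_nhds (by rwa [hcL0]))
  refine ⟨fun t => φ.symm (c t), by simp [hcL0, φ.left_inv hvφ], ?_, ?_, fun hyc => ?_⟩
  · have h1 := (hasVelocity_vector.2 hcL.hasDerivWithinAt).comp (s := univ) (f := φ.symm)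
      (I' := 𝓘(ℝ, B)) (hmd.mdifferentiableAt_symm (by rw [hcL0]; exact h0))
    rw [hcL0, he', e.symm_apply_apply] at h1
    exact h1
  · have hcont : ContinuousAt (fun t => φ.symm (c t)) 0 :=
      ContinuousAt.comp (g := φ.symm) (by rw [hcL0]; exact φ.continuousAt_symm h0)
        hcL.continuousAt
    have hsrc : ∀ᶠ t in 𝓝 0, f (φ.symm (c t)) ∈ ψ.source :=
      (hf.continuous.continuousAt.comp hcont).eventually_mem
        (by
          simp only [Function.comp_apply, hcL0, φ.left_inv hvφ]
          exact extChartAt_source_mem_nhds (I := 𝓘(ℝ, A)) (f v))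
    have hsrc' : ∀ᶠ t in 𝓝 0, y t ∈ ψ.source :=
      ((continuousWithinAt_univ _ _).1 hy.1).eventually_mem
        (by rw [hy0]; exact extChartAt_source_mem_nhds (I := 𝓘(ℝ, A)) (f v))
    filter_upwards [hct, hcy, hsrc, hsrc'] with t h1 h2 h3 h4
    refine ⟨(hL _ (φ.map_target h1)).2 (by rw [φ.right_inv h1]; exact (c t).2), ?_⟩
    exact ψ.injOn h3 h4 h2
  · have hyc' : ∀ᶠ t in 𝓝 0, ContinuousAt (ψ ∘ y) t := by
      have hsrc' : ∀ᶠ t in 𝓝 0, y t ∈ ψ.source :=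
        ((continuousWithinAt_univ _ _).1 hy.1).eventually_mem
          (by rw [hy0]; exact extChartAt_source_mem_nhds (I := 𝓘(ℝ, A)) (f v))
      filter_upwards [hyc, hsrc'] with t h1 h2
      exact (continuousAt_extChartAt' h2).comp h1
    filter_upwards [hcc hyc', hct] with t h1 h2
    exact ContinuousAt.comp (g := φ.symm) (f := fun t => (c t : B)) (φ.continuousAt_symm h2)
      (continuous_subtype_val.continuousAt.comp h1)

end Submanifold

/-! ### Level sets of the first integral of a flat frame -/

section FirstIntegral

variable {E : Type*} [NormedAddCommGroup E] [NormedSpace ℝ E]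
  {H : Type*} [NormedAddCommGroup H] [NormedSpace ℝ H]
  {p : E →L[ℝ] H} {G : E → H →L[ℝ] E} {G' : E → E →L[ℝ] H →L[ℝ] E} {M : ℝ}

lemma isLittleO_sq_norm_of_hasDerivWithinAt {f : ℝ → E} {w : E} {s : Set ℝ} {t : ℝ}
    (hf : HasDerivWithinAt f w s t) :
    (fun τ => ‖f τ - f t‖ ^ 2) =o[𝓝[s] t] fun τ => τ - t := by
  have h1 : (fun τ => f τ - f t) =O[𝓝[s] t] fun τ => τ - t := hf.hasFDerivWithinAt.isBigO_sub
  have h2 : (fun τ => f τ - f t) =o[𝓝[s] t] fun _ => (1 : ℝ) := by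
    rw [Asymptotics.isLittleO_one_iff]
    have := hf.continuousWithinAt.tendsto.sub_const (f t)
    rwa [sub_self] at this
  simpa [pow_two] using h1.norm_left.mul_isLittleO h2.norm_left

/-- Constancy to second order along a distribution implies that derivatives along curves which
are tangent to the distribution vanish. -/
lemma hasDerivWithinAt_zero_of_norm_sub_le {π : E → E} {U : Set E} {C : ℝ} {L : E →L[ℝ] E}
    {f : ℝ → E} {w : E} {s : Set ℝ} {t : ℝ} (hU : U ∈ 𝓝 (f t))
    (hπ : ∀ z ∈ U, ‖π z - π (f t)‖ ≤ C * (‖z - f t - L (z - f t)‖ + ‖z - f t‖ ^ 2))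
    (hf : HasDerivWithinAt f w s t) (hw : w = L w) : HasDerivWithinAt (π ∘ f) 0 s t := by
  have h1 : HasDerivWithinAt (fun τ => f τ - f t - L (f τ - f t)) (w - L w) s t :=
    (hf.sub_const _).sub (L.hasFDerivAt.comp_hasDerivWithinAt t (hf.sub_const _))
  rw [← hw, sub_self, hasDerivWithinAt_iff_isLittleO] at h1
  simp only [sub_self, map_zero, sub_zero, smul_zero] at h1
  rw [hasDerivWithinAt_iff_isLittleO]
  simp only [smul_zero, sub_zero, Function.comp_apply]
  refine Asymptotics.IsBigO.trans_isLittleO (Asymptotics.IsBigO.of_bound C ?_)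
    (h1.norm_left.add (isLittleO_sq_norm_of_hasDerivWithinAt hf))
  filter_upwards [hf.continuousWithinAt.eventually_mem hU] with τ hτ
  refine (hπ _ hτ).trans (le_of_eq ?_)
  rw [Real.norm_of_nonneg (by positivity)]

/-- Along a differentiable curve a defect of second order is o(τ − t), so its derivative w − L w
vanishes. -/
lemma eq_of_norm_sub_le_sq {C : ℝ} {L : E →L[ℝ] E}
    {f : ℝ → E} {w : E} {t : ℝ}
    (hU : ∀ᶠ τ in 𝓝 t, ‖f τ - f t - L (f τ - f t)‖ ≤ C * ‖f τ - f t‖ ^ 2)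
    (hf : HasDerivAt f w t) : w = L w := by
  have h1 : HasDerivAt (fun τ => f τ - f t - L (f τ - f t)) (w - L w) t :=
    (hf.sub_const _).sub (L.hasFDerivAt.comp_hasDerivAt t (hf.sub_const _))
  have h2 : HasDerivAt (fun τ => f τ - f t - L (f τ - f t)) 0 t := by
    rw [hasDerivAt_iff_isLittleO]
    simp only [sub_self, map_zero, sub_zero, smul_zero]
    have h3 := isLittleO_sq_norm_of_hasDerivWithinAt (hf.hasDerivWithinAt (s := univ))
    rw [nhdsWithin_univ] at h3
    refine Asymptotics.IsBigO.trans_isLittleO (Asymptotics.IsBigO.of_bound C ?_) h3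
    filter_upwards [hU] with τ hτ
    simpa using hτ
  exact sub_eq_zero.1 (h1.unique h2)

lemma eq_of_hasDerivWithinAt_zero {f : ℝ → E} {a b : ℝ}
    (hf : ∀ s ∈ Icc a b, HasDerivWithinAt f 0 (Icc a b) s) :
    ∀ s ∈ Icc a b, f s = f a :=
  constant_of_has_deriv_right_zero (fun s hs => (hf s hs).continuousWithinAt) fun s hs =>
    (hf s ⟨hs.1, hs.2.le⟩).mono_of_mem_nhdsWithin (Icc_mem_nhdsGE_of_mem hs)

/-- The distribution with flat frame `G` has local first integrals `π`, whose level sets are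
locally arcwise connected by curves tangent to the distribution. -/
theorem IsFlatFrame.exists_levelSets [CompleteSpace E] {z₀ : E} {ρ : ℝ} (hρ : 0 < ρ)
    (hG : IsFlatFrame p G G' (closedBall z₀ ρ) M) (hM : 1 ≤ M) :
    ∃ (π : E → E) (U : Set E), IsOpen U ∧ z₀ ∈ U ∧ U ⊆ closedBall z₀ ρ ∧
      (∀ (f : ℝ → E) (w : E) (s : Set ℝ) (t : ℝ), HasDerivWithinAt f w s t → f t ∈ U →
        w = G (f t) (p w) → HasDerivWithinAt (π ∘ f) 0 s t) ∧
      (∀ (f : ℝ → E) (w : E) (t : ℝ), HasDerivAt f w t → f t ∈ U →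
        (∀ᶠ τ in 𝓝 t, π (f τ) = π (f t)) → w = G (f t) (p w)) ∧
      (∀ z₁ ∈ U, ∀ O ∈ 𝓝 z₁, ∀ᶠ z₂ in 𝓝 z₁, π z₂ = π z₁ →
        ∃ h c, IsFlowArc G O h c ∧ c 0 = z₁ ∧ c 1 = z₂) ∧ ContinuousOn π U := by
  obtain ⟨π, U, C, hU, hz₀, hUρ, hC, hπ₁, hπ₂⟩ := hG.exists_firstIntegral hρ hM
  have hder : ∀ (f : ℝ → E) (w : E) (s : Set ℝ) (t : ℝ), HasDerivWithinAt f w s t → f t ∈ U →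
        w = G (f t) (p w) → HasDerivWithinAt (π ∘ f) 0 s t := fun f w s t hf ht hw =>
    hasDerivWithinAt_zero_of_norm_sub_le (L := (G (f t)).comp p) (hU.mem_nhds ht)
      (fun z hz => hπ₁ _ ht z hz) hf hw
  refine ⟨π, U, hU, hz₀, hUρ.trans (closedBall_subset_closedBall (by linarith)), hder, ?_, ?_, ?_⟩
  · intro f w t hf ht hc
    refine eq_of_norm_sub_le_sq (C := C) (L := (G (f t)).comp p) ?_ hf
    filter_upwards [hc, hf.continuousAt.eventually_mem (hU.mem_nhds ht)] with τ h1 h2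
    exact hπ₂ _ ht _ h2 h1.symm
  · intro z₁ hz₁ O hO
    obtain ⟨ε, hε, hball⟩ := Metric.mem_nhds_iff.1 (Filter.inter_mem hO (hU.mem_nhds hz₁))
    have hM0 : 0 < M := by linarith
    have hp0 : ContinuousAt (fun z => ‖p (z - z₁)‖) z₁ := by fun_prop
    have hsmall : ∀ η > 0, ∀ᶠ z in 𝓝 z₁, ‖p (z - z₁)‖ < η := fun η hη =>
      hp0.eventually_lt_const (by simpa using hη)
    -- The bounds on p (z − z₁) give, in order: parameter norm below 1, existence of the arc, its
    -- confinement to the ball of radius ε, and half of ‖z₂ − c 1‖ < 1 / C. The ball of radius 1 /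
    -- (2C) gives the other half.
    filter_upwards [hsmall 1 one_pos, hsmall (ρ / (2 * M)) (by positivity),
      hsmall (ε / M) (by positivity), hsmall (1 / (2 * C * M)) (by positivity), hU.mem_nhds hz₁,
      ball_mem_nhds z₁ (show 0 < 1 / (2 * C) by positivity)] with z₂ k1 k2 k3 k4 hz₂ k5 hππ
    set κ := p (z₂ - z₁) with hκ
    obtain ⟨c, hc, hc0, hcM⟩ := hG.exists_flowArc hM (hUρ hz₁) (h := κ) k1.le
      (by rw [lt_div_iff₀ (by positivity)] at k2; linarith)
    have hcb : ∀ s ∈ Icc (0 : ℝ) 1, c s ∈ ball z₁ ε := fun s hs => by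
      rw [mem_ball, dist_eq_norm]
      refine (hcM s hs).trans_lt ?_
      rw [lt_div_iff₀ hM0] at k3
      linarith
    refine ⟨κ, c, ⟨fun s hs => (hball (hcb s hs)).1, hc.deriv⟩, hc0, ?_⟩
    have h1 : (1 : ℝ) ∈ Icc (0 : ℝ) 1 := ⟨zero_le_one, le_rfl⟩
    have hp1 : p (c 1) - p z₁ = κ := by
      have h2 := eq_of_hasDerivWithinAt_zero (f := fun s => p (c s) - s • κ) (a := 0) (b := 1)
        (fun s hs => ?_) 1 h1
      · simp only [one_smul, zero_smul, sub_zero, hc0] at h2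
        rw [← h2]; abel
      · have h3 := (p.hasFDerivAt.comp_hasDerivWithinAt s (hc.deriv s hs)).sub
          ((hasDerivWithinAt_id s (Icc (0 : ℝ) 1)).smul_const κ)
        rw [hG.right_inv _ (hc.mem s hs), one_smul, sub_self] at h3
        exact h3
    have hπ1 : π (c 1) = π z₁ := by
      rw [← hc0]
      refine eq_of_hasDerivWithinAt_zero (f := π ∘ c) (fun s hs => ?_) 1 h1
      refine hder c _ _ s (hc.deriv s hs) (hball (hcb s hs)).2 ?_
      rw [hG.right_inv _ (hc.mem s hs)]
    have hp2 : p (z₂ - c 1) = 0 := by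
      have : p z₂ - p z₁ = κ := by rw [hκ, map_sub]
      rw [map_sub, sub_eq_zero]
      exact sub_left_injective (this.trans hp1.symm)
    -- The points `z₂` and `c 1` have equal values of `p` and `π`, so ‖z₂ − c 1‖ ≤ C ‖z₂ − c 1‖²; a
    -- distance below 1 / C must then be zero.
    have key := hπ₂ _ (hball (hcb 1 h1)).2 _ hz₂ (hπ1.trans hππ.symm)
    rw [hp2, map_zero, sub_zero] at key
    have hlt : ‖z₂ - c 1‖ < 1 / C := by
      have e : z₂ - c 1 = (z₂ - z₁) - (c 1 - z₁) := by abel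
      rw [e]
      refine (_root_.norm_sub_le _ _).trans_lt ?_
      rw [mem_ball, dist_eq_norm] at k5
      have k6 : M * ‖κ‖ < 1 / (2 * C) := by
        rw [lt_div_iff₀ (by positivity)] at k4 ⊢
        linarith
      have k7 : 1 / C = 1 / (2 * C) + 1 / (2 * C) := by field_simp; norm_num
      linarith [hcM 1 h1]
    rw [lt_div_iff₀ hC] at hlt
    have : ‖z₂ - c 1‖ = 0 := by nlinarith [norm_nonneg (z₂ - c 1)]
    exact (sub_eq_zero.1 (norm_eq_zero.1 this)).symm
  · intro z₁ hz₁
    refine ContinuousAt.continuousWithinAt ?_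
    rw [ContinuousAt, tendsto_iff_norm_sub_tendsto_zero]
    have hlim : ContinuousAt (fun z => C * (‖z - z₁ - G z₁ (p (z - z₁))‖ + ‖z - z₁‖ ^ 2)) z₁ := by
      fun_prop
    have hlim' := hlim.tendsto
    simp only [sub_self, map_zero, norm_zero, ne_eq, OfNat.ofNat_ne_zero, not_false_eq_true,
      zero_pow, add_zero, mul_zero] at hlim'
    refine squeeze_zero' (.of_forall fun _ => norm_nonneg _) ?_ hlim'
    filter_upwards [hU.mem_nhds hz₁] with z hz using hπ₁ _ hz₁ _ hz

end FirstIntegral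

/-! ### Normalized frames on a manifold and Frobenius' theorem -/

section Frame

variable {A : Type*} [NormedAddCommGroup A] [NormedSpace ℝ A]

variable {Q : Type*} [TopologicalSpace Q] [ChartedSpace A Q] [IsManifold 𝓘(ℝ, A) ∞ Q]

lemma contMDiffOn_extChartAt' (q : Q) :
    ContMDiffOn 𝓘(ℝ, A) 𝓘(ℝ, A) ∞ (extChartAt 𝓘(ℝ, A) q) (extChartAt 𝓘(ℝ, A) q).source := by
  rw [extChartAt_source]
  exact contMDiffOn_extChartAt

omit [IsManifold 𝓘(ℝ, A) ∞ Q] in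
lemma eventually_extChartAt_symm_mem {q x : Q} {U : Set Q} (hU : IsOpen U) (hx : x ∈ U)
    (hUs : U ⊆ (extChartAt 𝓘(ℝ, A) q).source) :
    ∀ᶠ z in 𝓝 (extChartAt 𝓘(ℝ, A) q x), (extChartAt 𝓘(ℝ, A) q).symm z ∈ U ∧
      extChartAt 𝓘(ℝ, A) q ((extChartAt 𝓘(ℝ, A) q).symm z) = z := by
  refine Filter.Eventually.and ?_ ?_
  · refine (continuousAt_extChartAt_symm' (hUs hx)).eventually_mem (hU.mem_nhds ?_)
    rwa [(extChartAt 𝓘(ℝ, A) q).left_inv (hUs hx)]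
  · filter_upwards [(isOpen_extChartAt_target q).mem_nhds
      ((extChartAt 𝓘(ℝ, A) q).map_source (hUs hx))] with z hz
    exact (extChartAt 𝓘(ℝ, A) q).right_inv hz

variable [FiniteDimensional ℝ A]

/-- Smooth fields which are linearly independent at a point span, near this point, the range of a
smooth normalized frame. -/
lemma exists_normalized_frame {r : ℕ} {W : Set A} (hW : IsOpen W) {X : Fin r → A → A}
    (hX : ∀ i, ContDiffOn ℝ ∞ (X i) W) {z₀ : A} (hz₀ : z₀ ∈ W)
    (hli : LinearIndependent ℝ fun i => X i z₀) :
    ∃ (p : A →L[ℝ] (Fin r → ℝ)) (G : A → (Fin r → ℝ) →L[ℝ] A) (W' : Set A), IsOpen W' ∧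
      z₀ ∈ W' ∧ W' ⊆ W ∧ ContDiffOn ℝ ∞ G W' ∧ (∀ z ∈ W', ∀ h, p (G z h) = h) ∧
      ∀ z ∈ W', ∀ w, w ∈ Submodule.span ℝ (range fun i => X i z) ↔ w = G z (p w) := by
  let T : A → (Fin r → ℝ) →L[ℝ] A := fun z =>
    ∑ i, (ContinuousLinearMap.proj i : (Fin r → ℝ) →L[ℝ] ℝ).smulRight (X i z)
  have hTa : ∀ z h, T z h = ∑ i, h i • X i z := fun z h => by simp [T]
  have hTsm : ContDiffOn ℝ ∞ T W := by
    refine ContDiffOn.sum fun i _ => ?_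
    exact (((ContinuousLinearMap.smulRightL ℝ (Fin r → ℝ) A)
      (ContinuousLinearMap.proj i)).contDiff.comp_contDiffOn (hX i))
  have hTr : ∀ z w, w ∈ Submodule.span ℝ (range fun i => X i z) ↔ ∃ h, T z h = w := fun z w => by
    rw [Submodule.mem_span_range_iff_exists_fun]
    simp only [hTa]
  have hker : LinearMap.ker (T z₀ : (Fin r → ℝ) →ₗ[ℝ] A) = ⊥ := by
    rw [LinearMap.ker_eq_bot']
    intro h hh
    have h1 : ∑ i, h i • X i z₀ = 0 := by rw [← hTa]; exact hh
    exact funext (Fintype.linearIndependent_iff.1 hli h h1)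
  -- A left inverse `p` of `T z₀` keeps p ∘ T z invertible for nearby z; composing `T z` with the
  -- inverse normalizes the frame without changing its range.
  obtain ⟨p', hp'⟩ := LinearMap.exists_leftInverse_of_injective _ hker
  let p : A →L[ℝ] (Fin r → ℝ) := LinearMap.toContinuousLinearMap p'
  have hp : ∀ h, p (T z₀ h) = h := fun h => congrArg (fun g : (Fin r → ℝ) →ₗ[ℝ] (Fin r → ℝ) => g h) hp'
  let S : A → (Fin r → ℝ) →L[ℝ] (Fin r → ℝ) := fun z => p.comp (T z)
  have hS : ContDiffOn ℝ ∞ S W := contDiffOn_const.clm_comp hTsm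
  have hS0 : S z₀ = 1 := by ext1 h; exact hp h
  have hu : ∀ z, IsUnit (S z) → ∀ h, p (T z (Ring.inverse (S z) h)) = h := fun z hz h =>
    congrArg (fun g : (Fin r → ℝ) →L[ℝ] (Fin r → ℝ) => g h) (Ring.mul_inverse_cancel _ hz)
  have hu' : ∀ z, IsUnit (S z) → ∀ h, Ring.inverse (S z) (p (T z h)) = h := fun z hz h =>
    congrArg (fun g : (Fin r → ℝ) →L[ℝ] (Fin r → ℝ) => g h) (Ring.inverse_mul_cancel _ hz)
  refine ⟨p, fun z => (T z).comp (Ring.inverse (S z)), W ∩ S ⁻¹' {g | IsUnit g},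
    hS.continuousOn.isOpen_inter_preimage hW Units.isOpen, ⟨hz₀, ?_⟩, inter_subset_left, ?_, ?_, ?_⟩
  · show IsUnit (S z₀)
    rw [hS0]; exact isUnit_one
  · refine (hTsm.mono inter_subset_left).clm_comp fun z hz => ?_
    obtain ⟨a, ha⟩ := hz.2
    have h1 : ContDiffAt ℝ ∞ Ring.inverse (S z) := by rw [← ha]; exact contDiffAt_ringInverse ℝ a
    exact h1.comp_contDiffWithinAt z ((hS z hz.1).mono inter_subset_left)
  · exact fun z hz h => hu z hz.2 h
  · intro z hz w
    rw [hTr]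
    constructor
    · rintro ⟨h, rfl⟩
      rw [ContinuousLinearMap.comp_apply, hu' z hz.2]
    · exact fun hw => ⟨_, hw.symm⟩

/-- A smooth distribution is given in a chart by a smooth normalized frame. -/
lemma IsSmoothDistribution.exists_frame {F : ∀ q : Q, Submodule ℝ (TangentSpace 𝓘(ℝ, A) q)} {r : ℕ}
    (hF : IsSmoothDistribution 𝓘(ℝ, A) F r) (q : Q) :
    ∃ (p : A →L[ℝ] (Fin r → ℝ)) (G : A → (Fin r → ℝ) →L[ℝ] A) (U : Set Q), IsOpen U ∧ q ∈ U ∧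
      U ⊆ (extChartAt 𝓘(ℝ, A) q).source ∧
      (∀ x ∈ U, ContDiffAt ℝ ∞ G (extChartAt 𝓘(ℝ, A) q x)) ∧
      (∀ x ∈ U, ∀ h, p (G (extChartAt 𝓘(ℝ, A) q x) h) = h) ∧
      ∀ x ∈ U, ∀ u : A, u ∈ F x ↔
        (mfderiv 𝓘(ℝ, A) 𝓘(ℝ, A) (extChartAt 𝓘(ℝ, A) q) x u : A) =
          G (extChartAt 𝓘(ℝ, A) q x) (p (mfderiv 𝓘(ℝ, A) 𝓘(ℝ, A) (extChartAt 𝓘(ℝ, A) q) x u)) := by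
  obtain ⟨U₁, hU₁, hq₁, X, hX, hXF⟩ := hF q
  set φ := extChartAt 𝓘(ℝ, A) q with hφ
  have hsrc : IsOpen φ.source := isOpen_extChartAt_source q
  have hqs : q ∈ φ.source := mem_extChartAt_source q
  set U₂ := U₁ ∩ φ.source with hU₂
  have hU₂o : IsOpen U₂ := hU₁.inter hsrc
  have ha : ∀ i, ContMDiffOn 𝓘(ℝ, A) 𝓘(ℝ, A) ∞ (fieldDeriv 𝓘(ℝ, A) φ (X i)) U₂ := fun i =>
    contMDiffOn_fieldDeriv hU₂o ((contMDiffOn_extChartAt' q).mono inter_subset_right)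
      ((hX i).mono inter_subset_left)
  set W := φ.target ∩ φ.symm ⁻¹' U₂ with hW
  have hsymm : ContMDiffOn 𝓘(ℝ, A) 𝓘(ℝ, A) ∞ φ.symm φ.target := contMDiffOn_extChartAt_symm q
  have hWo : IsOpen W := hsymm.continuousOn.isOpen_inter_preimage (isOpen_extChartAt_target q) hU₂o
  have hXs : ∀ i, ContDiffOn ℝ ∞ (fun z => fieldDeriv 𝓘(ℝ, A) φ (X i) (φ.symm z)) W := fun i => by
    rw [← contMDiffOn_iff_contDiffOn]
    exact (ha i).comp (hsymm.mono inter_subset_left) fun z hz => hz.2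
  have hinj : ∀ x ∈ φ.source, Function.Injective (mfderiv 𝓘(ℝ, A) 𝓘(ℝ, A) φ x) := fun x hx =>
    (isInvertible_mfderiv_extChartAt hx).injective
  have hφW : ∀ x ∈ U₂, φ x ∈ W ∧ φ.symm (φ x) = x := fun x hx =>
    ⟨⟨φ.map_source hx.2, by rw [mem_preimage, φ.left_inv hx.2]; exact hx⟩, φ.left_inv hx.2⟩
  have hli : LinearIndependent ℝ fun i => fieldDeriv 𝓘(ℝ, A) φ (X i) (φ.symm (φ q)) := by
    rw [(hφW q ⟨hq₁, hqs⟩).2]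
    exact ((hXF q hq₁).1).map' (mfderiv 𝓘(ℝ, A) 𝓘(ℝ, A) φ q).toLinearMap
      (LinearMap.ker_eq_bot.2 (hinj q hqs))
  obtain ⟨p, G, W', hW', hqW', hW'W, hG, hpG, hspan⟩ :=
    exists_normalized_frame hWo hXs (hφW q ⟨hq₁, hqs⟩).1 hli
  refine ⟨p, G, φ.source ∩ φ ⁻¹' W', (continuousOn_extChartAt q).isOpen_inter_preimage hsrc hW',
    ⟨hqs, hqW'⟩, inter_subset_left, fun x hx => (hG _ hx.2).contDiffAt (hW'.mem_nhds hx.2),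
    fun x hx => hpG _ hx.2, fun x hx u => ?_⟩
  have hxU : x ∈ U₁ := by
    have := (hW'W hx.2).2
    rw [mem_preimage, φ.left_inv hx.1] at this
    exact this.1
  refine Iff.trans ?_ (hspan _ hx.2 _)
  simp only [φ.left_inv hx.1]
  let D : TangentSpace 𝓘(ℝ, A) x →ₗ[ℝ] A := (mfderiv 𝓘(ℝ, A) 𝓘(ℝ, A) φ x).toLinearMap
  have e : Submodule.span ℝ (range fun i => fieldDeriv 𝓘(ℝ, A) φ (X i) x) = (F x).map D := by
    rw [← (hXF x hxU).2, Submodule.map_span, ← range_comp]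
    rfl
  rw [e]
  exact (Function.Injective.mem_set_image (f := D) (s := F x) (hinj x hx.1)).symm

/-- The frame of an involutive distribution has commuting coefficient fields. -/
lemma IsInvolutive.frame_symm {F : ∀ q : Q, Submodule ℝ (TangentSpace 𝓘(ℝ, A) q)} {r : ℕ}
    (hF : IsInvolutive 𝓘(ℝ, A) F) {q : Q}
    {p : A →L[ℝ] (Fin r → ℝ)} {G : A → (Fin r → ℝ) →L[ℝ] A} {U : Set Q} (hU : IsOpen U)
    (hUs : U ⊆ (extChartAt 𝓘(ℝ, A) q).source)
    (hG : ∀ x ∈ U, ContDiffAt ℝ ∞ G (extChartAt 𝓘(ℝ, A) q x))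
    (hp : ∀ x ∈ U, ∀ h, p (G (extChartAt 𝓘(ℝ, A) q x) h) = h)
    (hFG : ∀ x ∈ U, ∀ u : A, u ∈ F x ↔
        (mfderiv 𝓘(ℝ, A) 𝓘(ℝ, A) (extChartAt 𝓘(ℝ, A) q) x u : A) =
          G (extChartAt 𝓘(ℝ, A) q x) (p (mfderiv 𝓘(ℝ, A) 𝓘(ℝ, A) (extChartAt 𝓘(ℝ, A) q) x u)))
    {x : Q} (hx : x ∈ U) (h k : Fin r → ℝ) :
    fderiv ℝ G (extChartAt 𝓘(ℝ, A) q x) (G (extChartAt 𝓘(ℝ, A) q x) h) k =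
      fderiv ℝ G (extChartAt 𝓘(ℝ, A) q x) (G (extChartAt 𝓘(ℝ, A) q x) k) h := by
  set φ := extChartAt 𝓘(ℝ, A) q with hφ
  have hφU : ContMDiffOn 𝓘(ℝ, A) 𝓘(ℝ, A) ∞ φ U := (contMDiffOn_extChartAt' q).mono hUs
  have hinv : ∀ y ∈ U, (mfderiv 𝓘(ℝ, A) 𝓘(ℝ, A) φ y).IsInvertible := fun y hy =>
    isInvertible_mfderiv_extChartAt (hUs hy)
  let Z : (Fin r → ℝ) → ∀ y : Q, TangentSpace 𝓘(ℝ, A) y := fun h =>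
    VectorField.mpullback 𝓘(ℝ, A) 𝓘(ℝ, A) φ (fun z => (G z h : A))
  have hZ : ∀ h, ∀ y ∈ U, fieldDeriv 𝓘(ℝ, A) φ (Z h) y = G (φ y) h := fun h y hy =>
    (hinv y hy).self_apply_inverse _
  have hGh : ∀ h, ∀ y ∈ U, ContDiffAt ℝ ∞ (fun z => G z h) (φ y) := fun h y hy =>
    (hG y hy).clm_apply contDiffAt_const
  have hZs : ∀ h, SmoothFieldOn 𝓘(ℝ, A) (Z h) U := fun h y hy => by
    refine ContMDiffAt.contMDiffWithinAt ?_
    exact ContMDiffAt.mpullback_vectorField_preimage (n := ∞)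
      (contMDiffAt_vectorSpace_iff_contDiffAt.2 (hGh h y hy))
      ((hφU y hy).contMDiffAt (hU.mem_nhds hy)) (hinv y hy) (by simp)
  have hZF : ∀ h, ∀ y ∈ U, Z h y ∈ F y := fun h y hy => by
    refine (hFG y hy (Z h y)).2 ?_
    have e : (mfderiv 𝓘(ℝ, A) 𝓘(ℝ, A) φ y (Z h y) : A) = G (φ y) h := hZ h y hy
    rw [e, hp y hy]
  have hbr := (hFG x hx _).1 (hF U hU (Z h) (Z k) (hZs h) (hZs k) (hZF h) (hZF k) x hx)
  have hLB := fieldDeriv_mlieBracket hU hφU (hZs h) (hZs k) hx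
  have hterm : ∀ h k, fieldDeriv 𝓘(ℝ, A) (fieldDeriv 𝓘(ℝ, A) φ (Z k)) (Z h) x =
      fderiv ℝ G (φ x) (G (φ x) h) k := fun h k => by
    have e1 : fieldDeriv 𝓘(ℝ, A) φ (Z k) =ᶠ[𝓝 x] (fun z => G z k) ∘ φ :=
      Filter.eventuallyEq_of_mem (hU.mem_nhds hx) (hZ k)
    have hd : DifferentiableAt ℝ G (φ x) := (hG x hx).differentiableAt (by simp)
    rw [fieldDeriv_congr e1, fieldDeriv_comp ((hGh k x hx).differentiableAt (by simp))
      (((hφU x hx).contMDiffAt (hU.mem_nhds hx)).mdifferentiableAt (by simp)), hZ h x hx,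
      fderiv_clm_apply hd (differentiableAt_const k)]
    simp
  rw [hterm, hterm] at hLB
  have hbr' : fieldDeriv 𝓘(ℝ, A) φ (VectorField.mlieBracket 𝓘(ℝ, A) (Z h) (Z k)) x =
      G (φ x) (p (fieldDeriv 𝓘(ℝ, A) φ (VectorField.mlieBracket 𝓘(ℝ, A) (Z h) (Z k)) x)) := hbr
  rw [hLB] at hbr'
  -- As p ∘ G is constant, `p` annihilates the derivatives of `G`, hence the bracket. A vector of
  -- the distribution is determined by its image under `p`, so the bracket is zero.
  have hpz : ∀ w k, p (fderiv ℝ G (φ x) w k) = 0 := fun w k => by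
    have hd : DifferentiableAt ℝ G (φ x) := (hG x hx).differentiableAt (by simp)
    have h1 := p.hasFDerivAt.comp (φ x) (hd.hasFDerivAt.clm_apply (hasFDerivAt_const k (φ x)))
    have h2 : (p ∘ fun z => G z k) =ᶠ[𝓝 (φ x)] fun _ => k := by
      filter_upwards [eventually_extChartAt_symm_mem hU hx hUs] with z hz
      have := hp _ hz.1 k
      rwa [hz.2] at this
    have h3 := h1.unique ((hasFDerivAt_const k (φ x)).congr_of_eventuallyEq h2)
    simpa using congrArg (fun T : A →L[ℝ] (Fin r → ℝ) => T w) h3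
  rw [map_sub, hpz, hpz, sub_zero, map_zero] at hbr'
  exact sub_eq_zero.1 hbr'

omit [FiniteDimensional ℝ A] in
lemma mfderiv_extChartAt_mfderiv_symm {q : Q} {z : A} (hz : z ∈ (extChartAt 𝓘(ℝ, A) q).target)
    (w : A) : (mfderiv 𝓘(ℝ, A) 𝓘(ℝ, A) (extChartAt 𝓘(ℝ, A) q) ((extChartAt 𝓘(ℝ, A) q).symm z)
      (mfderiv 𝓘(ℝ, A) 𝓘(ℝ, A) (extChartAt 𝓘(ℝ, A) q).symm z w) : A) = w := by
  have h := mfderiv_extChartAt_comp_mfderivWithin_extChartAt_symm (I := 𝓘(ℝ, A)) hz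
  rw [ModelWithCorners.range_eq_univ, mfderivWithin_univ] at h
  exact congrArg (fun T : A →L[ℝ] A => T w) h

omit [FiniteDimensional ℝ A] in
/-- Integral curves of a coefficient field of a frame are tangent to the distribution. -/
lemma exists_hasVelocity_of_frame {F : ∀ q : Q, Submodule ℝ (TangentSpace 𝓘(ℝ, A) q)} {r : ℕ}
    {q : Q} {p : A →L[ℝ] (Fin r → ℝ)} {G : A → (Fin r → ℝ) →L[ℝ] A} {U : Set Q}
    (hp : ∀ x ∈ U, ∀ h, p (G (extChartAt 𝓘(ℝ, A) q x) h) = h)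
    (hFG : ∀ x ∈ U, ∀ u : A, u ∈ F x ↔
        (mfderiv 𝓘(ℝ, A) 𝓘(ℝ, A) (extChartAt 𝓘(ℝ, A) q) x u : A) =
          G (extChartAt 𝓘(ℝ, A) q x) (p (mfderiv 𝓘(ℝ, A) 𝓘(ℝ, A) (extChartAt 𝓘(ℝ, A) q) x u)))
    {c : ℝ → A} {s : Set ℝ} {t : ℝ} {h : Fin r → ℝ} (hct : c t ∈ (extChartAt 𝓘(ℝ, A) q).target)
    (hctU : (extChartAt 𝓘(ℝ, A) q).symm (c t) ∈ U) (hc : HasDerivWithinAt c (G (c t) h) s t) :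
    ∃ u : A, (mfderiv 𝓘(ℝ, A) 𝓘(ℝ, A) (extChartAt 𝓘(ℝ, A) q)
        ((extChartAt 𝓘(ℝ, A) q).symm (c t)) u : A) = G (c t) h ∧
      u ∈ F ((extChartAt 𝓘(ℝ, A) q).symm (c t)) ∧
      HasVelocity 𝓘(ℝ, A) ((extChartAt 𝓘(ℝ, A) q).symm ∘ c) s t u := by
  have hsd : MDifferentiableAt 𝓘(ℝ, A) 𝓘(ℝ, A) (extChartAt 𝓘(ℝ, A) q).symm (c t) :=
    ((contMDiffOn_extChartAt_symm (n := ∞) q _ hct).contMDiffAt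
      ((isOpen_extChartAt_target q).mem_nhds hct)).mdifferentiableAt (by simp)
  have e := mfderiv_extChartAt_mfderiv_symm hct (G (c t) h)
  refine ⟨_, e, (hFG _ hctU _).2 ?_, (hasVelocity_vector.2 hc).comp hsd⟩
  have e2 := hp _ hctU h
  have e1 := (extChartAt 𝓘(ℝ, A) q).right_inv hct
  rw [e1] at e2
  exact e.trans ((congrArg (fun z => G z _) e1).trans
    (congrArg (G (c t)) ((congrArg p e).trans e2))).symm

/-- `π` is, on `U`, a local first integral of the distribution `F`: the curves tangent to `F` are
the curves in the level sets of `π`, and the level sets are locally connected by such curves. -/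
structure IsFirstIntegral (F : ∀ q : Q, Submodule ℝ (TangentSpace 𝓘(ℝ, A) q)) (π : Q → A)
    (U : Set Q) : Prop where
  isOpen : IsOpen U
  continuousOn : ContinuousOn π U
  deriv_zero : ∀ (c : ℝ → Q) (s : Set ℝ) (t : ℝ) (u : A), HasVelocity 𝓘(ℝ, A) c s t u →
    c t ∈ U → u ∈ F (c t) → HasDerivWithinAt (π ∘ c) 0 s t
  mem_of_const : ∀ (c : ℝ → Q) (t : ℝ) (u : A), HasVelocity 𝓘(ℝ, A) c univ t u →
    c t ∈ U → (∀ᶠ τ in 𝓝 t, π (c τ) = π (c t)) → u ∈ F (c t)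
  joined : ∀ x ∈ U, ∀ O ∈ 𝓝 x, ∀ᶠ y in 𝓝 x, π y = π x → ∃ c : ℝ → Q, c 0 = x ∧ c 1 = y ∧
    ∀ t ∈ Icc (0 : ℝ) 1, c t ∈ O ∧ ∃ u : A, u ∈ F (c t) ∧ HasVelocity 𝓘(ℝ, A) c (Icc 0 1) t u

/-- **Frobenius' theorem**: an involutive distribution has local first integrals. -/
theorem IsInvolutive.exists_isFirstIntegral
    {F : ∀ q : Q, Submodule ℝ (TangentSpace 𝓘(ℝ, A) q)} {r : ℕ}
    (hF : IsInvolutive 𝓘(ℝ, A) F) (hFr : IsSmoothDistribution 𝓘(ℝ, A) F r) (q : Q) :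
    ∃ (π : Q → A) (U : Set Q), q ∈ U ∧ IsFirstIntegral F π U := by
  obtain ⟨p, G, U₁, hU₁, hq, hUs, hG, hp, hFG⟩ := hFr.exists_frame q
  have hsymm := fun x hx => hF.frame_symm hU₁ hUs hG hp hFG (x := x) hx
  set φ := extChartAt 𝓘(ℝ, A) q with hφ
  have hev := fun x hx => eventually_extChartAt_symm_mem (x := x) hU₁ hx hUs
  have hO : φ.symm ⁻¹' U₁ ∩ φ.target ∈ 𝓝 (φ q) :=
    Filter.inter_mem ((hev q hq).mono fun z hz => hz.1) (extChartAt_target_mem_nhds q)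
  obtain ⟨ρ, hρ, M, hM, hρO, hflat⟩ := exists_isFlatFrame (p := p)
    ((hG q hq).of_le (by norm_cast))
    ((hev q hq).mono fun z hz => by have := hp _ hz.1; rwa [hz.2] at this)
    ((hev q hq).mono fun z hz => by have := hsymm _ hz.1; rwa [hz.2] at this) hO
  obtain ⟨π, W, hW, hqW, hWρ, hπ₁, hπ₂, hπ₃, hπ₄⟩ := hflat.exists_levelSets hρ hM
  have hvel : ∀ (c : ℝ → Q) (s : Set ℝ) (t : ℝ) (u : A), HasVelocity 𝓘(ℝ, A) c s t u →
      c t ∈ U₁ → HasDerivWithinAt (φ ∘ c) (mfderiv 𝓘(ℝ, A) 𝓘(ℝ, A) φ (c t) u : A) s t :=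
    fun c s t u hc ht => hasVelocity_vector.1 (hc.comp
      (((contMDiffOn_extChartAt' q _ (hUs ht)).contMDiffAt
        ((isOpen_extChartAt_source q).mem_nhds (hUs ht))).mdifferentiableAt (by simp)))
  refine ⟨π ∘ φ, U₁ ∩ φ ⁻¹' W, ⟨hq, hqW⟩, ?_, ?_, ?_, ?_, ?_⟩
  · exact ((continuousOn_extChartAt q).mono hUs).isOpen_inter_preimage hU₁ hW
  · exact hπ₄.comp ((continuousOn_extChartAt q).mono (inter_subset_left.trans hUs))
      fun x hx => hx.2
  · intro c s t u hc ht hu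
    exact hπ₁ (φ ∘ c) _ s t (hvel c s t u hc ht.1) ht.2 ((hFG _ ht.1 u).1 hu)
  · intro c t u hc ht hconst
    exact (hFG _ ht.1 u).2
      (hπ₂ (φ ∘ c) _ t (hasDerivWithinAt_univ.1 (hvel c univ t u hc ht.1)) ht.2 hconst)
  · intro x hx O hO
    have hxs : x ∈ φ.source := hUs hx.1
    have hO' : φ.symm ⁻¹' (O ∩ U₁) ∩ φ.target ∈ 𝓝 (φ x) := by
      refine Filter.inter_mem ((continuousAt_extChartAt_symm' hxs).preimage_mem_nhds ?_)
        ((isOpen_extChartAt_target q).mem_nhds (φ.map_source hxs))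
      rw [φ.left_inv hxs]
      exact Filter.inter_mem hO (hU₁.mem_nhds hx.1)
    filter_upwards [(continuousAt_extChartAt' hxs).eventually (hπ₃ (φ x) hx.2 _ hO'),
      (isOpen_extChartAt_source q).mem_nhds hxs] with y hy hys hyx
    obtain ⟨h, c, hc, hc0, hc1⟩ := hy hyx
    refine ⟨φ.symm ∘ c, by rw [Function.comp_apply, hc0, φ.left_inv hxs],
      by rw [Function.comp_apply, hc1]; exact φ.left_inv hys, fun t ht => ?_⟩
    have hct := hc.mem t ht
    refine ⟨hct.1.1, ?_⟩
    obtain ⟨u, -, hu⟩ := exists_hasVelocity_of_frame hp hFG hct.2 hct.1.2 (hc.deriv t ht)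
    exact ⟨u, hu⟩

/-- Every vector of a smooth distribution is the velocity of a curve tangent to it. -/
lemma IsSmoothDistribution.exists_curve
    {F : ∀ q : Q, Submodule ℝ (TangentSpace 𝓘(ℝ, A) q)} {r : ℕ}
    (hF : IsSmoothDistribution 𝓘(ℝ, A) F r) {q : Q} {u : A} (hu : u ∈ F q) :
    ∃ c : ℝ → Q, c 0 = q ∧ HasVelocity 𝓘(ℝ, A) c univ 0 u ∧
      ∀ᶠ t in 𝓝 (0 : ℝ), ∃ u' : A, u' ∈ F (c t) ∧ HasVelocity 𝓘(ℝ, A) c univ t u' := by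
  obtain ⟨p, G, U, hU, hq, hUs, hG, hp, hFG⟩ := hF.exists_frame q
  set φ := extChartAt 𝓘(ℝ, A) q with hφ
  have hqs : q ∈ φ.source := hUs hq
  set κ := p (mfderiv 𝓘(ℝ, A) 𝓘(ℝ, A) φ q u) with hκ
  have hGκ : ContDiffAt ℝ 1 (fun z => G z κ) (φ q) :=
    ((hG q hq).of_le (by norm_cast)).clm_apply contDiffAt_const
  obtain ⟨c, hc0, ε, hε, hc⟩ :=
    hGκ.exists_forall_mem_closedBall_exists_eq_forall_mem_Ioo_hasDerivAt₀ 0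
  have hc' : ∀ᶠ t in 𝓝 (0 : ℝ), HasDerivAt c (G (c t) κ) t :=
    Filter.eventually_of_mem (Ioo_mem_nhds (by linarith) (by linarith)) hc
  have hφq : φ q ∈ φ.target := φ.map_source hqs
  have hsq : φ.symm (φ q) = q := φ.left_inv hqs
  have hcont : ContinuousAt c 0 := hc'.self_of_nhds.continuousAt
  have hev : ∀ᶠ t in 𝓝 (0 : ℝ), c t ∈ φ.target ∧ φ.symm (c t) ∈ U := by
    refine (hcont.eventually_mem ?_).and ((ContinuousAt.comp ?_ hcont).eventually_mem ?_)
    · rw [hc0]; exact (isOpen_extChartAt_target q).mem_nhds hφq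
    · rw [hc0]; exact continuousAt_extChartAt_symm q
    · rw [Function.comp_apply, hc0, hsq]; exact hU.mem_nhds hq
  refine ⟨φ.symm ∘ c, by rw [Function.comp_apply, hc0, hsq], ?_, ?_⟩
  · obtain ⟨u', hu', -, hv⟩ := exists_hasVelocity_of_frame hp hFG hev.self_of_nhds.1
      hev.self_of_nhds.2 (hc'.self_of_nhds.hasDerivWithinAt (s := univ))
    have e : u' = u := by
      refine (isInvertible_mfderiv_extChartAt (I := 𝓘(ℝ, A)) hqs).injective ?_
      rw [hc0, hsq] at hu'
      exact hu'.trans ((hFG q hq u).1 hu).symm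
    rwa [e] at hv
  · filter_upwards [hev, hc'] with t h1 h2
    obtain ⟨u', -, hu'⟩ := exists_hasVelocity_of_frame hp hFG h1.1 h1.2
      (h2.hasDerivWithinAt (s := univ))
    exact ⟨u', hu'⟩

end Frame

/-! ### Orbits of an involutive distribution -/

section Orbit

variable {A : Type*} [NormedAddCommGroup A] [NormedSpace ℝ A]
  {Q : Type*} [TopologicalSpace Q] [ChartedSpace A Q]
  {F : ∀ q : Q, Submodule ℝ (TangentSpace 𝓘(ℝ, A) q)}
  {ι : Type*} {π : ι → Q → A} {U : ι → Set Q}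

/-- `x` and `y` lie on the same level set of one of the functions `π i` on `U i`. -/
def SamePlaque (π : ι → Q → A) (U : ι → Set Q) (x y : Q) : Prop :=
  ∃ i, x ∈ U i ∧ y ∈ U i ∧ π i x = π i y

omit [TopologicalSpace Q] [ChartedSpace A Q] [NormedSpace ℝ A] [NormedAddCommGroup A] in
lemma samePlaque_symm {x y : Q} (h : SamePlaque π U x y) : SamePlaque π U y x := by
  obtain ⟨i, hx, hy, he⟩ := h
  exact ⟨i, hy, hx, he.symm⟩

/-- A level set of a first integral is contained in countably many level sets of another one. -/
lemma IsFirstIntegral.countable_image [SecondCountableTopology Q] {π₁ π₂ : Q → A} {U₁ U₂ : Set Q}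
    (h₁ : IsFirstIntegral F π₁ U₁) (h₂ : IsFirstIntegral F π₂ U₂) (a : A) :
    (π₂ '' {x | x ∈ U₁ ∧ x ∈ U₂ ∧ π₁ x = a}).Countable := by
  set P := {x | x ∈ U₁ ∧ x ∈ U₂ ∧ π₁ x = a} with hP
  -- `π₂` is locally constant on `P`: nearby points of `P` are joined inside `U₂` by curves tangent
  -- to `F`. Second countability then leaves countably many values.
  have hloc : ∀ x ∈ P, {y | π₂ y = π₂ x} ∈ 𝓝[P] x := fun x hx => by
    refine mem_nhdsWithin_iff_eventually.2 ?_
    filter_upwards [h₁.joined x hx.1 U₂ (h₂.isOpen.mem_nhds hx.2.1)] with y hy hyP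
    obtain ⟨c, hc0, hc1, hc⟩ := hy (hyP.2.2.trans hx.2.2.symm)
    have h := eq_of_hasDerivWithinAt_zero (f := π₂ ∘ c) (a := 0) (b := 1) (fun s hs => by
      obtain ⟨hs2, u, hu, hv⟩ := hc s hs
      exact h₂.deriv_zero c _ s u hv hs2 hu) 1 ⟨zero_le_one, le_rfl⟩
    simpa [hc0, hc1] using h
  obtain ⟨t, -, ht, hcov⟩ := TopologicalSpace.countable_cover_nhdsWithin hloc
  refine (ht.image π₂).mono ?_
  rintro _ ⟨x, hx, rfl⟩
  obtain ⟨y, hy, hxy⟩ := mem_iUnion₂.1 (hcov hx)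
  exact ⟨y, hy, Eq.symm hxy⟩

/-- Induction on the length of a chain of plaques: a plaque meets countably many plaques of each `π
j`, and there are countably many indices. Inside `U j` a plaque is recorded by its value of `π j`.
-/
lemma countable_image_orbit [SecondCountableTopology Q] [Countable ι]
    (hπ : ∀ i, IsFirstIntegral F (π i) (U i)) (x : Q) (j : ι) :
    (π j '' {y | y ∈ U j ∧ Relation.ReflTransGen (SamePlaque π U) x y}).Countable := by
  let O : ℕ → Set Q := fun n => Nat.rec {x} (fun _ s => {z | ∃ y ∈ s, SamePlaque π U y z}) n
  have hO : ∀ n j, (π j '' {y | y ∈ U j ∧ y ∈ O n}).Countable := by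
    intro n
    induction n with
    | zero =>
      exact fun j => ((countable_singleton x).mono fun y hy => hy.2).image _
    | succ n ih =>
      intro j
      refine Countable.mono ?_ (countable_iUnion fun i => (ih i).biUnion fun a _ =>
        (hπ i).countable_image (hπ j) a)
      rintro _ ⟨z, ⟨hzj, y, hy, i, hyi, hzi, hyz⟩, rfl⟩
      exact mem_iUnion.2 ⟨i, mem_iUnion₂.2
        ⟨π i y, ⟨y, ⟨hyi, hy⟩, rfl⟩, ⟨z, ⟨hzi, hzj, hyz.symm⟩, rfl⟩⟩⟩
  refine Countable.mono ?_ (countable_iUnion fun n => hO n j)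
  rintro _ ⟨y, ⟨hyj, hxy⟩, rfl⟩
  suffices h : ∃ n, y ∈ O n by
    obtain ⟨n, hn⟩ := h
    exact mem_iUnion.2 ⟨n, y, ⟨hyj, hn⟩, rfl⟩
  clear hyj
  induction hxy with
  | refl => exact ⟨0, rfl⟩
  | tail _ hyz ih =>
    obtain ⟨n, hn⟩ := ih
    exact ⟨n + 1, _, hn, hyz⟩

/-- A curve tangent to `F` stays in an orbit. -/
lemma reflTransGen_of_hasVelocity (hπ : ∀ i, IsFirstIntegral F (π i) (U i))
    (hU : ∀ x, ∃ i, x ∈ U i) {a b : ℝ} {c : ℝ → Q}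
    (hc : ∀ t ∈ Icc a b, ∃ u : A, u ∈ F (c t) ∧ HasVelocity 𝓘(ℝ, A) c (Icc a b) t u)
    {s t : ℝ} (hs : s ∈ Icc a b) (ht : t ∈ Icc a b) :
    Relation.ReflTransGen (SamePlaque π U) (c s) (c t) := by
  refine isPreconnected_Icc.induction₂' (fun s t => Relation.ReflTransGen (SamePlaque π U) (c s) (c t))
    (fun s hs => ?_) (fun x y z _ _ _ => Relation.ReflTransGen.trans) hs ht
  obtain ⟨i, hi⟩ := hU (c s)
  obtain ⟨u, -, hu⟩ := hc s hs
  obtain ⟨ε, hε, hsub⟩ := Metric.mem_nhdsWithin_iff.1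
    (hu.1.eventually_mem ((hπ i).isOpen.mem_nhds hi))
  refine Metric.mem_nhdsWithin_iff.2 ⟨ε, hε, fun τ hτ => ?_⟩
  have hsame : ∀ σ τ, σ ≤ τ → σ ∈ ball s ε ∩ Icc a b → τ ∈ ball s ε ∩ Icc a b →
      SamePlaque π U (c σ) (c τ) := fun σ τ hστ hσ hτ => by
    have hsub' : Icc σ τ ⊆ ball s ε ∩ Icc a b := by
      refine OrdConnected.out ?_ hσ hτ
      rw [Real.ball_eq_Ioo]
      infer_instance
    refine ⟨i, hsub hσ, hsub hτ, ?_⟩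
    refine (eq_of_hasDerivWithinAt_zero (f := π i ∘ c) (fun θ hθ => ?_) τ ⟨hστ, le_rfl⟩).symm
    obtain ⟨u, huF, hu⟩ := hc θ (hsub' hθ).2
    exact (hπ i).deriv_zero c _ θ u (hu.mono fun _ h => (hsub' h).2) (hsub (hsub' hθ)) huF
  have hs' : s ∈ ball s ε ∩ Icc a b := ⟨mem_ball_self hε, hs⟩
  rcases le_total s τ with h | h
  · exact ⟨.single (hsame s τ h hs' hτ), .single (samePlaque_symm (hsame s τ h hs' hτ))⟩
  · exact ⟨.single (samePlaque_symm (hsame τ s h hτ hs')), .single (hsame τ s h hτ hs')⟩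

lemma Reachable.reflTransGen (hπ : ∀ i, IsFirstIntegral F (π i) (U i))
    (hU : ∀ x, ∃ i, x ∈ U i) {x y : Q} (h : Reachable 𝓘(ℝ, A) F x y) :
    Relation.ReflTransGen (SamePlaque π U) x y := by
  induction h with
  | refl => exact .refl
  | tail _ hyz ih =>
    obtain ⟨a, b, c, hab, hc, hcF, rfl, rfl⟩ := hyz
    refine ih.trans (reflTransGen_of_hasVelocity hπ hU (a := a) (b := b) (fun t ht => ⟨_, hcF t ht,
      MDifferentiableWithinAt.hasVelocity ((hc t ht).mdifferentiableWithinAt (by simp))⟩)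
      ⟨le_rfl, hab.le⟩ ⟨hab.le, le_rfl⟩)

/-- The orbits of an involutive distribution are initial submanifolds: curves in an orbit are
tangent to the distribution. -/
lemma mem_of_orbit [SecondCountableTopology Q] [Countable ι]
    (hπ : ∀ i, IsFirstIntegral F (π i) (U i)) (hU : ∀ x, ∃ i, x ∈ U i) {x : Q} {c : ℝ → Q} {u : A}
    (hc : HasVelocity 𝓘(ℝ, A) c univ 0 u) (hcont : ∀ᶠ t in 𝓝 (0 : ℝ), ContinuousAt c t)
    (hx : ∀ᶠ t in 𝓝 (0 : ℝ), Relation.ReflTransGen (SamePlaque π U) x (c t)) : u ∈ F (c 0) := by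
  obtain ⟨j, hj⟩ := hU (c 0)
  refine (hπ j).mem_of_const c 0 u hc hj ?_
  have hcU := hcont.self_of_nhds.eventually_mem ((hπ j).isOpen.mem_nhds hj)
  obtain ⟨ε, hε, h⟩ := Metric.eventually_nhds_iff_ball.1 ((hcont.and hcU).and hx)
  -- The values of `π j` along the curve form a set both connected and countable, hence a single
  -- point.
  have hpre : IsPreconnected (π j ∘ c '' ball (0 : ℝ) ε) := by
    refine (convex_ball (0 : ℝ) ε).isPreconnected.image _ fun t ht => ?_
    exact ((((hπ j).continuousOn.continuousAt ((hπ j).isOpen.mem_nhds (h t ht).1.2))).comp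
      (h t ht).1.1).continuousWithinAt
  have hcount : (π j ∘ c '' ball (0 : ℝ) ε).Countable := by
    refine (countable_image_orbit hπ x j).mono ?_
    rintro _ ⟨t, ht, rfl⟩
    exact ⟨c t, ⟨(h t ht).1.2, (h t ht).2⟩, rfl⟩
  have hsub := hcount.isTotallyDisconnected _ subset_rfl hpre
  filter_upwards [ball_mem_nhds 0 hε] with t ht
  exact hsub ⟨t, ht, rfl⟩ ⟨0, mem_ball_self hε, rfl⟩

/-- If the points `x t` move along an involutive distribution `F` and `y t` can be reached from
`x t` along `F`, then the points `y t` move along `F`. -/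
theorem IsInvolutive.mem_of_reachable [IsManifold 𝓘(ℝ, A) ∞ Q] [FiniteDimensional ℝ A]
    [SecondCountableTopology Q] {r : ℕ} (hF : IsInvolutive 𝓘(ℝ, A) F)
    (hFr : IsSmoothDistribution 𝓘(ℝ, A) F r) {x y : ℝ → Q} {u : A}
    (hx : ∀ᶠ t in 𝓝 (0 : ℝ), ∃ u' : A, u' ∈ F (x t) ∧ HasVelocity 𝓘(ℝ, A) x univ t u')
    (hxy : ∀ᶠ t in 𝓝 (0 : ℝ), Reachable 𝓘(ℝ, A) F (x t) (y t))
    (hy : HasVelocity 𝓘(ℝ, A) y univ 0 u) (hcont : ∀ᶠ t in 𝓝 (0 : ℝ), ContinuousAt y t) :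
    u ∈ F (y 0) := by
  choose π U hqU hπ using hF.exists_isFirstIntegral hFr
  -- Countably many first integrals must suffice, since the orbit argument counts plaques.
  obtain ⟨s, hs, hcov⟩ := TopologicalSpace.countable_cover_nhds
    (fun q => (hπ q).isOpen.mem_nhds (hqU q))
  have : Countable s := hs.to_subtype
  have hU : ∀ x, ∃ i : s, x ∈ U i := fun x => by
    obtain ⟨i, hi, hxi⟩ := mem_iUnion₂.1 (hcov ▸ mem_univ x)
    exact ⟨⟨i, hi⟩, hxi⟩
  refine mem_of_orbit (ι := s) (x := x 0) (fun i => hπ i) hU hy hcont ?_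
  obtain ⟨ε, hε, h⟩ := Metric.eventually_nhds_iff_ball.1 hx
  filter_upwards [hxy, closedBall_mem_nhds (0 : ℝ) (half_pos hε)] with t ht htε
  -- From `x 0` to `x t` the curve `x` itself stays in the orbit; from `x t` to `y t` the
  -- reachability curve does.
  refine Relation.ReflTransGen.trans ?_ (ht.reflTransGen (fun i : s => hπ i) hU)
  rw [Real.closedBall_eq_Icc] at htε
  refine reflTransGen_of_hasVelocity (fun i : s => hπ i) hU (a := 0 - ε / 2) (b := 0 + ε / 2)
    (fun τ hτ => ?_) ⟨by linarith, by linarith⟩ htε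
  obtain ⟨u', hu', hv⟩ := h τ (closedBall_subset_ball (half_lt_self hε)
    (by rwa [Real.closedBall_eq_Icc]))
  exact ⟨u', hu', hv.mono (subset_univ _)⟩

end Orbit

/-! ### The dimension count -/

section LinearAlgebra

variable {A B : Type*} [AddCommGroup A] [Module ℝ A] [FiniteDimensional ℝ A]
  [AddCommGroup B] [Module ℝ B] [FiniteDimensional ℝ B]

lemma finrank_comap_of_surjective {f : B →ₗ[ℝ] A} (hf : Function.Surjective f)
    (F : Submodule ℝ A) :
    Module.finrank ℝ (F.comap f) + Module.finrank ℝ A =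
      Module.finrank ℝ F + Module.finrank ℝ B := by
  have h1 := (f.domRestrict (F.comap f)).finrank_range_add_finrank_ker
  have h2 : LinearMap.range (f.domRestrict (F.comap f)) = F := by
    rw [LinearMap.range_domRestrict, Submodule.map_comap_eq_of_surjective hf]
  have h3 : Module.finrank ℝ (LinearMap.ker (f.domRestrict (F.comap f))) =
      Module.finrank ℝ (LinearMap.ker f) := by
    rw [LinearMap.ker_domRestrict]
    exact (Submodule.comapSubtypeEquivOfLe (by
      intro x hx
      rw [Submodule.mem_comap, LinearMap.mem_ker.1 hx]
      exact F.zero_mem)).finrank_eq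
  have h4 := f.finrank_range_add_finrank_ker
  rw [LinearMap.range_eq_top.2 hf, finrank_top] at h4
  rw [h2, h3] at h1
  omega

/-- A dimension count: `m` and `p` being coordinates on `B`, a subspace `T` on which `m` is onto
with fibers of dimension `r = dim F₁ = dim F₂` satisfies `T ∩ m⁻¹ F₁ ⊆ p⁻¹ F₂` if and only if it
contains `m⁻¹ F₁ ∩ p⁻¹ F₂`. -/
lemma inf_comap_le_iff {m p : B →ₗ[ℝ] A} (hker : ∀ u, m u = 0 → p u = 0 → u = 0)
    (hB : Module.finrank ℝ B = 2 * Module.finrank ℝ A) {T : Submodule ℝ B} {F₁ F₂ : Submodule ℝ A}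
    {r : ℕ} (hT : Module.finrank ℝ T = Module.finrank ℝ A + r) (hF₁ : Module.finrank ℝ F₁ = r)
    (hF₂ : Module.finrank ℝ F₂ = r) (hm : ∀ a, ∃ u ∈ T, m u = a) :
    T ⊓ F₁.comap m ≤ F₂.comap p ↔ F₁.comap m ⊓ F₂.comap p ≤ T := by
  -- On `T` the kernel of `m` has dimension r, and `F₁` contributes another r.
  have e1 : Module.finrank ℝ (T ⊓ F₁.comap m : Submodule ℝ B) = 2 * r := by
    have hs : Function.Surjective (m.domRestrict T) := fun a => by
      obtain ⟨u, hu, h⟩ := hm a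
      exact ⟨⟨u, hu⟩, h⟩
    have h1 := finrank_comap_of_surjective hs F₁
    have h2 : (T ⊓ F₁.comap m : Submodule ℝ B) = (F₁.comap (m.domRestrict T)).map T.subtype := by
      have : F₁.comap (m.domRestrict T) = (F₁.comap m).comap T.subtype := rfl
      rw [this, Submodule.map_comap_subtype]
    rw [h2, Submodule.finrank_map_subtype_eq]
    omega
  -- Here u ↦ (m u, p u) is an isomorphism onto A × A, and the space is the preimage of F₁ × F₂.
  have e2 : Module.finrank ℝ (F₁.comap m ⊓ F₂.comap p : Submodule ℝ B) = 2 * r := by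
    have hinj : Function.Injective (m.prod p) := (injective_iff_map_eq_zero _).2 fun u hu =>
      hker u (congrArg Prod.fst hu) (congrArg Prod.snd hu)
    have hsurj : Function.Surjective (m.prod p) :=
      (LinearMap.injective_iff_surjective_of_finrank_eq_finrank
        (by rw [hB, Module.finrank_prod]; ring)).1 hinj
    have h1 := finrank_comap_of_surjective hsurj (F₁.prod F₂)
    have h2 : (F₁.comap m ⊓ F₂.comap p : Submodule ℝ B) = (F₁.prod F₂).comap (m.prod p) := by
      ext u; simp
    have h3 : Module.finrank ℝ (F₁.prod F₂) = Module.finrank ℝ F₁ + Module.finrank ℝ F₂ := by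
      have e : (F₁.prod F₂) = LinearMap.range (F₁.subtype.prodMap F₂.subtype) := by
        rw [LinearMap.range_prodMap, Submodule.range_subtype, Submodule.range_subtype]
      rw [e, LinearMap.finrank_range_of_inj (Function.Injective.prodMap
        Subtype.val_injective Subtype.val_injective), Module.finrank_prod]
    rw [h2]
    rw [Module.finrank_prod] at h1
    omega
  constructor
  · intro h
    have hle : T ⊓ F₁.comap m ≤ F₁.comap m ⊓ F₂.comap p := le_inf inf_le_right h
    rw [← Submodule.eq_of_le_of_finrank_eq hle (e1.trans e2.symm)]
    exact inf_le_left
  · intro h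
    have hle : F₁.comap m ⊓ F₂.comap p ≤ T ⊓ F₁.comap m := le_inf h inf_le_left
    rw [← Submodule.eq_of_le_of_finrank_eq hle (e2.trans e1.symm)]
    exact inf_le_right

end LinearAlgebra

/-! ### Transport of the constraint distribution -/

section Constraint

variable {A : Type*} [NormedAddCommGroup A] [NormedSpace ℝ A] [FiniteDimensional ℝ A]
  {Q : Type*} [TopologicalSpace Q] [ChartedSpace A Q] [IsManifold 𝓘(ℝ, A) ∞ Q]
  {B : Type*} [NormedAddCommGroup B] [NormedSpace ℝ B] [FiniteDimensional ℝ B]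
  {V : Type*} [TopologicalSpace V] [ChartedSpace B V] [IsManifold 𝓘(ℝ, B) ∞ V]
  {F : ∀ q : Q, Submodule ℝ (TangentSpace 𝓘(ℝ, A) q)} {r : ℕ}

omit [FiniteDimensional ℝ A] in
lemma IsSmoothDistribution.finrank_eq (hF : IsSmoothDistribution 𝓘(ℝ, A) F r) (q : Q) :
    Module.finrank ℝ (F q) = r := by
  obtain ⟨U, -, hq, X, -, hX⟩ := hF q
  rw [← (hX q hq).2, finrank_span_eq_card (hX q hq).1, Fintype.card_fin]

namespace DCLS

variable (S : DCLS A Q B V)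

/-- The derivative of `∂⁺` at `v`, as a map between the model spaces. -/
def derivPlus (v : V) : B →L[ℝ] A := mfderiv 𝓘(ℝ, B) 𝓘(ℝ, A) S.dPlus v

/-- The derivative of `∂⁻` at `v`, as a map between the model spaces. -/
def derivMinus (v : V) : B →L[ℝ] A := mfderiv 𝓘(ℝ, B) 𝓘(ℝ, A) S.dMinus v

variable {S}

omit [FiniteDimensional ℝ A] [FiniteDimensional ℝ B] in
lemma derivMinus_surjective_of_mem {v : V} (hv : v ∈ S.D) (a : A) :
    ∃ u : B, (⟨v, u⟩ : TangentBundle 𝓘(ℝ, B) V) ∈ tangentTo 𝓘(ℝ, B) S.D ∧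
      S.derivMinus v u = a :=
  S.submersion_dMinus_D v hv a

omit [FiniteDimensional ℝ A] [FiniteDimensional ℝ B] in
lemma derivMinus_derivPlus_injective {v : V} {u : B} (h : S.derivMinus v u = 0)
    (h' : S.derivPlus v u = 0) : u = 0 :=
  S.ker_inf_ker v u h' h

/-- Vectors can be prescribed by their two projections. -/
lemma exists_derivMinus_derivPlus (v : V) (a b : A) :
    ∃ u : B, S.derivMinus v u = a ∧ S.derivPlus v u = b := by
  have hinj : Function.Injective ((S.derivMinus v).prod (S.derivPlus v)) :=
    (injective_iff_map_eq_zero _).2 fun u hu =>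
      derivMinus_derivPlus_injective (congrArg Prod.fst hu) (congrArg Prod.snd hu)
  have hsurj : Function.Surjective ((S.derivMinus v).prod (S.derivPlus v)).toLinearMap :=
    (LinearMap.injective_iff_surjective_of_finrank_eq_finrank
      (by rw [S.dim_eq, Module.finrank_prod]; ring)).1 hinj
  obtain ⟨u, hu⟩ := hsurj (a, b)
  exact ⟨u, congrArg Prod.fst hu, congrArg Prod.snd hu⟩

variable (S F)

/-- Tangent vectors of `D_d` which start in the constraint distribution end in it. -/
def TransportsConstraint : Prop :=
  ∀ v ∈ S.D, ∀ u : B, (⟨v, u⟩ : TangentBundle 𝓘(ℝ, B) V) ∈ tangentTo 𝓘(ℝ, B) S.D →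
    S.derivMinus v u ∈ F (S.dMinus v) → S.derivPlus v u ∈ F (S.dPlus v)

variable {S F}

/-- Transport of the constraint distribution is equivalent to the tangency of all vectors with
both projections in the constraint distribution. -/
lemma HasLinearConstraints.transportsConstraint_iff (hF : S.HasLinearConstraints F r) :
    S.TransportsConstraint F ↔ ∀ v ∈ S.D, ∀ u : B, S.derivMinus v u ∈ F (S.dMinus v) →
      S.derivPlus v u ∈ F (S.dPlus v) →
      (⟨v, u⟩ : TangentBundle 𝓘(ℝ, B) V) ∈ tangentTo 𝓘(ℝ, B) S.D := by
  refine forall₂_congr fun v hv => ?_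
  obtain ⟨T, hTd, hT⟩ := S.submanifold_D.exists_tangent hv
  have key := inf_comap_le_iff (m := (S.derivMinus v).toLinearMap)
    (p := (S.derivPlus v).toLinearMap) (fun u => derivMinus_derivPlus_injective) S.dim_eq
    (hTd.trans hF.dim_eq) (F₁ := F (S.dMinus v)) (F₂ := F (S.dPlus v))
    (hF.smooth.finrank_eq _) (hF.smooth.finrank_eq _) (fun a => by
      obtain ⟨u, hu, hua⟩ := derivMinus_surjective_of_mem hv a
      exact ⟨u, (hT u).1 hu, hua⟩)
  refine Iff.trans ?_ (key.trans ?_)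
  · exact ⟨fun h u hu => h u ((hT u).2 hu.1) hu.2, fun h u hu hm => h ⟨(hT u).1 hu, hm⟩⟩
  · exact ⟨fun h u hm hp => (hT u).2 (h ⟨hm, hp⟩), fun h u hu => (hT u).1 (h u hu.1 hu.2)⟩

/-- The tangent vectors of `D_d` transport an involutive constraint distribution. -/
theorem HasLinearConstraints.transportsConstraint_of_isInvolutive [SecondCountableTopology Q]
    (hF : S.HasLinearConstraints F r) (hinv : IsInvolutive 𝓘(ℝ, A) F) :
    S.TransportsConstraint F := by
  intro v hv u hu hm
  obtain ⟨y, hy0, hy, hyF⟩ := hF.smooth.exists_curve hm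
  -- The lift stays in `S.D`, so for small t the point ∂⁺(c t) is reachable from ∂⁻(c t) = y t.
  obtain ⟨c, hc0, hc, hcy, hcc⟩ := S.submanifold_D.exists_lift_curve S.smooth_dMinus hv
    (derivMinus_surjective_of_mem hv) hu hy0 hy
  have hcont := hcc (hyF.mono fun t ⟨_, _, h⟩ => (continuousWithinAt_univ _ _).1 h.1)
  have h := hinv.mem_of_reachable hF.smooth (x := y) (y := S.dPlus ∘ c) hyF
    (hcy.mono fun t ht => by
      have := hF.reachable _ ht.1
      rwa [ht.2] at this)
    (hc.comp_of_eq hc0 ((S.smooth_dPlus v).mdifferentiableAt (by simp)))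
    (hcont.mono fun t ht => S.smooth_dPlus.continuous.continuousAt.comp ht)
  rw [Function.comp_apply, hc0] at h
  exact h

end DCLS

end Constraint

/-! ### Tangent vectors of sequences, and variations -/

section Chain

variable {A : Type*} [NormedAddCommGroup A] [NormedSpace ℝ A] [FiniteDimensional ℝ A]
  {Q : Type*} [TopologicalSpace Q] [ChartedSpace A Q] [IsManifold 𝓘(ℝ, A) ∞ Q]
  {B : Type*} [NormedAddCommGroup B] [NormedSpace ℝ B] [FiniteDimensional ℝ B]
  {V : Type*} [TopologicalSpace V] [ChartedSpace B V] [IsManifold 𝓘(ℝ, B) ∞ V]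
  {F : ∀ q : Q, Submodule ℝ (TangentSpace 𝓘(ℝ, A) q)} {r N : ℕ}

omit [IsManifold 𝓘(ℝ, B) ∞ V] [FiniteDimensional ℝ B] in
lemma isEmbeddedSubmanifold_univ [IsManifold 𝓘(ℝ, B) ∞ V] :
    IsEmbeddedSubmanifold (E := B) (univ : Set V) (Module.finrank ℝ B) := fun x _ =>
  ⟨chartAt B x, IsManifold.chart_mem_maximalAtlas x, mem_chart_source B x, ⊤, finrank_top ℝ B,
    fun y _ => by simp⟩

lemma mem_tangentTo_univ (v : V) (u : B) :
    (⟨v, u⟩ : TangentBundle 𝓘(ℝ, B) V) ∈ tangentTo 𝓘(ℝ, B) (univ : Set V) :=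
  (mem_tangentTo_submanifold_iff (L := ⊤) (IsManifold.chart_mem_maximalAtlas v)
    (fun y _ => by simp) (mem_chart_source B v) (mem_univ v) u).2 trivial

-- All tangent spaces of `Q` are copies of `A`; this moves membership between the fibers at ∂⁺(w k)
-- and ∂⁻(w l), which agree only propositionally.
omit [FiniteDimensional ℝ A] [FiniteDimensional ℝ B] [IsManifold 𝓘(ℝ, A) ∞ Q] in
lemma fiber_congr {q q' : Q} (h : q = q') {a : A} (ha : a ∈ F q) : a ∈ F q' := by
  subst h
  exact ha

namespace DCLS

variable {S : DCLS A Q B V}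

omit [FiniteDimensional ℝ A] [FiniteDimensional ℝ B] in
lemma tPlus_mk (w : Fin N → V) (δ : Fin N → B) (k : Fin N) :
    (S.tPlus (⟨w, δ⟩ : TangentBundle (powModel B N) (Fin N → V)) k : A) =
      S.derivPlus (w k) (δ k) :=
  congrArg (S.derivPlus (w k)) (entry_mk w δ k)

omit [FiniteDimensional ℝ A] [FiniteDimensional ℝ B] in
lemma tMinus_mk (w : Fin N → V) (δ : Fin N → B) (k : Fin N) :
    (S.tMinus (⟨w, δ⟩ : TangentBundle (powModel B N) (Fin N → V)) k : A) =
      S.derivMinus (w k) (δ k) :=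
  congrArg (S.derivMinus (w k)) (entry_mk w δ k)

omit [FiniteDimensional ℝ A] [FiniteDimensional ℝ B] in
lemma hasVelocity_dPlus {c : ℝ → V} {v : V} {u : B} (hc0 : c 0 = v)
    (hc : HasVelocity 𝓘(ℝ, B) c univ 0 u) :
    HasVelocity 𝓘(ℝ, A) (S.dPlus ∘ c) univ 0 (S.derivPlus v u) :=
  hc.comp_of_eq hc0 ((S.smooth_dPlus v).mdifferentiableAt (by simp))

omit [FiniteDimensional ℝ A] [FiniteDimensional ℝ B] in
lemma hasVelocity_dMinus {c : ℝ → V} {v : V} {u : B} (hc0 : c 0 = v)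
    (hc : HasVelocity 𝓘(ℝ, B) c univ 0 u) :
    HasVelocity 𝓘(ℝ, A) (S.dMinus ∘ c) univ 0 (S.derivMinus v u) :=
  hc.comp_of_eq hc0 ((S.smooth_dMinus v).mdifferentiableAt (by simp))

/-- The tangent vectors to the first order sequences with entries in a submanifold `T`. -/
lemma mem_tangentTo_chain {T : Set V} {d : ℕ} (hT : IsEmbeddedSubmanifold (E := B) T d)
    (hsurj : ∀ v ∈ T, ∀ a : A, ∃ u : B, (⟨v, u⟩ : TangentBundle 𝓘(ℝ, B) V) ∈ tangentTo 𝓘(ℝ, B) T ∧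
      S.derivMinus v u = a)
    {w : Fin N → V} (hw : w ∈ S.firstOrder N) (hwT : ∀ k, w k ∈ T) {δ : Fin N → B} :
    (⟨w, δ⟩ : TangentBundle (powModel B N) (Fin N → V)) ∈
        tangentTo (powModel B N) {w | w ∈ S.firstOrder N ∧ ∀ k, w k ∈ T} ↔
      (∀ k, (⟨w k, δ k⟩ : TangentBundle 𝓘(ℝ, B) V) ∈ tangentTo 𝓘(ℝ, B) T) ∧
      ∀ k l : Fin N, (l : ℕ) = k + 1 →
        S.derivPlus (w k) (δ k) = S.derivMinus (w l) (δ l) := by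
  constructor
  · intro h
    obtain ⟨c, hc0, hc, hcT⟩ := mem_tangentTo_iff.1 h
    have hck := hasVelocity_pow.1 hc
    refine ⟨fun k => mem_tangentTo_iff.2 ⟨fun t => c t k, congrFun hc0 k, hck k,
      hcT.mono fun t ht => ht.2 k⟩, fun k l hkl => ?_⟩
    refine (hasVelocity_dPlus (congrFun hc0 k) (hck k)).unique
      ((hasVelocity_dMinus (congrFun hc0 l) (hck l)).congr ?_)
    exact hcT.mono fun t ht => ht.1 k l hkl
  · rintro ⟨hδT, hδ⟩
    rcases isEmpty_or_nonempty (Fin N) with hN | ⟨⟨k₀⟩⟩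
    · exact mem_tangentTo_iff.2 ⟨fun _ => w, rfl, hasVelocity_pow.2 fun k => isEmptyElim k,
        .of_forall fun _ => ⟨hw, hwT⟩⟩
    -- Curves through the entries are built from left to right. The family is indexed by ℕ, with
    -- arbitrary values from n on, so that extending it is a single update.
    suffices key : ∀ n : ℕ, ∃ c : ℕ → ℝ → V,
        (∀ k : Fin N, (k : ℕ) < n → c k 0 = w k ∧ HasVelocity 𝓘(ℝ, B) (c k) univ 0 (δ k) ∧
          ∀ᶠ t in 𝓝 (0 : ℝ), c k t ∈ T) ∧
        ∀ k l : Fin N, (l : ℕ) < n → (l : ℕ) = k + 1 →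
          ∀ᶠ t in 𝓝 (0 : ℝ), S.dPlus (c k t) = S.dMinus (c l t) by
      obtain ⟨c, h1, h2⟩ := key N
      refine mem_tangentTo_iff.2 ⟨fun t k => c k t, funext fun k => (h1 k k.2).1,
        hasVelocity_pow.2 fun k => (h1 k k.2).2.1, ?_⟩
      refine Filter.Eventually.and ?_ ?_
      · change ∀ᶠ t in 𝓝 (0 : ℝ), ∀ k l : Fin N, (l : ℕ) = k + 1 →
          S.dPlus (c k t) = S.dMinus (c l t)
        refine Filter.eventually_all.2 fun k => Filter.eventually_all.2 fun l => ?_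
        exact Filter.eventually_imp_distrib_left.2 fun hkl => h2 k l l.2 hkl
      · exact Filter.eventually_all.2 fun k => (h1 k k.2).2.2
    intro n
    induction n with
    | zero =>
      exact ⟨fun _ _ => w k₀, fun k hk => absurd hk (Nat.not_lt_zero _),
        fun k l hl => absurd hl (Nat.not_lt_zero _)⟩
    | succ n ih =>
      obtain ⟨c, h1, h2⟩ := ih
      by_cases hn : n < N
      swap
      · exact ⟨c, fun k _ => h1 k (by omega), fun k l _ => h2 k l (by omega)⟩
      suffices hstep : ∃ c' : ℝ → V, (c' 0 = w ⟨n, hn⟩ ∧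
          HasVelocity 𝓘(ℝ, B) c' univ 0 (δ ⟨n, hn⟩) ∧ ∀ᶠ t in 𝓝 (0 : ℝ), c' t ∈ T) ∧
          ∀ k : Fin N, n = k + 1 → ∀ᶠ t in 𝓝 (0 : ℝ), S.dPlus (c k t) = S.dMinus (c' t) by
        obtain ⟨c', h3, h4⟩ := hstep
        refine ⟨Function.update c n c', fun k hk => ?_, fun k l hl hkl => ?_⟩
        · rcases Nat.lt_succ_iff_lt_or_eq.1 hk with hk | hk
          · rw [Function.update_of_ne hk.ne]
            exact h1 k hk
          · have e : k = ⟨n, hn⟩ := Fin.ext hk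
            rw [e, Function.update_self]
            exact h3
        · rw [Function.update_of_ne (show (k : ℕ) ≠ n by omega)]
          rcases Nat.lt_succ_iff_lt_or_eq.1 hl with hl | hl
          · rw [Function.update_of_ne hl.ne]
            exact h2 k l hl hkl
          · rw [hl, Function.update_self]
            exact h4 k (by omega)
      -- The first entry may follow any curve with its velocity; each later one lifts, along ∂⁻, the
      -- ∂⁺-projection of its predecessor, so that consecutive entries match.
      rcases n with _ | m
      · obtain ⟨c', h⟩ := mem_tangentTo_iff.1 (hδT ⟨0, hn⟩)
        exact ⟨c', h, fun k hk => by omega⟩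
      · let k : Fin N := ⟨m, by omega⟩
        obtain ⟨hk0, hk1, -⟩ := h1 k (Nat.lt_succ_self m)
        have e := hδ k ⟨m + 1, hn⟩ rfl
        have hv := hasVelocity_dPlus (S := S) hk0 hk1
        rw [e] at hv
        obtain ⟨c', h3, h4, h5, -⟩ := hT.exists_lift_curve S.smooth_dMinus (hwT ⟨m + 1, hn⟩)
          (hsurj _ (hwT _)) (hδT ⟨m + 1, hn⟩)
          (y := S.dPlus ∘ c k) (by rw [Function.comp_apply, hk0]; exact hw k _ rfl) hv
        refine ⟨c', ⟨h3, h4, h5.mono fun t ht => ht.1⟩, fun j hj => ?_⟩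
        have : j = k := Fin.ext (by simp only [k]; omega)
        rw [this]
        exact h5.mono fun t ht => ht.2.symm

lemma mem_tangentTo_firstOrder {w : Fin N → V} (hw : w ∈ S.firstOrder N) {δ : Fin N → B} :
    (⟨w, δ⟩ : TangentBundle (powModel B N) (Fin N → V)) ∈
        tangentTo (powModel B N) (S.firstOrder N) ↔
      ∀ k l : Fin N, (l : ℕ) = k + 1 →
        S.derivPlus (w k) (δ k) = S.derivMinus (w l) (δ l) := by
  have h := mem_tangentTo_chain (S := S) (isEmbeddedSubmanifold_univ (V := V) (B := B))
    (fun v _ a => by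
      obtain ⟨u, hu, -⟩ := exists_derivMinus_derivPlus (S := S) v a 0
      exact ⟨u, mem_tangentTo_univ v u, hu⟩) hw (fun k => mem_univ _) (δ := δ)
  have e : {w | w ∈ S.firstOrder N ∧ ∀ k, w k ∈ (univ : Set V)} = S.firstOrder N := by
    ext w; simp
  rw [e] at h
  rw [h]
  exact and_iff_right fun k => mem_tangentTo_univ _ _

lemma mem_tangentTo_constrained {w : Fin N → V} (hw : w ∈ S.constrained N) {δ : Fin N → B} :
    (⟨w, δ⟩ : TangentBundle (powModel B N) (Fin N → V)) ∈
        tangentTo (powModel B N) (S.constrained N) ↔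
      (∀ k, (⟨w k, δ k⟩ : TangentBundle 𝓘(ℝ, B) V) ∈ tangentTo 𝓘(ℝ, B) S.D) ∧
      ∀ k l : Fin N, (l : ℕ) = k + 1 →
        S.derivPlus (w k) (δ k) = S.derivMinus (w l) (δ l) :=
  mem_tangentTo_chain S.submanifold_D (fun _ hv => derivMinus_surjective_of_mem hv) hw.1 hw.2

omit [FiniteDimensional ℝ A] [FiniteDimensional ℝ B] in
lemma mem_fixedEndpoints {w : Fin N → V} {δ : Fin N → B} :
    (⟨w, δ⟩ : TangentBundle (powModel B N) (Fin N → V)) ∈ S.fixedEndpoints N ↔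
      (∀ k : Fin N, (k : ℕ) = 0 → S.derivMinus (w k) (δ k) = 0) ∧
      ∀ k : Fin N, (k : ℕ) + 1 = N → S.derivPlus (w k) (δ k) = 0 := by
  refine and_congr (forall₂_congr fun k _ => ?_) (forall₂_congr fun k _ => ?_)
  · exact ⟨fun h => (tMinus_mk w δ k).symm.trans h, fun h => (tMinus_mk w δ k).trans h⟩
  · exact ⟨fun h => (tPlus_mk w δ k).symm.trans h, fun h => (tPlus_mk w δ k).trans h⟩

lemma HasLinearConstraints.mem_variations (hF : S.HasLinearConstraints F r) {w : Fin N → V}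
    (hw : w ∈ S.constrained N) {δ : Fin N → B} :
    (⟨w, δ⟩ : TangentBundle (powModel B N) (Fin N → V)) ∈ S.variations N ↔
      (∀ k l : Fin N, (l : ℕ) = k + 1 →
        S.derivPlus (w k) (δ k) = S.derivMinus (w l) (δ l)) ∧
      ((∀ k : Fin N, (k : ℕ) = 0 → S.derivMinus (w k) (δ k) = 0) ∧
        ∀ k : Fin N, (k : ℕ) + 1 = N → S.derivPlus (w k) (δ k) = 0) ∧
      ∀ k, S.derivPlus (w k) (δ k) ∈ F (S.dPlus (w k)) := by
  refine and_congr (mem_tangentTo_firstOrder hw.1) (and_congr mem_fixedEndpoints ?_)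
  have h : ∀ k, S.tPlus (⟨w, δ⟩ : TangentBundle (powModel B N) (Fin N → V)) k ∈
      S.E ⟨w k, hw.2 k⟩ ↔ S.derivPlus (w k) (δ k) ∈ F (S.dPlus (w k)) := fun k => by
    rw [hF.E_eq]
    exact iff_of_eq (congrArg (fun a : A => a ∈ F (S.dPlus (w k))) (tPlus_mk w δ k))
  exact ⟨fun ⟨_, h'⟩ k => (h k).1 (h' k), fun h' => ⟨hw, fun k => (h k).2 (h' k)⟩⟩

omit [FiniteDimensional ℝ A] [FiniteDimensional ℝ B] in
/-- Transport of the constraint distribution along constrained sequences. -/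
lemma TransportsConstraint.derivPlus_mem (hP : S.TransportsConstraint F) {w : Fin N → V}
    (hw : w ∈ S.constrained N) {δ : Fin N → B}
    (hδ : ∀ k, (⟨w k, δ k⟩ : TangentBundle 𝓘(ℝ, B) V) ∈ tangentTo 𝓘(ℝ, B) S.D)
    (hc : ∀ k l : Fin N, (l : ℕ) = k + 1 → S.derivPlus (w k) (δ k) = S.derivMinus (w l) (δ l))
    (h0 : ∀ k : Fin N, (k : ℕ) = 0 → S.derivMinus (w k) (δ k) = 0) (k : Fin N) :
    S.derivPlus (w k) (δ k) ∈ F (S.dPlus (w k)) := by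
  obtain ⟨k, hk⟩ := k
  induction k with
  | zero =>
    refine hP _ (hw.2 _) _ (hδ _) ?_
    rw [h0 _ rfl]
    exact (F _).zero_mem
  | succ k ih =>
    refine hP _ (hw.2 _) _ (hδ _) ?_
    rw [← hc ⟨k, by omega⟩ _ rfl]
    exact fiber_congr (hw.1 _ _ rfl) (ih (by omega))

/-- Each entry of a variation starts where its predecessor ends, or with zero, so both its
projections lie in `F` and it is tangent to D_d. In the other direction, `derivPlus_mem` propagates
membership in `F` from the vanishing initial projection. -/
theorem HasLinearConstraints.variations_eq (hF : S.HasLinearConstraints F r)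
    (hP : S.TransportsConstraint F) :
    S.variations N = {δ | δ ∈ tangentTo (powModel B N) (S.constrained N) ∧
      δ ∈ S.fixedEndpoints N} := by
  have hP' := hF.transportsConstraint_iff.1 hP
  ext ⟨w, δ⟩
  constructor
  · intro h
    have hw : w ∈ S.constrained N := h.2.2.1
    obtain ⟨h1, h2, h3⟩ := (hF.mem_variations hw (δ := δ)).1 h
    refine ⟨(mem_tangentTo_constrained hw (δ := δ)).2 ⟨fun k => ?_, h1⟩, h.2.1⟩
    refine hP' _ (hw.2 k) _ ?_ (h3 k)
    obtain ⟨k, hk⟩ := k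
    cases k with
    | zero =>
      rw [h2.1 _ rfl]
      exact (F _).zero_mem
    | succ k =>
      rw [← h1 ⟨k, by omega⟩ _ rfl]
      exact fiber_congr (hw.1 _ _ rfl) (h3 _)
  · rintro ⟨h1, h2⟩
    have hw : w ∈ S.constrained N := base_mem_of_mem_tangentTo h1
    obtain ⟨h3, h4⟩ := (mem_tangentTo_constrained hw (δ := δ)).1 h1
    have h5 := (mem_fixedEndpoints (S := S) (w := w) (δ := δ)).1 h2
    exact (hF.mem_variations hw (δ := δ)).2 ⟨h4, h5, hP.derivPlus_mem hw h3 h4 h5.1⟩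

omit [FiniteDimensional ℝ A] [FiniteDimensional ℝ B] in
/-- Composable elements of `D_d` extend to constrained sequences. -/
lemma exists_constrained (hD : ∀ q : Q, ∃ v' ∈ S.D, S.dMinus v' = q) (hN : 2 ≤ N) {a b : V}
    (ha : a ∈ S.D) (hb : b ∈ S.D) (hab : S.dPlus a = S.dMinus b) :
    ∃ w ∈ S.constrained N, w ⟨0, by omega⟩ = a ∧ w ⟨1, by omega⟩ = b := by
  choose next hnext hm using hD
  let s : ℕ → V := fun n => Nat.rec b (fun _ v => next (S.dPlus v)) n
  have hs : ∀ n, s n ∈ S.D := fun n => by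
    cases n with
    | zero => exact hb
    | succ n => exact hnext _
  let w : ℕ → V := fun n => Nat.casesOn n a s
  have hw : ∀ n, w n ∈ S.D := fun n => by
    cases n with
    | zero => exact ha
    | succ n => exact hs n
  have hww : ∀ n, S.dPlus (w n) = S.dMinus (w (n + 1)) := fun n => by
    rcases n with _ | n
    · exact hab
    · exact (hm _).symm
  refine ⟨fun k => w k, ⟨fun k l hkl => ?_, fun k => hw k⟩, rfl, rfl⟩
  change S.dPlus (w k) = S.dMinus (w l)
  rw [hkl]
  exact hww k

/-- If all variations are tangent to the constraint, then the tangent vectors of `D_d` transport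
the constraint distribution. -/
theorem HasLinearConstraints.transportsConstraint_of_variations_subset
    (hF : S.HasLinearConstraints F r)
    (hD : ∀ q : Q, ∃ v ∈ S.D, ∃ v' ∈ S.D, S.dPlus v = q ∧ S.dMinus v' = q) (hN : 2 ≤ N)
    (h : S.variations N ⊆ tangentTo (powModel B N) (S.constrained N)) :
    S.TransportsConstraint F := by
  have key : ∀ a ∈ S.D, ∀ b ∈ S.D, S.dPlus a = S.dMinus b → ∀ u : A, u ∈ F (S.dPlus a) → ∀ x y : B,
      S.derivMinus a x = 0 → S.derivPlus a x = u → S.derivMinus b y = u → S.derivPlus b y = 0 →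
      (⟨a, x⟩ : TangentBundle 𝓘(ℝ, B) V) ∈ tangentTo 𝓘(ℝ, B) S.D ∧
      (⟨b, y⟩ : TangentBundle 𝓘(ℝ, B) V) ∈ tangentTo 𝓘(ℝ, B) S.D := by
    intro a ha b hb hab u hu x y hx hx' hy hy'
    obtain ⟨w, hw, hwa, hwb⟩ := exists_constrained (N := N)
      (fun q => by
        obtain ⟨-, -, v, hv, -, h⟩ := hD q
        exact ⟨v, hv, h⟩) hN ha hb hab
    -- The only nonzero junction velocity is `u`, between the first two entries, so fixed endpoints
    -- cost nothing.
    let δ : ℕ → B := fun n => if n = 0 then x else if n = 1 then y else 0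
    have hδ : (⟨w, fun k => δ k⟩ : TangentBundle (powModel B N) (Fin N → V)) ∈ S.variations N := by
      refine (hF.mem_variations hw (δ := fun k => δ k)).2 ⟨?_, ⟨?_, ?_⟩, ?_⟩
      · rintro ⟨k, hk⟩ ⟨l, hl⟩ (rfl : l = k + 1)
        rcases k with _ | _ | k
        · simp only [δ, hwa, hwb, zero_add, if_true, one_ne_zero, if_false]
          exact hx'.trans hy.symm
        · simp only [δ, hwb, zero_add, if_true, one_ne_zero, if_false, hy']
          simp
        · simp [δ]
      · rintro ⟨k, hk⟩ (rfl : k = 0)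
        simp only [δ, hwa, if_true, hx]
      · rintro ⟨k, hk⟩ hkN
        rcases k with _ | _ | k
        · simp at hkN; omega
        · simp only [δ, hwb, zero_add, if_true, one_ne_zero, if_false, hy']
        · simp [δ]
      · rintro ⟨k, hk⟩
        rcases k with _ | _ | k
        · simp only [δ, hwa, if_true, hx']
          exact fiber_congr (congrArg S.dPlus hwa.symm) hu
        · simp only [δ, hwb, zero_add, if_true, one_ne_zero, if_false, hy']
          exact (F _).zero_mem
        · simp only [δ, Nat.add_eq_zero_iff, one_ne_zero, and_false, if_false, Nat.add_eq_right,
            map_zero]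
          exact (F _).zero_mem
    have h1 := ((mem_tangentTo_constrained hw (δ := fun k => δ k)).1 (h hδ)).1
    have h2 := h1 ⟨0, by omega⟩
    have h3 := h1 ⟨1, by omega⟩
    rw [hwa] at h2
    rw [hwb] at h3
    exact ⟨h2, h3⟩
  refine hF.transportsConstraint_iff.2 fun v hv u hm hp => ?_
  obtain ⟨T, -, hT⟩ := S.submanifold_D.exists_tangent hv
  -- Split `u` into a part with fixed start and a part with fixed end. The first is tangent because
  -- `v` can be the first member of a composable pair, the second because `v` can be the second
  -- member of one.
  obtain ⟨x, hx, hx'⟩ := exists_derivMinus_derivPlus (S := S) v 0 (S.derivPlus v u)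
  obtain ⟨y, hy, hy'⟩ := exists_derivMinus_derivPlus (S := S) v (S.derivMinus v u) 0
  have hu : u = x + y := by
    refine sub_eq_zero.1 (derivMinus_derivPlus_injective (S := S) (v := v) ?_ ?_)
    · rw [map_sub, map_add, hx, hy, zero_add, sub_self]
    · rw [map_sub, map_add, hx', hy', add_zero, sub_self]
  rw [hT, hu]
  refine T.add_mem ((hT x).1 ?_) ((hT y).1 ?_)
  · obtain ⟨-, -, b, hb, -, hvb⟩ := hD (S.dPlus v)
    obtain ⟨z, hz, hz'⟩ := exists_derivMinus_derivPlus (S := S) b (S.derivPlus v u) 0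
    exact (key v hv b hb hvb.symm _ hp x z hx hx' hz hz').1
  · obtain ⟨a, ha, -, -, hav, -⟩ := hD (S.dMinus v)
    obtain ⟨z, hz, hz'⟩ := exists_derivMinus_derivPlus (S := S) a 0 (S.derivMinus v u)
    exact (key a ha v hv hav _ (fiber_congr hav.symm hm) z y hz hz' hy hy').2

end DCLS

end Chain

/-! ### Brackets of fields tangent to a subset -/

section Bracket

variable {E : Type*} [NormedAddCommGroup E] [NormedSpace ℝ E] [CompleteSpace E]
  {G : Type*} [NormedAddCommGroup G] [NormedSpace ℝ G]
  {H : Type*} [TopologicalSpace H] {I : ModelWithCorners ℝ E H} [I.Boundaryless]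
  {M : Type*} [TopologicalSpace M] [ChartedSpace H M] [IsManifold I ∞ M]

-- A derivative along a vector tangent to `S` depends only on the values along a curve in `S`.
omit [CompleteSpace E] [I.Boundaryless] [IsManifold I ∞ M] in
lemma fieldDeriv_eq_of_tangentTo {b₁ b₂ : M → G} {X : ∀ x : M, TangentSpace I x} {U S : Set M}
    (hU : IsOpen U) {x : M} (hx : x ∈ U) (h₁ : MDifferentiableAt I 𝓘(ℝ, G) b₁ x)
    (h₂ : MDifferentiableAt I 𝓘(ℝ, G) b₂ x)
    (hX : (⟨x, X x⟩ : TangentBundle I M) ∈ tangentTo I S) (h : ∀ y ∈ U ∩ S, b₁ y = b₂ y) :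
    fieldDeriv I b₁ X x = fieldDeriv I b₂ X x := by
  obtain ⟨c, hc0, hc, hcS⟩ := mem_tangentTo_iff.1 hX
  have hcU := ((continuousWithinAt_univ _ _).1 hc.1).eventually_mem
    (hU.mem_nhds (show c 0 ∈ U by rwa [hc0]))
  refine (hc.comp_of_eq hc0 h₁).unique ((hc.comp_of_eq hc0 h₂).congr ?_)
  filter_upwards [hcU, hcS] with t h3 h4 using h _ ⟨h3, h4⟩

/-- If two functions have the same derivatives along two vector fields at the points of a set `S`
to which these are tangent, then they have the same derivatives along the Lie bracket. -/
lemma fieldDeriv_mlieBracket_eq {g₁ g₂ : M → G} {X Y : ∀ x : M, TangentSpace I x} {U S : Set M}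
    (hU : IsOpen U) (hg₁ : ContMDiffOn I 𝓘(ℝ, G) ∞ g₁ U) (hg₂ : ContMDiffOn I 𝓘(ℝ, G) ∞ g₂ U)
    (hX : SmoothFieldOn I X U) (hY : SmoothFieldOn I Y U) {x : M} (hx : x ∈ U)
    (hXS : (⟨x, X x⟩ : TangentBundle I M) ∈ tangentTo I S)
    (hYS : (⟨x, Y x⟩ : TangentBundle I M) ∈ tangentTo I S)
    (hgX : ∀ y ∈ U ∩ S, fieldDeriv I g₁ X y = fieldDeriv I g₂ X y)
    (hgY : ∀ y ∈ U ∩ S, fieldDeriv I g₁ Y y = fieldDeriv I g₂ Y y) :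
    fieldDeriv I g₁ (VectorField.mlieBracket I X Y) x =
      fieldDeriv I g₂ (VectorField.mlieBracket I X Y) x := by
  have hsm : ∀ g : M → G, ContMDiffOn I 𝓘(ℝ, G) ∞ g U → ∀ Z : ∀ x : M, TangentSpace I x,
      SmoothFieldOn I Z U → MDifferentiableAt I 𝓘(ℝ, G) (fieldDeriv I g Z) x := fun g hg Z hZ =>
    ((contMDiffOn_fieldDeriv hU hg hZ x hx).contMDiffAt (hU.mem_nhds hx)).mdifferentiableAt
      (by simp)
  rw [fieldDeriv_mlieBracket hU hg₁ hX hY hx, fieldDeriv_mlieBracket hU hg₂ hX hY hx,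
    fieldDeriv_eq_of_tangentTo hU hx (hsm g₁ hg₁ Y hY) (hsm g₂ hg₂ Y hY) hXS hgY,
    fieldDeriv_eq_of_tangentTo hU hx (hsm g₁ hg₁ X hX) (hsm g₂ hg₂ X hX) hYS hgX]

omit [CompleteSpace E] [I.Boundaryless] [IsManifold I ∞ M] in
lemma fieldDeriv_const (X : ∀ x : M, TangentSpace I x) (x : M) (a : G) :
    fieldDeriv I (fun _ : M => a) X x = 0 := by
  have h : mfderiv I 𝓘(ℝ, G) (fun _ : M => a) x = 0 := mfderiv_const
  exact congrArg (fun T : E →L[ℝ] G => T (X x)) h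

end Bracket

/-! ### Coordinates of the projections of entries -/

section Entries

variable {B : Type*} [NormedAddCommGroup B] [NormedSpace ℝ B]
  {V : Type*} [TopologicalSpace V] [ChartedSpace B V]
  {G : Type*} [NormedAddCommGroup G] [NormedSpace ℝ G]
  {A : Type*} [NormedAddCommGroup A] [NormedSpace ℝ A]
  {Q : Type*} [TopologicalSpace Q] [ChartedSpace A Q] [IsManifold 𝓘(ℝ, A) ∞ Q] {N : ℕ}

/-- The `k`-th entry of a vector field on `V[1,N]`. -/
def fieldEntry (X : ∀ w : Fin N → V, TangentSpace (powModel B N) w) (k : Fin N)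
    (w : Fin N → V) : B :=
  (X w : Fin N → B) k

lemma fieldDeriv_entry {h : V → G} {k : Fin N} {w : Fin N → V}
    (hh : MDifferentiableAt 𝓘(ℝ, B) 𝓘(ℝ, G) h (w k))
    (X : ∀ w : Fin N → V, TangentSpace (powModel B N) w) :
    fieldDeriv (powModel B N) (fun w => h (w k)) X w =
      (mfderiv 𝓘(ℝ, B) 𝓘(ℝ, G) h (w k) (fieldEntry X k w : B) : G) := by
  have h1 := mfderiv_comp (I := powModel B N) (I' := 𝓘(ℝ, B)) (I'' := 𝓘(ℝ, G)) w hh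
    ((contMDiff_eval k w).mdifferentiableAt (by simp))
  refine (congrArg (fun T : (Fin N → B) →L[ℝ] G => T (X w)) h1).trans ?_
  exact congrArg (fun T : (Fin N → B) →L[ℝ] B =>
    (mfderiv 𝓘(ℝ, B) 𝓘(ℝ, G) h (w k) (T (X w)) : G)) (mfderiv_eval k w)

/-- Derivatives of the coordinates of `p (w k)`. -/
lemma fieldDeriv_coord_entry {p : V → Q} (hp : ContMDiff 𝓘(ℝ, B) 𝓘(ℝ, A) ∞ p) {q : Q} {k : Fin N}
    {w : Fin N → V} (hw : p (w k) ∈ (extChartAt 𝓘(ℝ, A) q).source)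
    (X : ∀ w : Fin N → V, TangentSpace (powModel B N) w) :
    fieldDeriv (powModel B N) (fun w => extChartAt 𝓘(ℝ, A) q (p (w k))) X w =
      (mfderiv 𝓘(ℝ, A) 𝓘(ℝ, A) (extChartAt 𝓘(ℝ, A) q) (p (w k))
        (mfderiv 𝓘(ℝ, B) 𝓘(ℝ, A) p (w k) (fieldEntry X k w : B)) : A) := by
  have h1 : MDifferentiableAt 𝓘(ℝ, A) 𝓘(ℝ, A) (extChartAt 𝓘(ℝ, A) q) (p (w k)) :=
    ((contMDiffOn_extChartAt' q _ hw).contMDiffAt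
      ((isOpen_extChartAt_source q).mem_nhds hw)).mdifferentiableAt (by simp)
  have h2 : MDifferentiableAt 𝓘(ℝ, B) 𝓘(ℝ, A) p (w k) := (hp _).mdifferentiableAt (by simp)
  refine (fieldDeriv_entry (h := extChartAt 𝓘(ℝ, A) q ∘ p) (h1.comp (w k) h2) X).trans ?_
  exact congrArg (fun T : B →L[ℝ] A => T (fieldEntry X k w)) (mfderiv_comp (w k) h1 h2)

lemma contMDiffOn_coord_entry {p : V → Q} (hp : ContMDiff 𝓘(ℝ, B) 𝓘(ℝ, A) ∞ p) (q : Q)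
    (k : Fin N) :
    ContMDiffOn (powModel B N) 𝓘(ℝ, A) ∞ (fun w : Fin N → V => extChartAt 𝓘(ℝ, A) q (p (w k)))
      ((fun w : Fin N → V => p (w k)) ⁻¹' (extChartAt 𝓘(ℝ, A) q).source) :=
  (contMDiffOn_extChartAt' q).comp (hp.comp (contMDiff_eval k)).contMDiffOn fun _ h => h

omit [IsManifold 𝓘(ℝ, A) ∞ Q] in
lemma isOpen_coord_entry {p : V → Q} (hp : ContMDiff 𝓘(ℝ, B) 𝓘(ℝ, A) ∞ p) (q : Q)
    (k : Fin N) :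
    IsOpen ((fun w : Fin N → V => p (w k)) ⁻¹' (extChartAt 𝓘(ℝ, A) q).source) :=
  (isOpen_extChartAt_source q).preimage (hp.continuous.comp (continuous_apply k))

lemma mfderiv_extChartAt_injective {q x : Q} (hx : x ∈ (extChartAt 𝓘(ℝ, A) q).source) {a b : A}
    (h : (mfderiv 𝓘(ℝ, A) 𝓘(ℝ, A) (extChartAt 𝓘(ℝ, A) q) x a : A) =
      mfderiv 𝓘(ℝ, A) 𝓘(ℝ, A) (extChartAt 𝓘(ℝ, A) q) x b) : a = b :=
  (isInvertible_mfderiv_extChartAt (I := 𝓘(ℝ, A)) hx).injective h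

end Entries

/-- Tangency to a submanifold becomes the vanishing of a derivative, to which the bracket identity
applies. Following the quotient map by a section keeps the values in `B`. -/
lemma exists_ker_eq {B : Type*} [NormedAddCommGroup B] [NormedSpace ℝ B] [FiniteDimensional ℝ B]
    (L : Submodule ℝ B) : ∃ P : B →L[ℝ] B, ∀ u, P u = 0 ↔ u ∈ L := by
  obtain ⟨s, hs⟩ := L.mkQ.exists_rightInverse_of_surjective (LinearMap.range_eq_top.2
    L.mkQ_surjective)
  refine ⟨LinearMap.toContinuousLinearMap (s ∘ₗ L.mkQ), fun u => ?_⟩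
  have hinj : Function.Injective s :=
    Function.LeftInverse.injective (g := L.mkQ) fun x => LinearMap.congr_fun hs x
  rw [LinearMap.coe_toContinuousLinearMap', LinearMap.comp_apply, map_eq_zero_iff s hinj,
    Submodule.mkQ_apply, Submodule.Quotient.mk_eq_zero]

/-! ### Transport implies involutivity of the variations -/

section Involutive

variable {A : Type*} [NormedAddCommGroup A] [NormedSpace ℝ A] [FiniteDimensional ℝ A]
  {Q : Type*} [TopologicalSpace Q] [ChartedSpace A Q] [IsManifold 𝓘(ℝ, A) ∞ Q]
  {B : Type*} [NormedAddCommGroup B] [NormedSpace ℝ B] [FiniteDimensional ℝ B]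
  {V : Type*} [TopologicalSpace V] [ChartedSpace B V] [IsManifold 𝓘(ℝ, B) ∞ V]
  {F : ∀ q : Q, Submodule ℝ (TangentSpace 𝓘(ℝ, A) q)} {r N : ℕ}

/-- Brackets of vector fields with entries tangent to a submanifold have this property. -/
lemma fieldEntry_mlieBracket_mem {T : Set V} {d : ℕ} (hT : IsEmbeddedSubmanifold (E := B) T d)
    {X Y : ∀ w : Fin N → V, TangentSpace (powModel B N) w} {U S : Set (Fin N → V)}
    (hU : IsOpen U) (hX : SmoothFieldOn (powModel B N) X U) (hY : SmoothFieldOn (powModel B N) Y U)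
    {w : Fin N → V} (hwU : w ∈ U)
    (hXS : (⟨w, X w⟩ : TangentBundle (powModel B N) (Fin N → V)) ∈ tangentTo (powModel B N) S)
    (hYS : (⟨w, Y w⟩ : TangentBundle (powModel B N) (Fin N → V)) ∈ tangentTo (powModel B N) S)
    {k : Fin N} (hS : ∀ w ∈ S, w k ∈ T)
    (hXT : ∀ w ∈ U ∩ S,
      (⟨w k, (fieldEntry X k w : B)⟩ : TangentBundle 𝓘(ℝ, B) V) ∈ tangentTo 𝓘(ℝ, B) T)
    (hYT : ∀ w ∈ U ∩ S,
      (⟨w k, (fieldEntry Y k w : B)⟩ : TangentBundle 𝓘(ℝ, B) V) ∈ tangentTo 𝓘(ℝ, B) T) :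
    (⟨w k, (fieldEntry (VectorField.mlieBracket (powModel B N) X Y) k w : B)⟩ :
      TangentBundle 𝓘(ℝ, B) V) ∈ tangentTo 𝓘(ℝ, B) T := by
  have hwT : w k ∈ T := hS w (base_mem_of_mem_tangentTo hXS)
  obtain ⟨φ, hφ, hwφ, L, -, hL⟩ := hT (w k) hwT
  obtain ⟨P, hP⟩ := exists_ker_eq L
  have hφs : ContMDiffOn 𝓘(ℝ, B) 𝓘(ℝ, B) ∞ φ φ.source := contMDiffOn_of_mem_maximalAtlas hφ
  have hφd : ∀ v ∈ φ.source, MDifferentiableAt 𝓘(ℝ, B) 𝓘(ℝ, B) φ v := fun v hv =>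
    ((hφs v hv).contMDiffAt (φ.open_source.mem_nhds hv)).mdifferentiableAt (by simp)
  have hPd : ∀ z : B, MDifferentiableAt 𝓘(ℝ, B) 𝓘(ℝ, B) P z := fun z =>
    P.differentiableAt.mdifferentiableAt
  set U' := U ∩ (fun w => w k) ⁻¹' φ.source with hU'
  have hU'o : IsOpen U' := hU.inter (φ.open_source.preimage (continuous_apply k))
  have hg : ContMDiffOn (powModel B N) 𝓘(ℝ, B) ∞ (fun w => P (φ (w k))) U' :=
    P.contDiff.contMDiff.comp_contMDiffOn
      (hφs.comp (contMDiff_eval k).contMDiffOn fun w hw => hw.2)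
  have hder : ∀ Z : ∀ w : Fin N → V, TangentSpace (powModel B N) w, ∀ w ∈ U', w k ∈ T →
      (fieldDeriv (powModel B N) (fun w => P (φ (w k))) Z w = 0 ↔
        (⟨w k, (fieldEntry Z k w : B)⟩ : TangentBundle 𝓘(ℝ, B) V) ∈ tangentTo 𝓘(ℝ, B) T) := by
    intro Z w hw hwT
    rw [mem_tangentTo_submanifold_iff hφ hL hw.2 hwT (fieldEntry Z k w)]
    refine Iff.trans (iff_of_eq (congrArg (fun z : B => z = 0) ?_)) (hP _)
    refine (fieldDeriv_entry (h := P ∘ φ) ((hPd _).comp (w k) (hφd _ hw.2)) Z).trans ?_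
    refine (congrArg (fun T : B →L[ℝ] B => T (fieldEntry Z k w))
      (mfderiv_comp (w k) (hPd _) (hφd _ hw.2))).trans ?_
    have e : mfderiv 𝓘(ℝ, B) 𝓘(ℝ, B) P (φ (w k)) = P := by
      rw [mfderiv_eq_fderiv]
      exact P.fderiv
    exact congrArg (fun T : B →L[ℝ] B => T (mfderiv 𝓘(ℝ, B) 𝓘(ℝ, B) φ (w k) (fieldEntry Z k w : B))) e
  refine (hder _ w ⟨hwU, hwφ⟩ hwT).1 ?_
  rw [fieldDeriv_mlieBracket_eq (S := S) (g₂ := fun _ => 0) hU'o hg contMDiffOn_const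
    (hX.mono inter_subset_left) (hY.mono inter_subset_left) ⟨hwU, hwφ⟩ hXS hYS, fieldDeriv_const]
  · intro y hy
    rw [fieldDeriv_const]
    exact (hder X y hy.1 (hS y hy.2)).2 (hXT y ⟨hy.1.1, hy.2⟩)
  · intro y hy
    rw [fieldDeriv_const]
    exact (hder Y y hy.1 (hS y hy.2)).2 (hYT y ⟨hy.1.1, hy.2⟩)

omit [FiniteDimensional ℝ A] in
/-- Brackets of vector fields which have a vanishing projection have this property. -/
lemma mfderiv_fieldEntry_mlieBracket_eq_zero {p : V → Q} (hp : ContMDiff 𝓘(ℝ, B) 𝓘(ℝ, A) ∞ p)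
    {X Y : ∀ w : Fin N → V, TangentSpace (powModel B N) w} {U S : Set (Fin N → V)}
    (hU : IsOpen U) (hX : SmoothFieldOn (powModel B N) X U) (hY : SmoothFieldOn (powModel B N) Y U)
    {w : Fin N → V} (hwU : w ∈ U)
    (hXS : (⟨w, X w⟩ : TangentBundle (powModel B N) (Fin N → V)) ∈ tangentTo (powModel B N) S)
    (hYS : (⟨w, Y w⟩ : TangentBundle (powModel B N) (Fin N → V)) ∈ tangentTo (powModel B N) S)
    {k : Fin N}
    (hXp : ∀ w ∈ U ∩ S, (mfderiv 𝓘(ℝ, B) 𝓘(ℝ, A) p (w k) (fieldEntry X k w : B) : A) = 0)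
    (hYp : ∀ w ∈ U ∩ S, (mfderiv 𝓘(ℝ, B) 𝓘(ℝ, A) p (w k) (fieldEntry Y k w : B) : A) = 0) :
    (mfderiv 𝓘(ℝ, B) 𝓘(ℝ, A) p (w k)
      (fieldEntry (VectorField.mlieBracket (powModel B N) X Y) k w : B) : A) = 0 := by
  set q := p (w k) with hq
  have hqs : p (w k) ∈ (extChartAt 𝓘(ℝ, A) q).source := mem_extChartAt_source (I := 𝓘(ℝ, A)) q
  have h := fieldDeriv_mlieBracket_eq (S := S) (g₂ := fun _ => 0)
    (hU.inter (isOpen_coord_entry hp q k))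
    ((contMDiffOn_coord_entry hp q k).mono inter_subset_right) contMDiffOn_const
    (hX.mono inter_subset_left) (hY.mono inter_subset_left) ⟨hwU, hqs⟩ hXS hYS
    (fun y hy => by
      rw [fieldDeriv_const, fieldDeriv_coord_entry hp hy.1.2]
      exact (congrArg _ (hXp y ⟨hy.1.1, hy.2⟩)).trans (map_zero _))
    (fun y hy => by
      rw [fieldDeriv_const, fieldDeriv_coord_entry hp hy.1.2]
      exact (congrArg _ (hYp y ⟨hy.1.1, hy.2⟩)).trans (map_zero _))
  rw [fieldDeriv_const, fieldDeriv_coord_entry hp hqs] at h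
  exact mfderiv_extChartAt_injective hqs (h.trans (map_zero _).symm)

omit [FiniteDimensional ℝ A] [IsManifold 𝓘(ℝ, A) ∞ Q] in
lemma mfderiv_extChartAt_congr {q x y : Q} (hxy : x = y) {a b : A} (hab : a = b) :
    (mfderiv 𝓘(ℝ, A) 𝓘(ℝ, A) (extChartAt 𝓘(ℝ, A) q) x a : A) =
      mfderiv 𝓘(ℝ, A) 𝓘(ℝ, A) (extChartAt 𝓘(ℝ, A) q) y b := by
  subst hxy hab
  rfl

namespace DCLS

variable {S : DCLS A Q B V}

omit [FiniteDimensional ℝ A] in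
/-- Brackets of vector fields which are tangent to the first order sequences, at the points of a
set `R` of first order sequences to which they are tangent, have this property. -/
lemma derivPlus_mlieBracket_eq
    {X Y : ∀ w : Fin N → V, TangentSpace (powModel B N) w} {U R : Set (Fin N → V)}
    (hU : IsOpen U) (hX : SmoothFieldOn (powModel B N) X U) (hY : SmoothFieldOn (powModel B N) Y U)
    {w : Fin N → V} (hwU : w ∈ U)
    (hXR : (⟨w, X w⟩ : TangentBundle (powModel B N) (Fin N → V)) ∈ tangentTo (powModel B N) R)
    (hYR : (⟨w, Y w⟩ : TangentBundle (powModel B N) (Fin N → V)) ∈ tangentTo (powModel B N) R)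
    {k l : Fin N} (hR : ∀ w ∈ R, S.dPlus (w k) = S.dMinus (w l))
    (hXp : ∀ w ∈ U ∩ R, S.derivPlus (w k) (fieldEntry X k w) =
      S.derivMinus (w l) (fieldEntry X l w))
    (hYp : ∀ w ∈ U ∩ R, S.derivPlus (w k) (fieldEntry Y k w) =
      S.derivMinus (w l) (fieldEntry Y l w)) :
    S.derivPlus (w k) (fieldEntry (VectorField.mlieBracket (powModel B N) X Y) k w) =
      S.derivMinus (w l) (fieldEntry (VectorField.mlieBracket (powModel B N) X Y) l w) := by
  have hwR := hR w (base_mem_of_mem_tangentTo hXR)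
  set q := S.dPlus (w k) with hq
  have hqs : S.dPlus (w k) ∈ (extChartAt 𝓘(ℝ, A) q).source :=
    mem_extChartAt_source (I := 𝓘(ℝ, A)) q
  have hqs' : S.dMinus (w l) ∈ (extChartAt 𝓘(ℝ, A) q).source := by rwa [← hwR]
  have h := fieldDeriv_mlieBracket_eq (S := R)
    (hU.inter ((isOpen_coord_entry S.smooth_dPlus q k).inter
      (isOpen_coord_entry S.smooth_dMinus q l)))
    ((contMDiffOn_coord_entry S.smooth_dPlus q k).mono (inter_subset_right.trans inter_subset_left))
    ((contMDiffOn_coord_entry S.smooth_dMinus q l).mono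
      (inter_subset_right.trans inter_subset_right))
    (hX.mono inter_subset_left) (hY.mono inter_subset_left) ⟨hwU, hqs, hqs'⟩ hXR hYR
    (fun y hy => by
      rw [fieldDeriv_coord_entry S.smooth_dPlus hy.1.2.1,
        fieldDeriv_coord_entry S.smooth_dMinus hy.1.2.2]
      exact mfderiv_extChartAt_congr (hR y hy.2) (hXp y ⟨hy.1.1, hy.2⟩))
    (fun y hy => by
      rw [fieldDeriv_coord_entry S.smooth_dPlus hy.1.2.1,
        fieldDeriv_coord_entry S.smooth_dMinus hy.1.2.2]
      exact mfderiv_extChartAt_congr (hR y hy.2) (hYp y ⟨hy.1.1, hy.2⟩))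
  rw [fieldDeriv_coord_entry S.smooth_dPlus hqs,
    fieldDeriv_coord_entry S.smooth_dMinus hqs'] at h
  exact mfderiv_extChartAt_injective hqs
    (h.trans (mfderiv_extChartAt_congr hwR.symm rfl))

/-- If the tangent vectors of `D_d` transport the constraint distribution, then the variations
are involutive. -/
theorem HasLinearConstraints.isInvolutiveAlong (hF : S.HasLinearConstraints F r)
    (hP : S.TransportsConstraint F) :
    IsInvolutiveAlong (powModel B N) (S.firstOrder N) (S.constrained N) (S.variations N) := by
  intro U hU X Y hX hY _ _ hXW hYW w hw
  -- Transport makes the fields tangent to the constrained sequences themselves, so conditions known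
  -- only at these points can be differentiated along them.
  have hT : ∀ Z : ∀ w : Fin N → V, TangentSpace (powModel B N) w,
      (∀ w ∈ U ∩ S.constrained N,
        (⟨w, Z w⟩ : TangentBundle (powModel B N) (Fin N → V)) ∈ S.variations N) →
      ∀ w ∈ U ∩ S.constrained N,
        (⟨w, Z w⟩ : TangentBundle (powModel B N) (Fin N → V)) ∈
          tangentTo (powModel B N) (S.constrained N) ∧
        (∀ k, (⟨w k, (fieldEntry Z k w : B)⟩ : TangentBundle 𝓘(ℝ, B) V) ∈ tangentTo 𝓘(ℝ, B) S.D) ∧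
        (∀ k l : Fin N, (l : ℕ) = k + 1 →
          S.derivPlus (w k) (fieldEntry Z k w) = S.derivMinus (w l) (fieldEntry Z l w)) ∧
        (∀ k : Fin N, (k : ℕ) = 0 → S.derivMinus (w k) (fieldEntry Z k w) = 0) ∧
        ∀ k : Fin N, (k : ℕ) + 1 = N → S.derivPlus (w k) (fieldEntry Z k w) = 0 := by
    intro Z hZ w hw
    have h := hZ w hw
    rw [hF.variations_eq hP] at h
    obtain ⟨h1, h2⟩ := (mem_tangentTo_constrained hw.2 (δ := Z w)).1 h.1
    obtain ⟨h3, h4⟩ := (mem_fixedEndpoints (S := S) (w := w) (δ := Z w)).1 h.2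
    exact ⟨h.1, h1, h2, h3, h4⟩
  have hX' := hT X hXW
  have hY' := hT Y hYW
  have hXw := (hX' w hw).1
  have hYw := (hY' w hw).1
  have hD : ∀ k, (⟨w k, (fieldEntry (VectorField.mlieBracket (powModel B N) X Y) k w : B)⟩ :
      TangentBundle 𝓘(ℝ, B) V) ∈ tangentTo 𝓘(ℝ, B) S.D := fun k =>
    fieldEntry_mlieBracket_mem S.submanifold_D hU hX hY hw.1 hXw hYw (fun w hw => hw.2 k)
      (fun w hw => (hX' w hw).2.1 k) (fun w hw => (hY' w hw).2.1 k)
  have hc : ∀ k l : Fin N, (l : ℕ) = k + 1 →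
      S.derivPlus (w k) (fieldEntry (VectorField.mlieBracket (powModel B N) X Y) k w) =
        S.derivMinus (w l) (fieldEntry (VectorField.mlieBracket (powModel B N) X Y) l w) :=
    fun k l hkl => derivPlus_mlieBracket_eq hU hX hY hw.1 hXw hYw (fun w hw => hw.1 k l hkl)
      (fun w hw => (hX' w hw).2.2.1 k l hkl) (fun w hw => (hY' w hw).2.2.1 k l hkl)
  have h0 : ∀ k : Fin N, (k : ℕ) = 0 →
      S.derivMinus (w k) (fieldEntry (VectorField.mlieBracket (powModel B N) X Y) k w) = 0 :=
    fun k hk => mfderiv_fieldEntry_mlieBracket_eq_zero S.smooth_dMinus hU hX hY hw.1 hXw hYw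
      (fun w hw => (hX' w hw).2.2.2.1 k hk) (fun w hw => (hY' w hw).2.2.2.1 k hk)
  have hN : ∀ k : Fin N, (k : ℕ) + 1 = N →
      S.derivPlus (w k) (fieldEntry (VectorField.mlieBracket (powModel B N) X Y) k w) = 0 :=
    fun k hk => mfderiv_fieldEntry_mlieBracket_eq_zero S.smooth_dPlus hU hX hY hw.1 hXw hYw
      (fun w hw => (hX' w hw).2.2.2.2 k hk) (fun w hw => (hY' w hw).2.2.2.2 k hk)
  -- Membership of the projections of the bracket in `F` needs no bracket computation: transport
  -- yields it from the conditions already obtained.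
  exact (hF.mem_variations hw.2 (δ := fun k =>
    fieldEntry (VectorField.mlieBracket (powModel B N) X Y) k w)).2
    ⟨hc, ⟨h0, hN⟩, hP.derivPlus_mem hw.2 hD hc h0⟩

end DCLS

end Involutive

/-! ### Brackets of related vector fields -/

section Related

variable {E : Type*} [NormedAddCommGroup E] [NormedSpace ℝ E] [CompleteSpace E]
  {H : Type*} [TopologicalSpace H] {I : ModelWithCorners ℝ E H} [I.Boundaryless]
  {M : Type*} [TopologicalSpace M] [ChartedSpace H M] [IsManifold I ∞ M]
  {A : Type*} [NormedAddCommGroup A] [NormedSpace ℝ A] [CompleteSpace A]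
  {Q : Type*} [TopologicalSpace Q] [ChartedSpace A Q] [IsManifold 𝓘(ℝ, A) ∞ Q]
  {G : Type*} [NormedAddCommGroup G] [NormedSpace ℝ G]

omit [CompleteSpace E] [I.Boundaryless] [IsManifold I ∞ M] [CompleteSpace A]
  [IsManifold 𝓘(ℝ, A) ∞ Q] in
lemma fieldDeriv_comp_of_related {p : M → Q} {x : M} {X : ∀ x : M, TangentSpace I x}
    {ξ : ∀ q : Q, TangentSpace 𝓘(ℝ, A) q} {h : Q → G} (hp : MDifferentiableAt I 𝓘(ℝ, A) p x)
    (hh : MDifferentiableAt 𝓘(ℝ, A) 𝓘(ℝ, G) h (p x))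
    (hX : (mfderiv I 𝓘(ℝ, A) p x (X x) : A) = ξ (p x)) :
    fieldDeriv I (h ∘ p) X x = fieldDeriv 𝓘(ℝ, A) h ξ (p x) :=
  (congrArg (fun T : E →L[ℝ] G => T (X x)) (mfderiv_comp x hh hp)).trans
    (congrArg (fun a : A => (mfderiv 𝓘(ℝ, A) 𝓘(ℝ, G) h (p x) a : G)) hX)

/-- Lie brackets of related vector fields are related. -/
lemma mfderiv_mlieBracket_of_related {p : M → Q} {X Y : ∀ x : M, TangentSpace I x}
    {ξ η : ∀ q : Q, TangentSpace 𝓘(ℝ, A) q} {U : Set M} {W : Set Q} (hU : IsOpen U)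
    (hW : IsOpen W) (hUW : ∀ x ∈ U, p x ∈ W) (hp : ContMDiff I 𝓘(ℝ, A) ∞ p)
    (hX : SmoothFieldOn I X U) (hY : SmoothFieldOn I Y U) (hξ : SmoothFieldOn 𝓘(ℝ, A) ξ W)
    (hη : SmoothFieldOn 𝓘(ℝ, A) η W)
    (hXξ : ∀ x ∈ U, (mfderiv I 𝓘(ℝ, A) p x (X x) : A) = ξ (p x))
    (hYη : ∀ x ∈ U, (mfderiv I 𝓘(ℝ, A) p x (Y x) : A) = η (p x)) {x : M} (hx : x ∈ U) :
    (mfderiv I 𝓘(ℝ, A) p x (VectorField.mlieBracket I X Y x) : A) =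
      VectorField.mlieBracket 𝓘(ℝ, A) ξ η (p x) := by
  set φ := extChartAt 𝓘(ℝ, A) (p x) with hφ
  have hxs : p x ∈ φ.source := mem_extChartAt_source (p x)
  have hso : IsOpen φ.source := isOpen_extChartAt_source (p x)
  have hWo : IsOpen (W ∩ φ.source) := hW.inter hso
  have hUo : IsOpen (U ∩ p ⁻¹' φ.source) := hU.inter (hso.preimage hp.continuous)
  have hφs : ContMDiffOn 𝓘(ℝ, A) 𝓘(ℝ, A) ∞ φ φ.source := contMDiffOn_extChartAt' (p x)
  have hφd : ∀ q ∈ φ.source, MDifferentiableAt 𝓘(ℝ, A) 𝓘(ℝ, A) φ q := fun q hq =>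
    ((hφs q hq).contMDiffAt (hso.mem_nhds hq)).mdifferentiableAt (by simp)
  have hpd : ∀ y, MDifferentiableAt I 𝓘(ℝ, A) p y := fun y => (hp y).mdifferentiableAt (by simp)
  -- Iterated derivatives of φ ∘ p along the upper fields are those of φ along the lower ones, so
  -- the bracket identities above and below have the same right-hand side.
  have hsecond : ∀ (X' Y' : ∀ x : M, TangentSpace I x) (ξ' η' : ∀ q : Q, TangentSpace 𝓘(ℝ, A) q),
      SmoothFieldOn 𝓘(ℝ, A) η' W →
      (∀ x ∈ U, (mfderiv I 𝓘(ℝ, A) p x (X' x) : A) = ξ' (p x)) →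
      (∀ x ∈ U, (mfderiv I 𝓘(ℝ, A) p x (Y' x) : A) = η' (p x)) →
      fieldDeriv I (fieldDeriv I (φ ∘ p) Y') X' x =
        fieldDeriv 𝓘(ℝ, A) (fieldDeriv 𝓘(ℝ, A) φ η') ξ' (p x) := by
    intro X' Y' ξ' η' hη' hX' hY'
    have e : fieldDeriv I (φ ∘ p) Y' =ᶠ[𝓝 x] fieldDeriv 𝓘(ℝ, A) φ η' ∘ p := by
      filter_upwards [hUo.mem_nhds ⟨hx, hxs⟩] with y hy
      exact fieldDeriv_comp_of_related (hpd y) (hφd _ hy.2) (hY' y hy.1)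
    rw [fieldDeriv_congr e]
    refine fieldDeriv_comp_of_related (hpd x) ?_ (hX' x hx)
    exact ((contMDiffOn_fieldDeriv hWo (hφs.mono inter_subset_right) (hη'.mono inter_subset_left)
      _ ⟨hUW x hx, hxs⟩).contMDiffAt (hWo.mem_nhds ⟨hUW x hx, hxs⟩)).mdifferentiableAt (by simp)
  have h1 := fieldDeriv_mlieBracket hUo (hφs.comp hp.contMDiffOn fun y hy => hy.2)
    (hX.mono inter_subset_left) (hY.mono inter_subset_left) ⟨hx, hxs⟩
  have h2 := fieldDeriv_mlieBracket hWo (hφs.mono inter_subset_right) (hξ.mono inter_subset_left)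
    (hη.mono inter_subset_left) ⟨hUW x hx, hxs⟩
  rw [hsecond X Y ξ η hη hXξ hYη, hsecond Y X η ξ hξ hYη hXξ, ← h2] at h1
  refine mfderiv_extChartAt_injective hxs (Eq.trans ?_ h1)
  exact (congrArg (fun T : E →L[ℝ] A => T (VectorField.mlieBracket I X Y x))
    (mfderiv_comp x (hφd _ hxs) (hpd x))).symm

end Related

lemma isInvertible_of_injective {E E' : Type*} [NormedAddCommGroup E] [NormedSpace ℝ E]
    [FiniteDimensional ℝ E] [NormedAddCommGroup E'] [NormedSpace ℝ E'] [FiniteDimensional ℝ E']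
    {f : E →L[ℝ] E'} (hf : ∀ u, f u = 0 → u = 0)
    (hd : Module.finrank ℝ E = Module.finrank ℝ E') : f.IsInvertible :=
  ⟨(LinearMap.linearEquivOfInjective f.toLinearMap
    ((injective_iff_map_eq_zero f.toLinearMap).2 hf) hd).toContinuousLinearEquiv, by ext u; rfl⟩

/-! ### Lifting vector fields from `Q`; involutive variations force an involutive constraint -/

section Lift

variable {A : Type*} [NormedAddCommGroup A] [NormedSpace ℝ A] [FiniteDimensional ℝ A]
  {Q : Type*} [TopologicalSpace Q] [ChartedSpace A Q] [IsManifold 𝓘(ℝ, A) ∞ Q]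
  {B : Type*} [NormedAddCommGroup B] [NormedSpace ℝ B] [FiniteDimensional ℝ B]
  {V : Type*} [TopologicalSpace V] [ChartedSpace B V] [IsManifold 𝓘(ℝ, B) ∞ V]
  {F : ∀ q : Q, Submodule ℝ (TangentSpace 𝓘(ℝ, A) q)} {r N : ℕ}

omit [FiniteDimensional ℝ A] in
lemma contDiffAt_fieldDeriv_extChartAt_symm {ξ : ∀ q : Q, TangentSpace 𝓘(ℝ, A) q} {W : Set Q}
    (hW : IsOpen W) (hξ : SmoothFieldOn 𝓘(ℝ, A) ξ W) {q x : Q} (hx : x ∈ W)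
    (hxs : x ∈ (extChartAt 𝓘(ℝ, A) q).source) :
    ContDiffAt ℝ ∞ (fun z => fieldDeriv 𝓘(ℝ, A) (extChartAt 𝓘(ℝ, A) q) ξ
      ((extChartAt 𝓘(ℝ, A) q).symm z)) (extChartAt 𝓘(ℝ, A) q x) := by
  have hWo : IsOpen (W ∩ (extChartAt 𝓘(ℝ, A) q).source) := hW.inter (isOpen_extChartAt_source q)
  have hz := (extChartAt 𝓘(ℝ, A) q).map_source hxs
  have e := (extChartAt 𝓘(ℝ, A) q).left_inv hxs
  have h1 : ContMDiffAt 𝓘(ℝ, A) 𝓘(ℝ, A) ∞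
      (fieldDeriv 𝓘(ℝ, A) (extChartAt 𝓘(ℝ, A) q) ξ) x :=
    (contMDiffOn_fieldDeriv hWo ((contMDiffOn_extChartAt' q).mono inter_subset_right)
      (hξ.mono inter_subset_left) x ⟨hx, hxs⟩).contMDiffAt (hWo.mem_nhds ⟨hx, hxs⟩)
  have h2 : ContMDiffAt 𝓘(ℝ, A) 𝓘(ℝ, A) ∞ (extChartAt 𝓘(ℝ, A) q).symm
      (extChartAt 𝓘(ℝ, A) q x) :=
    (contMDiffOn_extChartAt_symm q _ hz).contMDiffAt ((isOpen_extChartAt_target q).mem_nhds hz)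
  rw [← contMDiffAt_iff_contDiffAt]
  exact ContMDiffAt.comp (extChartAt 𝓘(ℝ, A) q x) (by rwa [e]) h2

namespace DCLS

variable {S : DCLS A Q B V}

/-- Vector fields on `V[1,N]` can be prescribed by vector fields on `Q` to which they are related
by the maps `∂⁻(w(k))` and `∂⁺(w(k))`. -/
lemma exists_related_field (S : DCLS A Q B V) {ξm ξp : Fin N → ∀ q : Q, TangentSpace 𝓘(ℝ, A) q}
    {Wm Wp : Fin N → Set Q} (hWm : ∀ k, IsOpen (Wm k)) (hWp : ∀ k, IsOpen (Wp k))
    (hξm : ∀ k, SmoothFieldOn 𝓘(ℝ, A) (ξm k) (Wm k))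
    (hξp : ∀ k, SmoothFieldOn 𝓘(ℝ, A) (ξp k) (Wp k)) {w₀ : Fin N → V}
    (hm : ∀ k, S.dMinus (w₀ k) ∈ Wm k) (hp : ∀ k, S.dPlus (w₀ k) ∈ Wp k) :
    ∃ (X : ∀ w : Fin N → V, TangentSpace (powModel B N) w) (U : Set (Fin N → V)), IsOpen U ∧
      w₀ ∈ U ∧ SmoothFieldOn (powModel B N) X U ∧ ∀ w ∈ U, ∀ k,
        S.dMinus (w k) ∈ Wm k ∧ S.dPlus (w k) ∈ Wp k ∧
        S.derivMinus (w k) (fieldEntry X k w) = ξm k (S.dMinus (w k)) ∧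
        S.derivPlus (w k) (fieldEntry X k w) = ξp k (S.dPlus (w k)) := by
  let φm : Fin N → PartialEquiv Q A := fun k => extChartAt 𝓘(ℝ, A) (S.dMinus (w₀ k))
  let φp : Fin N → PartialEquiv Q A := fun k => extChartAt 𝓘(ℝ, A) (S.dPlus (w₀ k))
  -- Both projections of all entries, read in charts, serve as local coordinates: the derivative is
  -- injective since the kernels of T∂⁺ and T∂⁻ meet in zero, and the dimensions agree. The field is
  -- then prescribed in these coordinates.
  let Ψ : (Fin N → V) → (Fin N → A × A) := fun w k =>
    (φm k (S.dMinus (w k)), φp k (S.dPlus (w k)))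
  let U : Set (Fin N → V) := ⋂ k, ((fun w : Fin N → V => S.dMinus (w k)) ⁻¹' ((φm k).source ∩ Wm k)
    ∩ (fun w : Fin N → V => S.dPlus (w k)) ⁻¹' ((φp k).source ∩ Wp k))
  have hUo : IsOpen U := isOpen_iInter_of_finite fun k =>
    (((isOpen_extChartAt_source _).inter (hWm k)).preimage
      (S.smooth_dMinus.continuous.comp (continuous_apply k))).inter
    (((isOpen_extChartAt_source _).inter (hWp k)).preimage
      (S.smooth_dPlus.continuous.comp (continuous_apply k)))
  have hUm : ∀ w ∈ U, ∀ k, S.dMinus (w k) ∈ (φm k).source ∧ S.dMinus (w k) ∈ Wm k := fun w hw k =>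
    (mem_iInter.1 hw k).1
  have hUp : ∀ w ∈ U, ∀ k, S.dPlus (w k) ∈ (φp k).source ∧ S.dPlus (w k) ∈ Wp k := fun w hw k =>
    (mem_iInter.1 hw k).2
  have hsm : ∀ k, ContMDiffOn (powModel B N) 𝓘(ℝ, A) ∞ (fun w => φm k (S.dMinus (w k))) U :=
    fun k => (contMDiffOn_coord_entry S.smooth_dMinus _ k).mono fun w hw => (hUm w hw k).1
  have hsp : ∀ k, ContMDiffOn (powModel B N) 𝓘(ℝ, A) ∞ (fun w => φp k (S.dPlus (w k))) U :=
    fun k => (contMDiffOn_coord_entry S.smooth_dPlus _ k).mono fun w hw => (hUp w hw k).1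
  have hΨ : ContMDiffOn (powModel B N) 𝓘(ℝ, Fin N → A × A) ∞ Ψ U :=
    contMDiffOn_pi_space.2 fun k => (hsm k).prodMk_space (hsp k)
  have hΨd : ∀ w ∈ U, MDifferentiableAt (powModel B N) 𝓘(ℝ, Fin N → A × A) Ψ w := fun w hw =>
    ((hΨ w hw).contMDiffAt (hUo.mem_nhds hw)).mdifferentiableAt (by simp)
  have hder : ∀ (Z : ∀ w : Fin N → V, TangentSpace (powModel B N) w), ∀ w ∈ U, ∀ k,
      (fieldDeriv (powModel B N) Ψ Z w k).1 = (mfderiv 𝓘(ℝ, A) 𝓘(ℝ, A) (φm k) (S.dMinus (w k))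
        (S.derivMinus (w k) (fieldEntry Z k w)) : A) ∧
      (fieldDeriv (powModel B N) Ψ Z w k).2 = (mfderiv 𝓘(ℝ, A) 𝓘(ℝ, A) (φp k) (S.dPlus (w k))
        (S.derivPlus (w k) (fieldEntry Z k w)) : A) := by
    intro Z w hw k
    let c1 : (Fin N → A × A) →L[ℝ] A :=
      (ContinuousLinearMap.fst ℝ A A).comp (ContinuousLinearMap.proj k)
    let c2 : (Fin N → A × A) →L[ℝ] A :=
      (ContinuousLinearMap.snd ℝ A A).comp (ContinuousLinearMap.proj k)
    have h1 := fieldDeriv_comp (g := c1) c1.differentiableAt (hΨd w hw) Z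
    have h2 := fieldDeriv_comp (g := c2) c2.differentiableAt (hΨd w hw) Z
    rw [c1.fderiv] at h1
    rw [c2.fderiv] at h2
    exact ⟨h1.symm.trans (fieldDeriv_coord_entry S.smooth_dMinus (hUm w hw k).1 Z),
      h2.symm.trans (fieldDeriv_coord_entry S.smooth_dPlus (hUp w hw k).1 Z)⟩
  have hinv : ∀ w ∈ U, (mfderiv (powModel B N) 𝓘(ℝ, Fin N → A × A) Ψ w).IsInvertible := by
    intro w hw
    refine isInvertible_of_injective (E := Fin N → B) (E' := Fin N → A × A) (fun δ hδ => ?_) ?_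
    · have h := hder (fun _ => δ) w hw
      have h0 : fieldDeriv (powModel B N) Ψ (fun _ => δ) w = 0 := hδ
      rw [h0] at h
      refine funext fun k => derivMinus_derivPlus_injective (S := S) (v := w k) ?_ ?_
      · exact mfderiv_extChartAt_injective (hUm w hw k).1 ((h k).1.symm.trans (map_zero _).symm)
      · exact mfderiv_extChartAt_injective (hUp w hw k).1 ((h k).2.symm.trans (map_zero _).symm)
    · rw [Module.finrank_pi_fintype, Module.finrank_pi_fintype]
      refine Finset.sum_congr rfl fun _ _ => ?_
      rw [S.dim_eq, Module.finrank_prod]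
      ring
  let Ξ : (Fin N → A × A) → (Fin N → A × A) := fun z k =>
    (fieldDeriv 𝓘(ℝ, A) (φm k) (ξm k) ((φm k).symm (z k).1),
      fieldDeriv 𝓘(ℝ, A) (φp k) (ξp k) ((φp k).symm (z k).2))
  have hΞ : ∀ w ∈ U, ContDiffAt ℝ ∞ Ξ (Ψ w) := by
    intro w hw
    refine contDiffAt_pi.2 fun k => ContDiffAt.prodMk ?_ ?_
    · exact (contDiffAt_fieldDeriv_extChartAt_symm (hWm k) (hξm k) (hUm w hw k).2
        (hUm w hw k).1).comp (Ψ w) (f := fun z : Fin N → A × A => (z k).1) (by fun_prop)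
    · exact (contDiffAt_fieldDeriv_extChartAt_symm (hWp k) (hξp k) (hUp w hw k).2
        (hUp w hw k).1).comp (Ψ w) (f := fun z : Fin N → A × A => (z k).2) (by fun_prop)
  let X : ∀ w : Fin N → V, TangentSpace (powModel B N) w :=
    VectorField.mpullback (powModel B N) 𝓘(ℝ, Fin N → A × A) Ψ Ξ
  have hX : ∀ w ∈ U, fieldDeriv (powModel B N) Ψ X w = Ξ (Ψ w) := fun w hw =>
    (hinv w hw).self_apply_inverse _
  refine ⟨X, U, hUo, mem_iInter.2 fun k => ⟨⟨mem_extChartAt_source _, hm k⟩,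
    ⟨mem_extChartAt_source _, hp k⟩⟩, fun w hw => ContMDiffAt.contMDiffWithinAt ?_,
    fun w hw k => ⟨(hUm w hw k).2, (hUp w hw k).2, ?_, ?_⟩⟩
  · exact ContMDiffAt.mpullback_vectorField_preimage (n := ∞)
      (contMDiffAt_vectorSpace_iff_contDiffAt.2 (hΞ w hw))
      ((hΨ w hw).contMDiffAt (hUo.mem_nhds hw)) (hinv w hw) (by simp)
  · refine mfderiv_extChartAt_injective (hUm w hw k).1 ((hder X w hw k).1.symm.trans ?_)
    rw [hX w hw]
    exact congrArg (fieldDeriv 𝓘(ℝ, A) (φm k) (ξm k)) ((φm k).left_inv (hUm w hw k).1)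
  · refine mfderiv_extChartAt_injective (hUp w hw k).1 ((hder X w hw k).2.symm.trans ?_)
    rw [hX w hw]
    exact congrArg (fieldDeriv 𝓘(ℝ, A) (φp k) (ξp k)) ((φp k).left_inv (hUp w hw k).1)

/-- If the variations are involutive, then the constraint distribution is involutive. -/
theorem HasLinearConstraints.isInvolutive (hF : S.HasLinearConstraints F r)
    (hD : ∀ q : Q, ∃ v ∈ S.D, ∃ v' ∈ S.D, S.dPlus v = q ∧ S.dMinus v' = q) (hN : 2 ≤ N)
    (h : IsInvolutiveAlong (powModel B N) (S.firstOrder N) (S.constrained N) (S.variations N)) :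
    IsInvolutive 𝓘(ℝ, A) F := by
  intro W hW ξ η hξ hη hξF hηF q hq
  obtain ⟨a, ha, b, hb, haq, hbq⟩ := hD q
  obtain ⟨w₀, hw₀, hw₀a, hw₀b⟩ := exists_constrained (N := N) (S := S)
    (fun q => by
      obtain ⟨-, -, v, hv, -, h⟩ := hD q
      exact ⟨v, hv, h⟩) hN ha hb (haq.trans hbq.symm)
  set i : Fin N := ⟨0, by omega⟩ with hi
  set j : Fin N := ⟨1, by omega⟩ with hj
  have hlift : ∀ ζ : ∀ q : Q, TangentSpace 𝓘(ℝ, A) q, SmoothFieldOn 𝓘(ℝ, A) ζ W →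
      (∀ x ∈ W, ζ x ∈ F x) →
      ∃ (X : ∀ w : Fin N → V, TangentSpace (powModel B N) w) (U : Set (Fin N → V)), IsOpen U ∧
        w₀ ∈ U ∧ SmoothFieldOn (powModel B N) X U ∧ (∀ w ∈ U, S.dPlus (w i) ∈ W) ∧
        (∀ w ∈ U, S.derivPlus (w i) (fieldEntry X i w) = ζ (S.dPlus (w i))) ∧
        (∀ w ∈ U ∩ S.firstOrder N,
          (⟨w, X w⟩ : TangentBundle (powModel B N) (Fin N → V)) ∈
            tangentTo (powModel B N) (S.firstOrder N)) ∧
        (∀ w ∈ U ∩ S.constrained N,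
          (⟨w, X w⟩ : TangentBundle (powModel B N) (Fin N → V)) ∈ S.variations N) := by
    intro ζ hζ hζF
    -- ζ is placed at the junction of entries `i` and `j`, as T∂⁺ of the former and T∂⁻ of the
    -- latter; all other projections are zero.
    obtain ⟨X, U, hU, hw₀U, hX, hXU⟩ := S.exists_related_field
      (ξm := fun k => if k = j then ζ else fun _ => 0)
      (ξp := fun k => if k = i then ζ else fun _ => 0)
      (Wm := fun k => if k = j then W else univ) (Wp := fun k => if k = i then W else univ)
      (fun k => by split_ifs; exacts [hW, isOpen_univ])
      (fun k => by split_ifs; exacts [hW, isOpen_univ])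
      (fun k => by
        split_ifs
        exacts [hζ, (Bundle.contMDiff_zeroSection ℝ
          (TangentSpace 𝓘(ℝ, A) : Q → Type _)).contMDiffOn])
      (fun k => by
        split_ifs
        exacts [hζ, (Bundle.contMDiff_zeroSection ℝ
          (TangentSpace 𝓘(ℝ, A) : Q → Type _)).contMDiffOn]) (w₀ := w₀)
      (fun k => by
        split_ifs with hk
        · rw [hk, hw₀b, hbq]; exact hq
        · trivial)
      (fun k => by
        split_ifs with hk
        · rw [hk, hw₀a, haq]; exact hq
        · trivial)
    have hpi : ∀ w ∈ U, S.dPlus (w i) ∈ W ∧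
        S.derivPlus (w i) (fieldEntry X i w) = ζ (S.dPlus (w i)) := fun w hw => by
      obtain ⟨-, h1, -, h2⟩ := hXU w hw i
      simp only [if_true] at h1 h2
      exact ⟨h1, h2⟩
    have hmj : ∀ w ∈ U, S.derivMinus (w j) (fieldEntry X j w) = ζ (S.dMinus (w j)) :=
      fun w hw => by
        obtain ⟨-, -, h1, -⟩ := hXU w hw j
        simpa only [if_true] using h1
    have hp0 : ∀ w ∈ U, ∀ k, k ≠ i → S.derivPlus (w k) (fieldEntry X k w) = 0 :=
      fun w hw k hk => by
        obtain ⟨-, -, -, h1⟩ := hXU w hw k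
        simp only [if_neg hk] at h1
        exact h1
    have hm0 : ∀ w ∈ U, ∀ k, k ≠ j → S.derivMinus (w k) (fieldEntry X k w) = 0 :=
      fun w hw k hk => by
        obtain ⟨-, -, h1, -⟩ := hXU w hw k
        simp only [if_neg hk] at h1
        exact h1
    have hcompat : ∀ w ∈ U, w ∈ S.firstOrder N → ∀ k l : Fin N, (l : ℕ) = k + 1 →
        S.derivPlus (w k) (fieldEntry X k w) = S.derivMinus (w l) (fieldEntry X l w) := by
      intro w hw hwC k l hkl
      by_cases hk : k = i
      · have hl : l = j := Fin.ext (by rw [hkl, hk])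
        rw [hk, hl, (hpi w hw).2, hmj w hw]
        exact congrArg (fun q => (ζ q : A)) (hwC i j rfl)
      · have hl : l ≠ j := fun hl => hk (Fin.ext (by
          have := congrArg Fin.val hl
          simp only [hj, hi] at this ⊢
          omega))
        rw [hp0 w hw k hk, hm0 w hw l hl]
    refine ⟨X, U, hU, hw₀U, hX, fun w hw => (hpi w hw).1, fun w hw => (hpi w hw).2,
      fun w hw => (mem_tangentTo_firstOrder hw.2 (δ := X w)).2 (hcompat w hw.1 hw.2),
      fun w hw => (hF.mem_variations hw.2 (δ := X w)).2
        ⟨hcompat w hw.1 hw.2.1, ⟨fun k hk => ?_, fun k hk => ?_⟩, fun k => ?_⟩⟩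
    · exact hm0 w hw.1 k fun hkj => by
        have := congrArg Fin.val hkj
        simp only [hj] at this
        omega
    -- The last entry is not `i`, because N ≥ 2.
    · exact hp0 w hw.1 k fun hki => by
        have := congrArg Fin.val hki
        simp only [hi] at this
        omega
    · by_cases hk : k = i
      · subst hk
        have h1 := hζF _ (hpi w hw.1).1
        rw [← (hpi w hw.1).2] at h1
        exact h1
      · have h1 := hp0 w hw.1 k hk
        have h2 : (0 : A) ∈ F (S.dPlus (w k)) := (F _).zero_mem
        rw [← h1] at h2
        exact h2
  obtain ⟨X, U, hU, hw₀U, hX, hXW, hXp, hXC, hXV⟩ := hlift ξ hξ hξF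
  obtain ⟨Y, U', hU', hw₀U', hY, -, hYp, hYC, hYV⟩ := hlift η hη hηF
  have hbr := h (U ∩ U') (hU.inter hU') X Y (hX.mono inter_subset_left) (hY.mono inter_subset_right)
    (fun w hw => hXC w ⟨hw.1.1, hw.2⟩) (fun w hw => hYC w ⟨hw.1.2, hw.2⟩)
    (fun w hw => hXV w ⟨hw.1.1, hw.2⟩) (fun w hw => hYV w ⟨hw.1.2, hw.2⟩) w₀
    ⟨⟨hw₀U, hw₀U'⟩, hw₀⟩
  have h1 := ((hF.mem_variations hw₀ (δ := VectorField.mlieBracket (powModel B N) X Y w₀)).1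
    hbr).2.2 i
  have hpd : ∀ (Z : ∀ w : Fin N → V, TangentSpace (powModel B N) w) (w : Fin N → V),
      (mfderiv (powModel B N) 𝓘(ℝ, A) (fun w : Fin N → V => S.dPlus (w i)) w (Z w) : A) =
        S.derivPlus (w i) (fieldEntry Z i w) := by
    intro Z w
    have h2 := mfderiv_comp (I := powModel B N) (I' := 𝓘(ℝ, B)) (I'' := 𝓘(ℝ, A)) w
      ((S.smooth_dPlus (w i)).mdifferentiableAt (by simp))
      ((contMDiff_eval i w).mdifferentiableAt (by simp))
    refine (congrArg (fun T : (Fin N → B) →L[ℝ] A => T (Z w)) h2).trans ?_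
    exact congrArg (fun T : (Fin N → B) →L[ℝ] B => S.derivPlus (w i) (T (Z w))) (mfderiv_eval i w)
  -- The lifts are related to ξ and η on a whole open set, not merely on constrained sequences, so
  -- their bracket projects to that of ξ and η.
  have h3 := mfderiv_mlieBracket_of_related (p := fun w : Fin N → V => S.dPlus (w i))
    (hU.inter hU') hW (fun w hw => hXW w hw.1) (S.smooth_dPlus.comp (contMDiff_eval i))
    (hX.mono inter_subset_left) (hY.mono inter_subset_right) hξ hη
    (fun w hw => (hpd X w).trans (hXp w hw.1)) (fun w hw => (hpd Y w).trans (hYp w hw.2))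
    ⟨hw₀U, hw₀U'⟩
  have h4 := (hpd (VectorField.mlieBracket (powModel B N) X Y) w₀).symm.trans h3
  have hq' : S.dPlus (w₀ i) = q := by rw [hw₀a, haq]
  subst hq'
  exact (congrArg (fun a : A => a ∈ F (S.dPlus (w₀ i))) h4).mp h1

end DCLS

end Lift

end

end DiscreteMechanics

/-! ### The equivalence of the four statements -/

theorem mainTheorem6
    {A : Type*} [NormedAddCommGroup A] [NormedSpace ℝ A] [FiniteDimensional ℝ A]
    {Q : Type*} [TopologicalSpace Q] [ChartedSpace A Q] [IsManifold 𝓘(ℝ, A) ∞ Q]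
    [T2Space Q] [SecondCountableTopology Q]
    {B : Type*} [NormedAddCommGroup B] [NormedSpace ℝ B] [FiniteDimensional ℝ B]
    {V : Type*} [TopologicalSpace V] [ChartedSpace B V] [IsManifold 𝓘(ℝ, B) ∞ V]
    [T2Space V] [SecondCountableTopology V]
    (S : DiscreteMechanics.DCLS A Q B V)
    (F : ∀ q : Q, Submodule ℝ (TangentSpace 𝓘(ℝ, A) q)) (r : ℕ)
    (hF : S.HasLinearConstraints F r)
    (hD : ∀ q : Q, ∃ v ∈ S.D, ∃ v' ∈ S.D, S.dPlus v = q ∧ S.dMinus v' = q)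
    (N : ℕ) (hN : 2 ≤ N) :
    List.TFAE [
      DiscreteMechanics.IsInvolutive 𝓘(ℝ, A) F,
      DiscreteMechanics.IsInvolutiveAlong (DiscreteMechanics.powModel B N)
        (S.firstOrder N) (S.constrained N) (S.variations N),
      S.variations N =
        {δ | δ ∈ DiscreteMechanics.tangentTo (DiscreteMechanics.powModel B N) (S.constrained N) ∧
          δ ∈ S.fixedEndpoints N},
      S.variations N ⊆
        DiscreteMechanics.tangentTo (DiscreteMechanics.powModel B N) (S.constrained N)] := by
  tfae_have 1 → 4 := fun h => by
    rw [hF.variations_eq (hF.transportsConstraint_of_isInvolutive h)]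
    exact fun _ hδ => hδ.1
  tfae_have 4 → 3 := fun h =>
    hF.variations_eq (hF.transportsConstraint_of_variations_subset hD hN h)
  tfae_have 3 → 4 := fun h => h.trans_subset fun _ hδ => hδ.1
  tfae_have 4 → 2 := fun h =>
    hF.isInvolutiveAlong (hF.transportsConstraint_of_variations_subset hD hN h)
  tfae_have 2 → 1 := hF.isInvolutive hD hN
  tfae_finish
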